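/- Let $q(x)=x^5+Ax^2+Bx+C$ with $A,B,C\in\mathbb Q$ and $A^4-5B^3+25ABC\neq 0$. Let $\mathrm{Disc}(q)$ be its discriminant and $L\subset\overline{\mathbb Q}$ its splitting field. Put \[ \begin{aligned} 5^4\,\delta &= A^4-5B^3+25ABC,\\ 12^2\,5^5\,\gamma_4 &= 128A^4B^2-192A^5C-600AB^3C+1000A^2BC^2-144B^5+3125C^4,\\ 12^3\,5^{10}\,\gamma_6 &= 1728A^{10}+10400A^6B^3+405000A^2B^6-180000A^7BC-1170000A^3B^4C+1725000A^4B^2C^2\\&\quad-1800000A^5C^3+2812500AB^3C^3-4687500A^2BC^4-2025000B^5C^2-9765625C^6 .\end{aligned}\] (1) Let $\zeta_5\in\overline{\mathbb Q}$ be a primitive fifth root of unity, $\varepsilon=\zeta_5+\zeta_5^4$, and consider the fractional linear transformations $Sz=\zeta_5z$, $Tz=\frac{\varepsilon z+1}{z-\varepsilon}$, $Uz=-\frac1z$ and the rational functions \[ \lambda(z)=\frac{(z^2+1)^2(z^2-2\varepsilon z-1)^2(z^2+2\varepsilon^{-1}z-1)^2}{-z(z^{10}+11z^5-1)},\qquad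 \mu(z)=\frac{-125z^5}{z^{10}+11z^5-1}. \] Then $\langle S,T,U\rangle\simeq A_5$, and the rational function \[ j(z)=(\lambda+3)^3(\lambda^2+11\lambda+64)=\frac{(\mu^2+10\mu+5)^3}{\mu} \] is invariant under $\langle S,T,U\rangle$. For all $m,n\in\overline{\mathbb Q}$, the resolvents ($\nu=0,\dots,4$) \[ x_\nu=\frac{m}{\lambda(\zeta_5^\nu z)+3}+\frac{12\,n}{\left[\lambda(\zeta_5^\nu z)+3\right]\left[\lambda(\zeta_5^\nu z)^2+10\lambda(\zeta_5^\nu z)+45\right]} \] are the roots of $x^5+A_{m,n,j}x^2+B_{m,n,j}x+C_{m,n,j}$, i.e. this polynomial equals $\prod_{\nu}(x-x_\nu)$ over $\overline{\mathbb Q}(z)$, where $j=j(z)$ and \[ \begin{aligned} A_{m,n,j}&=-\frac{20}{j}\left[(2m^3+3m^2n)+432\,\frac{6mn^2+n^3}{1728-j}\right],\\ B_{m,n,j}&=-\frac5j\left[m^4-864\,\frac{3m^2n^2+2mn^3}{1728-j}-559872\,\frac{n^4}{(1728-j)^2}\right],\\ C_{m,n,j}&=-\frac1j\left[m^5-1440\,\frac{m^3n^2}{1728-j}+62208\,\frac{15mn^4+4n^5}{(1728-j)^2}\right].\end{aligned}\]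 (2) Assume that the quadratic polynomial $\delta^5X^2-1728(\gamma_4^3-\gamma_6^2+\delta^5)X+1728^2\gamma_4^3$ has a root in $\overline{\mathbb Q}$ different from $0$ and $1728$; equivalently, that none of the following holds: $\gamma_4=0$ and $\gamma_6^2=\delta^5$; $\gamma_6=0$ and $\gamma_4^3=\delta^5$; $\gamma_4=\gamma_6=0$. Then there exist $m,n,j\in\mathbb Q(\sqrt{5\,\mathrm{Disc}(q)})$ with $j\ne0,1728$ such that $A=A_{m,n,j}$, $B=B_{m,n,j}$ and $C=C_{m,n,j}$. (3) Assume $\mathrm{Disc}(q)\neq0$. Then there exists an elliptic curve $E$, given by a Weierstrass equation over $K=\mathbb Q(\sqrt{5\,\mathrm{Disc}(q)})$, such that $L(\sqrt{5\,\mathrm{Disc}(q)})$ is the field generated over $K$ by the sums $x_P+x_{2P}$ of $x$-coordinates, where $P$ runs over the non-zero $5$-torsion points of $E$ over $\overline{\mathbb Q}$. -/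

import Mathlib

open scoped MatrixGroups

noncomputable section

/-- A fixed algebraic closure of the rationals; every number field below is a subfield of it. -/
abbrev Qbar : Type := AlgebraicClosure ℚ

namespace Icosahedral

/-! ### The icosahedral group and Klein's function

`ζ` stands for a primitive fifth root of unity throughout. -/

/-- `ε = ζ + ζ⁴`. -/
def eps (ζ : Qbar) : Qbar := ζ + ζ ^ 4

/-- Matrix of `S z = ζ z`. -/
def matS (ζ : Qbar) : Matrix (Fin 2) (Fin 2) Qbar := !![ζ, 0; 0, 1]

/-- Matrix of `T z = (ε z + 1) / (z - ε)`. -/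
def matT (ζ : Qbar) : Matrix (Fin 2) (Fin 2) Qbar := !![eps ζ, 1; 1, -eps ζ]

/-- Matrix of `U z = -1 / z`. -/
def matU : Matrix (Fin 2) (Fin 2) Qbar := !![0, -1; 1, 0]

/-- The group `⟨S, T, U⟩` of fractional linear transformations, as a subgroup of `PGL₂`. -/
def icosahedralGroup (ζ : Qbar) : Subgroup PGL(2, Qbar) :=
  Subgroup.closure
    (Matrix.ProjGenLinGroup.mk ''
      {M : GL (Fin 2) Qbar | M.val = matS ζ ∨ M.val = matT ζ ∨ M.val = matU})

/-- The fractional linear transformation `(a z + b) / (c z + d)` as a rational function of `z`. -/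
def moebius (M : GL (Fin 2) Qbar) : RatFunc Qbar :=
  (RatFunc.C (M.val 0 0) * RatFunc.X + RatFunc.C (M.val 0 1)) /
    (RatFunc.C (M.val 1 0) * RatFunc.X + RatFunc.C (M.val 1 1))

/-- The composition `f (g z)` of rational functions (used only for non-constant `g`). -/
def comp (f g : RatFunc Qbar) : RatFunc Qbar := RatFunc.eval RatFunc.C g f

/-- The function `λ(z)`. -/
def lam (ζ : Qbar) : RatFunc Qbar :=
  (RatFunc.X ^ 2 + 1) ^ 2 *
      (RatFunc.X ^ 2 - 2 * RatFunc.C (eps ζ) * RatFunc.X - 1) ^ 2 *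
      (RatFunc.X ^ 2 + 2 * RatFunc.C (eps ζ)⁻¹ * RatFunc.X - 1) ^ 2 /
    (-RatFunc.X * (RatFunc.X ^ 10 + 11 * RatFunc.X ^ 5 - 1))

/-- The function `μ(z)`. -/
def mu : RatFunc Qbar :=
  -125 * RatFunc.X ^ 5 / (RatFunc.X ^ 10 + 11 * RatFunc.X ^ 5 - 1)

/-- Klein's function `j(z) = (λ + 3)³ (λ² + 11 λ + 64)`. -/
def kleinJ (ζ : Qbar) : RatFunc Qbar :=
  (lam ζ + 3) ^ 3 * (lam ζ ^ 2 + 11 * lam ζ + 64)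

/-- The resolvent
`x_ν = m / (λ(ζ^ν z) + 3) + 12 n / ((λ(ζ^ν z) + 3) (λ(ζ^ν z)² + 10 λ(ζ^ν z) + 45))`. -/
def resolvent (ζ m n : Qbar) (ν : Fin 5) : RatFunc Qbar :=
  let l := comp (lam ζ) (RatFunc.C (ζ ^ (ν : ℕ)) * RatFunc.X)
  RatFunc.C m / (l + 3) + 12 * RatFunc.C n / ((l + 3) * (l ^ 2 + 10 * l + 45))

/-! ### The coefficients of the resolvent quintic -/

/-- `A_{m,n,j}` -/
def coeffA {k : Type*} [Field k] (m n j : k) : k :=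
  -(20 / j) * ((2 * m ^ 3 + 3 * m ^ 2 * n) +
    432 * ((6 * m * n ^ 2 + n ^ 3) / (1728 - j)))

/-- `B_{m,n,j}` -/
def coeffB {k : Type*} [Field k] (m n j : k) : k :=
  -(5 / j) * (m ^ 4 - 864 * ((3 * m ^ 2 * n ^ 2 + 2 * m * n ^ 3) / (1728 - j)) -
    559872 * (n ^ 4 / (1728 - j) ^ 2))

/-- `C_{m,n,j}` -/
def coeffC {k : Type*} [Field k] (m n j : k) : k :=
  -(1 / j) * (m ^ 5 - 1440 * (m ^ 3 * n ^ 2 / (1728 - j)) +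
    62208 * ((15 * m * n ^ 4 + 4 * n ^ 5) / (1728 - j) ^ 2))

/-! ### The quintic and its invariants -/

/-- The quintic `x⁵ + a x² + b x + c`. -/
def quintic {R : Type*} [CommRing R] (a b c : R) : Polynomial R :=
  Polynomial.X ^ 5 + Polynomial.C a * Polynomial.X ^ 2 + Polynomial.C b * Polynomial.X +
    Polynomial.C c

/-- The invariant `δ`. -/
def delta (a b c : ℚ) : ℚ := (a ^ 4 - 5 * b ^ 3 + 25 * a * b * c) / 5 ^ 4

/-- The invariant `γ₄`. -/
def gamma4 (a b c : ℚ) : ℚ :=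
  (128 * a ^ 4 * b ^ 2 - 192 * a ^ 5 * c - 600 * a * b ^ 3 * c + 1000 * a ^ 2 * b * c ^ 2
    - 144 * b ^ 5 + 3125 * c ^ 4) / (12 ^ 2 * 5 ^ 5)

/-- The invariant `γ₆`. -/
def gamma6 (a b c : ℚ) : ℚ :=
  (1728 * a ^ 10 + 10400 * a ^ 6 * b ^ 3 + 405000 * a ^ 2 * b ^ 6 - 180000 * a ^ 7 * b * c
    - 1170000 * a ^ 3 * b ^ 4 * c + 1725000 * a ^ 4 * b ^ 2 * c ^ 2 - 1800000 * a ^ 5 * c ^ 3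
    + 2812500 * a * b ^ 3 * c ^ 3 - 4687500 * a ^ 2 * b * c ^ 4
    - 2025000 * b ^ 5 * c ^ 2 - 9765625 * c ^ 6) / (12 ^ 3 * 5 ^ 10)

/-- The quadratic `δ⁵ X² - 1728 (γ₄³ - γ₆² + δ⁵) X + 1728² γ₄³` does not have all its roots in
`{0, 1728}`: its roots are not `0, 0`, nor `1728, 1728`, nor `0, 1728` (for `δ ≠ 0`). -/
def IsNondegenerate (a b c : ℚ) : Prop :=
  ¬(gamma4 a b c = 0 ∧ gamma6 a b c ^ 2 = delta a b c ^ 5) ∧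
  ¬(gamma6 a b c = 0 ∧ gamma4 a b c ^ 3 = delta a b c ^ 5) ∧
  ¬(gamma4 a b c = 0 ∧ gamma6 a b c = 0)

/-! ### Five-torsion -/

open scoped Classical in
/-- The set of all sums `x_P + x_{2P}` of `x`-coordinates, where `P` runs over the non-zero
`5`-torsion points of a Weierstrass curve over `Qbar`. -/
def fiveTorsionSums (W : WeierstrassCurve Qbar) : Set Qbar :=
  {s | ∃ (x y x' y' : Qbar) (h : W.toAffine.Nonsingular x y)
      (h' : W.toAffine.Nonsingular x' y'),
    5 • WeierstrassCurve.Affine.Point.some x y h = 0 ∧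
    2 • WeierstrassCurve.Affine.Point.some x y h =
      WeierstrassCurve.Affine.Point.some x' y' h' ∧
    s = x + x'}

end Icosahedral

end

/-! Everything is expressed through Klein's icosahedral forms f, H, T (`formF`, `formH`, `formT`),
with T² = H³ + 1728 f⁵, and the octahedral form t (`formO`): λ = -t²/f, j = -H³/f⁵ and 1728 - j =
T²/f⁵.

Resolvents. Up to a common factor the five x_ν are rotates, under z ↦ ζz, of one expression whose
Fourier components are 0, A, zA, C, -zC. The zeroth component kills the x⁴ term and A·(-zC) + zA·C =
0 kills the x³ term; `circulant_product` gives the other coefficients, which are polynomials in f,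
H, T. The group ⟨S, T, U⟩ permutes the five λ(ζ^ν z). This action is faithful because z is a
quotient of two Fourier coefficients of the resolvents, and the induced permutations generate A₅.

Inversion. The parameters m, n, j are written down explicitly as x + y√(5 Disc). The two signs of
the square root give both roots j of the quadratic; if each lies in {0, 1728}, the trace and norm of
j (`jRat_eq`, `jRat_sq`) force one of the excluded cases.

Elliptic curve. For a resolvent quintic choose z with j(z) = j and take y² = x³ + 3κx + 2κ with κ =
j/(1728 - j). The sums x_P + x_{2P} are the roots of `torsionSextic`, which `torsionSextic_forms`
splits by explicit forms in z. Sums of products of these roots over pairings of the six indices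
recover the λ(ζ^ν z), hence the x_ν. Conversely, an automorphism fixing the x_ν and √(5 Disc) fixes
√5, so it sends (ζ, z) to itself or to (ζ⁴, -1/z), and both choices preserve the sextic roots
(`map_sexticRoot_eq_of_fixed`). An arbitrary separable quintic is first made non-degenerate by a
Tschirnhaus transformation that keeps the splitting field and changes the discriminant by a rational
square (`exists_nondegenerate_quintic`). -/

noncomputable section

namespace Icosahedral

/-! ### Quintics whose roots are given by Fourier components -/

section Circulant

variable {F : Type*} [CommRing F]

/-- The factors for ζ and ζ⁻¹ are exchanged by ζ ↦ ζ⁴, so their product involves only η = ζ + ζ⁴ and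
its conjugate ζ² + ζ³ = -1 - η. -/
theorem circulant_pair {ζ : F} (h : 1 + ζ + ζ ^ 2 + ζ ^ 3 + ζ ^ 4 = 0) (y a b c d : F) :
    (y - (a * ζ + b * ζ ^ 2 + c * ζ ^ 3 + d * ζ ^ 4)) *
      (y - (a * ζ ^ 4 + b * ζ ^ 3 + c * ζ ^ 2 + d * ζ)) =
    y ^ 2 - ((a + d) * (ζ + ζ ^ 4) + (b + c) * (-1 - (ζ + ζ ^ 4))) * y +
      (a ^ 2 + b ^ 2 + c ^ 2 + d ^ 2 + (a * b + b * c + c * d) * (ζ + ζ ^ 4) +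
        (a * c + b * d + a * d) * (-1 - (ζ + ζ ^ 4))) := by
  grind

theorem conjugate_quadratics {η : F} (h : η ^ 2 + η - 1 = 0) (y p q r u v : F) :
    (y ^ 2 - (p * η + q * (-1 - η)) * y + (r + u * η + v * (-1 - η))) *
      (y ^ 2 - (p * (-1 - η) + q * η) * y + (r + u * (-1 - η) + v * η)) =
    y ^ 4 + (p + q) * y ^ 3 + (2 * r - u - v - p ^ 2 - q ^ 2 + 3 * p * q) * y ^ 2 +
      ((p + q) * r + 2 * p * u - 3 * p * v - 3 * q * u + 2 * q * v) * y +
      (r ^ 2 - r * (u + v) - u ^ 2 - v ^ 2 + 3 * u * v) := by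
  linear_combination -(y * (p - q) - (u - v)) ^ 2 * h

theorem circulant_product {ζ : F} (h : 1 + ζ + ζ ^ 2 + ζ ^ 3 + ζ ^ 4 = 0) (y a b c d : F) :
    (y - (a + b + c + d)) *
      (y - (a * ζ + b * ζ ^ 2 + c * ζ ^ 3 + d * ζ ^ 4)) *
      (y - (a * ζ ^ 2 + b * ζ ^ 4 + c * ζ + d * ζ ^ 3)) *
      (y - (a * ζ ^ 3 + b * ζ + c * ζ ^ 4 + d * ζ ^ 2)) *
      (y - (a * ζ ^ 4 + b * ζ ^ 3 + c * ζ ^ 2 + d * ζ)) =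
    y ^ 5 - 5 * (a * d + b * c) * y ^ 3 -
      5 * (a ^ 2 * c + b ^ 2 * a + c ^ 2 * d + d ^ 2 * b) * y ^ 2 -
      5 * (a ^ 3 * b + b ^ 3 * d + c ^ 3 * a + d ^ 3 * c - a ^ 2 * d ^ 2 - b ^ 2 * c ^ 2
        + a * b * c * d) * y -
      (a ^ 5 + b ^ 5 + c ^ 5 + d ^ 5 - 5 * (a ^ 3 * c * d + b ^ 3 * a * c + c ^ 3 * b * d
        + d ^ 3 * a * b) + 5 * (a ^ 2 * b ^ 2 * d + b ^ 2 * d ^ 2 * c + c ^ 2 * a ^ 2 * b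
        + d ^ 2 * c ^ 2 * a)) := by
  have h5 : ζ ^ 5 = 1 := by linear_combination (ζ - 1) * h
  have hη : (ζ + ζ ^ 4) ^ 2 + (ζ + ζ ^ 4) - 1 = 0 := by grind
  have h1 := circulant_pair h y a b c d
  -- Passing from ζ to ζ² exchanges η and -1 - η, so the two quadratic factors are conjugate and
  -- `conjugate_quadratics` multiplies them.
  have h2 := circulant_pair (ζ := ζ ^ 2) (by grind) y a b c d
  have e2 : ζ ^ 2 + (ζ ^ 2) ^ 4 = -1 - (ζ + ζ ^ 4) := by grind
  have e3 : (ζ ^ 2) ^ 2 = ζ ^ 4 := by ring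
  have e4 : (ζ ^ 2) ^ 3 = ζ := by grind
  have e5 : (ζ ^ 2) ^ 4 = ζ ^ 3 := by grind
  rw [e2, e3, e4, e5] at h2
  generalize ζ + ζ ^ 4 = η at *
  have regroup (p q r s t : F) : p * q * r * s * t = p * (q * t) * (r * s) := by ring
  calc _ = (y - (a + b + c + d)) * ((y - (a * ζ + b * ζ ^ 2 + c * ζ ^ 3 + d * ζ ^ 4)) *
      (y - (a * ζ ^ 4 + b * ζ ^ 3 + c * ζ ^ 2 + d * ζ))) *
      ((y - (a * ζ ^ 2 + b * ζ ^ 4 + c * ζ + d * ζ ^ 3)) *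
      (y - (a * ζ ^ 3 + b * ζ + c * ζ ^ 4 + d * ζ ^ 2))) := regroup _ _ _ _ _
    _ = _ := by
      rw [h1, h2, mul_assoc, show -1 - (-1 - η) = η by ring, conjugate_quadratics hη]
      ring

end Circulant

/-! ### Icosahedral forms and the resolvent quintic -/

section Forms

variable {F : Type*}

/-- The vertex form `f`. -/
def formF [CommRing F] (z : F) : F := z * (z ^ 10 + 11 * z ^ 5 - 1)

/-- The face form `H`. -/
def formH [CommRing F] (z : F) : F := z ^ 20 - 228 * z ^ 15 + 494 * z ^ 10 + 228 * z ^ 5 + 1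

/-- The edge form `T`. -/
def formT [CommRing F] (z : F) : F :=
  z ^ 30 + 522 * z ^ 25 - 10005 * z ^ 20 - 10005 * z ^ 10 - 522 * z ^ 5 + 1

/-- The octahedral form `t` of degree six. -/
def formO [CommRing F] (z : F) : F := (z ^ 2 + 1) * (z ^ 4 + 2 * z ^ 3 - 6 * z ^ 2 - 2 * z + 1)

/-- The form `W` of degree eight. -/
def formW [CommRing F] (z : F) : F :=
  z ^ 8 - z ^ 7 + 7 * z ^ 6 + 7 * z ^ 5 - 7 * z ^ 3 + 7 * z ^ 2 + z + 1

theorem formW_mul [CommRing F] (z : F) :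
    formW z * (formO z ^ 2 - 3 * formF z) = formH z := by
  simp only [formW, formO, formF, formH]; ring

theorem formO_mul [CommRing F] (z : F) :
    formO z * (formO z ^ 4 - 10 * formF z * formO z ^ 2 + 45 * formF z ^ 2) = formT z := by
  simp only [formT, formO, formF]; ring

theorem formT_sq [CommRing F] (z : F) : formT z ^ 2 = formH z ^ 3 + 1728 * formF z ^ 5 := by
  simp only [formT, formH, formF]; ring

theorem formW_cube [CommRing F] (z : F) :
    formW z ^ 3 = formO z ^ 4 - 11 * formF z * formO z ^ 2 + 64 * formF z ^ 2 := by
  simp only [formW, formO, formF]; ring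

/-- First component of the discrete Fourier transform of the pencil spanned by `W` and `t W`. -/
def pencilA [CommRing F] (z α γ : F) : F :=
  z * (α * (1 + 7 * z ^ 5) + γ * z ^ 3 * (z ^ 10 - 39 * z ^ 5 - 26))

/-- Third component of the discrete Fourier transform of the pencil spanned by `W` and `t W`. -/
def pencilC [CommRing F] (z α γ : F) : F :=
  z * (α * z ^ 2 * (7 - z ^ 5) + γ * (1 + 39 * z ^ 5 - 26 * z ^ 10))

theorem pencil_sum [CommRing F] (z α γ : F) :
    pencilA z α γ + z * pencilA z α γ + pencilC z α γ + -z * pencilC z α γ =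
      z * formW z * (α + γ * formO z) := by
  simp only [pencilA, pencilC, formW, formO]; ring

/-- This is the y² coefficient of `circulant_product`, up to the factor -5, at the components A, zA,
C, -zC. The next two identities play the same role for the y and constant coefficients. Only f, H, T
occur on the right, which is why the quintic depends on z through j alone. -/
theorem pencil_cubic [CommRing F] (z α γ : F) :
    pencilA z α γ ^ 2 * pencilC z α γ + z ^ 2 * pencilA z α γ ^ 3 - z * pencilC z α γ ^ 3 +
        z ^ 3 * pencilA z α γ * pencilC z α γ ^ 2 =
      z ^ 3 * (8 * formF z ^ 2 * α ^ 3 + formT z * α ^ 2 * γ + 72 * formF z ^ 3 * α * γ ^ 2 +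
        formF z * formT z * γ ^ 3) := by
  simp only [pencilA, pencilC, formF, formT]; ring

theorem pencil_quartic [CommRing F] (z α γ : F) :
    z * pencilA z α γ ^ 4 - z ^ 4 * pencilA z α γ ^ 3 * pencilC z α γ +
        pencilA z α γ * pencilC z α γ ^ 3 - z ^ 3 * pencilC z α γ ^ 4 -
        3 * z ^ 2 * pencilA z α γ ^ 2 * pencilC z α γ ^ 2 =
      -z ^ 4 * formH z * (formF z * α ^ 4 - 18 * formF z ^ 2 * α ^ 2 * γ ^ 2 -
        formT z * α * γ ^ 3 - 27 * formF z ^ 3 * γ ^ 4) := by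
  simp only [pencilA, pencilC, formF, formH, formT]; ring

theorem pencil_quintic [CommRing F] (z α γ : F) :
    (1 + z ^ 5) * pencilA z α γ ^ 5 + (1 - z ^ 5) * pencilC z α γ ^ 5 +
        10 * z * pencilA z α γ ^ 3 * pencilC z α γ ^ 2 - 10 * z ^ 3 * pencilA z α γ ^ 4 * pencilC z α γ +
        10 * z ^ 2 * pencilA z α γ * pencilC z α γ ^ 4 + 10 * z ^ 4 * pencilA z α γ ^ 2 * pencilC z α γ ^ 3 =
      z ^ 5 * formH z ^ 2 * (α ^ 5 - 10 * formF z * α ^ 3 * γ ^ 2 +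
        45 * formF z ^ 2 * α * γ ^ 4 + formT z * γ ^ 5) := by
  simp only [pencilA, pencilC, formF, formH, formT]; ring

theorem formF_rotate [CommRing F] {ζ : F} (h : ζ ^ 5 = 1) (z : F) :
    formF (ζ * z) = ζ * formF z := by
  have h10 : ζ ^ 10 = 1 := by linear_combination (ζ ^ 5 + 1) * h
  simp only [formF, mul_pow, h, h10]; ring

theorem formH_rotate [CommRing F] {ζ : F} (h : ζ ^ 5 = 1) (z : F) : formH (ζ * z) = formH z := by
  have e (k : ℕ) : ζ ^ (5 * k) = 1 := by rw [pow_mul, h, one_pow]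
  simp only [formH, mul_pow, h, show ζ ^ 10 = 1 from e 2, show ζ ^ 15 = 1 from e 3,
    show ζ ^ 20 = 1 from e 4, one_mul]

theorem formT_rotate [CommRing F] {ζ : F} (h : ζ ^ 5 = 1) (z : F) : formT (ζ * z) = formT z := by
  have e (k : ℕ) : ζ ^ (5 * k) = 1 := by rw [pow_mul, h, one_pow]
  simp only [formT, mul_pow, h, show ζ ^ 10 = 1 from e 2, show ζ ^ 25 = 1 from e 5,
    show ζ ^ 20 = 1 from e 4, show ζ ^ 30 = 1 from e 6, one_mul]

/-- Sorting zW(z) and zW(z)t(z) by exponents modulo 5 gives the four components. The factor ζ² on γ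
is the one that f² acquires under rotation; it brings the second family to the same weights as the
first. -/
theorem formW_rotate [CommRing F] {ζ : F} (h : ζ ^ 5 = 1) (z α γ : F) :
    ζ * z * formW (ζ * z) * (α + ζ ^ 2 * γ * formO (ζ * z)) =
      ζ * pencilA z α γ + ζ ^ 2 * (z * pencilA z α γ) + ζ ^ 3 * pencilC z α γ +
        ζ ^ 4 * (-z * pencilC z α γ) := by
  have e (k : ℕ) : ζ ^ (5 * k) = 1 := by rw [pow_mul, h, one_pow]
  have hp := pencil_sum (ζ * z) α (ζ ^ 2 * γ)
  rw [← hp]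
  simp only [pencilA, pencilC, mul_pow, h, show ζ ^ 10 = 1 from e 2]
  linear_combination z * (γ * z ^ 3 * (z ^ 10 - 39 * z ^ 5 - 26) * (ζ + ζ ^ 2 * z) ) * h

/-- The value `λ(z)`. -/
def lamVal [Field F] (z : F) : F := -formO z ^ 2 / formF z

/-- The value of the resolvent belonging to `λ(z)`. -/
def resVal [Field F] (m n z : F) : F :=
  m / (lamVal z + 3) +
    12 * n / ((lamVal z + 3) * (lamVal z ^ 2 + 10 * lamVal z + 45))

/-- The value `j(z)`. -/
def jVal [Field F] (z : F) : F := -formH z ^ 3 / formF z ^ 5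

variable [Field F] {z : F}

theorem lamVal_add_three (hf : formF z ≠ 0) (hH : formH z ≠ 0) :
    1 / (lamVal z + 3) = -(formF z * formW z) / formH z := by
  have h := formW_mul z
  have h1 : formO z ^ 2 - 3 * formF z ≠ 0 := fun h0 => hH (by rw [← h, h0, mul_zero])
  have h2 : lamVal z + 3 = -(formO z ^ 2 - 3 * formF z) / formF z := by
    rw [lamVal]; field_simp; ring
  rw [h2, div_eq_div_iff (div_ne_zero (neg_ne_zero.mpr h1) hf) hH, ← h]
  field_simp

theorem lamVal_quadratic (hf : formF z ≠ 0) (hT : formT z ≠ 0) :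
    1 / (lamVal z ^ 2 + 10 * lamVal z + 45) = formF z ^ 2 * formO z / formT z := by
  have h := formO_mul z
  have h1 : formO z ^ 4 - 10 * formF z * formO z ^ 2 + 45 * formF z ^ 2 ≠ 0 :=
    fun h0 => hT (by rw [← h, h0, mul_zero])
  have h2 : lamVal z ^ 2 + 10 * lamVal z + 45 =
      (formO z ^ 4 - 10 * formF z * formO z ^ 2 + 45 * formF z ^ 2) / formF z ^ 2 := by
    rw [lamVal]; field_simp; ring
  rw [h2, div_eq_div_iff (div_ne_zero h1 (pow_ne_zero _ hf)) hT, ← h]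
  field_simp

theorem resVal_eq (m n : F) (hf : formF z ≠ 0) (hH : formH z ≠ 0) (hT : formT z ≠ 0) :
    resVal m n z = -(formF z / formH z) * (formW z * (m + 12 * n * formF z ^ 2 / formT z * formO z)) := by
  have h : resVal m n z = m * (1 / (lamVal z + 3)) +
      12 * n * (1 / (lamVal z + 3)) * (1 / (lamVal z ^ 2 + 10 * lamVal z + 45)) := by
    simp only [resVal, div_eq_mul_inv, mul_inv]; ring
  rw [h, lamVal_add_three hf hH, lamVal_quadratic hf hT]; ring

theorem jVal_eq (hf : formF z ≠ 0) :
    jVal z = (lamVal z + 3) ^ 3 * (lamVal z ^ 2 + 11 * lamVal z + 64) := by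
  have h : (lamVal z + 3) ^ 3 * (lamVal z ^ 2 + 11 * lamVal z + 64) =
      -((formO z ^ 2 - 3 * formF z) ^ 3 *
        (formO z ^ 4 - 11 * formF z * formO z ^ 2 + 64 * formF z ^ 2)) / formF z ^ 5 := by
    rw [lamVal]; field_simp; ring
  rw [h, ← formW_cube, jVal, ← formW_mul]; ring

theorem sub_jVal (hf : formF z ≠ 0) : 1728 - jVal z = formT z ^ 2 / formF z ^ 5 := by
  rw [formT_sq, jVal]; field_simp; ring

theorem resVal_rotate {ζ : F} (h : ζ ^ 5 = 1) (m n : F) (hf : formF z ≠ 0) (hH : formH z ≠ 0)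
    (hT : formT z ≠ 0) :
    resVal m n (ζ * z) = -(formF z / (z * formH z)) *
      (ζ * pencilA z m (12 * n * formF z ^ 2 / formT z) +
        ζ ^ 2 * (z * pencilA z m (12 * n * formF z ^ 2 / formT z)) +
        ζ ^ 3 * pencilC z m (12 * n * formF z ^ 2 / formT z) +
        ζ ^ 4 * (-z * pencilC z m (12 * n * formF z ^ 2 / formT z))) := by
  have hζ : ζ ≠ 0 := fun h0 => by simp [h0] at h
  have hz : z ≠ 0 := fun h0 => hf (by simp [h0, formF])
  rw [resVal_eq m n (by rw [formF_rotate h]; exact mul_ne_zero hζ hf) (by rwa [formH_rotate h])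
    (by rwa [formT_rotate h]), formF_rotate h, formH_rotate h, formT_rotate h, ← formW_rotate h]
  field_simp

/-- The resolvents are the roots of the resolvent quintic. -/
theorem quintic_eq_prod_resVal [CharZero F] {ζ : F} (hζ : IsPrimitiveRoot ζ 5) (m n : F)
    (hf : formF z ≠ 0) (hH : formH z ≠ 0) (hT : formT z ≠ 0) (y : F) :
    y ^ 5 + coeffA m n (jVal z) * y ^ 2 + coeffB m n (jVal z) * y + coeffC m n (jVal z) =
      (y - resVal m n z) * (y - resVal m n (ζ * z)) * (y - resVal m n (ζ ^ 2 * z)) *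
        (y - resVal m n (ζ ^ 3 * z)) * (y - resVal m n (ζ ^ 4 * z)) := by
  have h5 : ζ ^ 5 = 1 := hζ.pow_eq_one
  have hsum : 1 + ζ + ζ ^ 2 + ζ ^ 3 + ζ ^ 4 = 0 := by
    have := hζ.geom_sum_eq_zero (by norm_num)
    simpa [Finset.sum_range_succ] using this
  have hz : z ≠ 0 := fun h0 => hf (by simp [h0, formF])
  have hpow (k : ℕ) : (ζ ^ k) ^ 5 = 1 := by rw [← pow_mul, mul_comm, pow_mul, h5, one_pow]
  have r0 := resVal_rotate (one_pow 5) m n hf hH hT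
  have r1 := resVal_rotate h5 m n hf hH hT
  have r2 := resVal_rotate (hpow 2) m n hf hH hT
  have r3 := resVal_rotate (hpow 3) m n hf hH hT
  have r4 := resVal_rotate (hpow 4) m n hf hH hT
  obtain ⟨γ, hγ⟩ : ∃ γ, γ = 12 * n * formF z ^ 2 / formT z := ⟨_, rfl⟩
  rw [← hγ] at r0 r1 r2 r3 r4
  have hn : n = γ * formT z / (12 * formF z ^ 2) := by rw [hγ]; field_simp
  have e3 := pencil_cubic z m γ
  have e4 := pencil_quartic z m γ
  have e5 := pencil_quintic z m γ
  rw [one_mul] at r0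
  rw [r0, r1, r2, r3, r4]
  generalize pencilA z m γ = a at *
  generalize pencilC z m γ = c at *
  obtain ⟨s, hs⟩ : ∃ s, s = -(formF z / (z * formH z)) := ⟨_, rfl⟩
  rw [← hs]
  -- The y³ term drops out here because sA·(-szC) + szA·sC = 0.
  have hc := circulant_product hsum y (s * a) (s * (z * a)) (s * c) (s * (-z * c))
  have hA : coeffA m n (jVal z) = -5 * s ^ 3 * (a ^ 2 * c + z ^ 2 * a ^ 3 - z * c ^ 3 + z ^ 3 * a * c ^ 2) := by
    rw [e3, coeffA, sub_jVal hf, jVal, hs, hn]; field_simp; ring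
  have hB : coeffB m n (jVal z) = -5 * s ^ 4 * (z * a ^ 4 - z ^ 4 * a ^ 3 * c + a * c ^ 3 - z ^ 3 * c ^ 4 - 3 * z ^ 2 * a ^ 2 * c ^ 2) := by
    rw [e4, coeffB, sub_jVal hf, jVal, hs, hn]; field_simp; ring
  have hC : coeffC m n (jVal z) = -s ^ 5 * ((1 + z ^ 5) * a ^ 5 + (1 - z ^ 5) * c ^ 5 +
        10 * z * a ^ 3 * c ^ 2 - 10 * z ^ 3 * a ^ 4 * c +
        10 * z ^ 2 * a * c ^ 4 + 10 * z ^ 4 * a ^ 2 * c ^ 3) := by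
    rw [e5, coeffC, sub_jVal hf, jVal, hs, hn]; field_simp; ring
  have p6 : ζ ^ 6 = ζ := by linear_combination ζ * h5
  have p8 : ζ ^ 8 = ζ ^ 3 := by linear_combination ζ ^ 3 * h5
  have p9 : ζ ^ 9 = ζ ^ 4 := by linear_combination ζ ^ 4 * h5
  have p12 : ζ ^ 12 = ζ ^ 2 := by linear_combination (ζ ^ 7 + ζ ^ 2) * h5
  have p16 : ζ ^ 16 = ζ := by linear_combination (ζ ^ 11 + ζ ^ 6 + ζ) * h5
  simp only [← pow_mul, Nat.reduceMul, p6, p8, p9, p12, p16]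
  rw [hA, hB, hC]
  calc _ = _ := by ring
    _ = _ := hc.symm
    _ = _ := by ring

end Forms

/-! ### Compatibility of the forms with ring homomorphisms -/

section Maps

variable {F G : Type*}

theorem map_formF [CommRing F] [CommRing G] (φ : F →+* G) (z : F) :
    φ (formF z) = formF (φ z) := by simp [formF, map_ofNat]

theorem map_formH [CommRing F] [CommRing G] (φ : F →+* G) (z : F) :
    φ (formH z) = formH (φ z) := by simp [formH, map_ofNat]

theorem map_formT [CommRing F] [CommRing G] (φ : F →+* G) (z : F) :
    φ (formT z) = formT (φ z) := by simp [formT, map_ofNat]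

theorem map_formO [CommRing F] [CommRing G] (φ : F →+* G) (z : F) :
    φ (formO z) = formO (φ z) := by simp [formO, map_ofNat]

theorem map_lamVal [Field F] [Field G] (φ : F →+* G) (z : F) :
    φ (lamVal z) = lamVal (φ z) := by simp [lamVal, map_formF, map_formO]

end Maps

/-! ### Substitution in rational functions and the action of PGL₂ -/

section RationalFunctions

/-- An algebraic element has a minimal polynomial of degree one over an algebraically closed field.
Transcendence is what makes substitution of g a field homomorphism. -/
theorem ratFunc_transcendental {k : Type*} [Field k] [IsAlgClosed k] {g : RatFunc k}
    (h : ∀ c, g ≠ RatFunc.C c) : Transcendental k g := by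
  intro hg
  have h1 := IsAlgClosed.degree_eq_one_of_irreducible k (minpoly.irreducible hg.isIntegral)
  obtain ⟨c, hc⟩ := minpoly.mem_range_of_degree_eq_one k g h1
  exact h c hc.symm

theorem algebraMap_X_poly_ne_zero {k : Type*} [Field k] {p : Polynomial k} (x : k)
    (h : p.eval x ≠ 0) : algebraMap (Polynomial k) (RatFunc k) p ≠ 0 := by
  rw [Ne, FaithfulSMul.algebraMap_eq_zero_iff]
  rintro rfl
  simp at h

variable {k : Type*} [Field k] [CharZero k]

theorem formF_X_ne_zero : formF (RatFunc.X : RatFunc k) ≠ 0 := by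
  rw [← RatFunc.algebraMap_X, ← map_formF]
  exact algebraMap_X_poly_ne_zero 1 (by norm_num [formF])

theorem formH_X_ne_zero : formH (RatFunc.X : RatFunc k) ≠ 0 := by
  rw [← RatFunc.algebraMap_X, ← map_formH]
  exact algebraMap_X_poly_ne_zero 0 (by norm_num [formH])

theorem formT_X_ne_zero : formT (RatFunc.X : RatFunc k) ≠ 0 := by
  rw [← RatFunc.algebraMap_X, ← map_formT]
  exact algebraMap_X_poly_ne_zero 0 (by norm_num [formT])

/-- Composition with a non-constant rational function, as a homomorphism. -/
def compHom {g : RatFunc Qbar} (h : Transcendental Qbar g) :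
    RatFunc Qbar →ₐ[Qbar] RatFunc Qbar :=
  (IntermediateField.val _).comp (RatFunc.algEquivOfTranscendental g h).toAlgHom

theorem compHom_apply {g : RatFunc Qbar} (h : Transcendental Qbar g) (f : RatFunc Qbar) :
    compHom h f = comp f g := by
  have := RatFunc.algEquivOfTranscendental_apply g h f
  simpa [compHom, comp, RatFunc.eval, Polynomial.aeval_def, RatFunc.algebraMap_eq_C] using this

theorem compHom_X {g : RatFunc Qbar} (h : Transcendental Qbar g) : compHom h RatFunc.X = g := by
  simp [compHom]

theorem algHom_ext_X {f g : RatFunc Qbar →ₐ[Qbar] RatFunc Qbar}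
    (h : f RatFunc.X = g RatFunc.X) : f = g := by
  have key (p : Polynomial Qbar) :
      f (algebraMap _ (RatFunc Qbar) p) = g (algebraMap _ (RatFunc Qbar) p) := by
    rw [← RatFunc.aeval_X_left_eq_algebraMap, ← Polynomial.aeval_algHom_apply,
      ← Polynomial.aeval_algHom_apply, h]
  ext u
  rw [← RatFunc.num_div_denom u, map_div₀, map_div₀, key, key]

theorem algHom_C (f : RatFunc Qbar →ₐ[Qbar] RatFunc Qbar) (c : Qbar) :
    f (RatFunc.C c) = RatFunc.C c := by
  rw [← RatFunc.algebraMap_eq_C]; exact f.commutes c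

theorem linear_eq_zero {a b : Qbar}
    (h : RatFunc.C a * RatFunc.X + RatFunc.C b = (0 : RatFunc Qbar)) : a = 0 ∧ b = 0 := by
  have h1 : algebraMap (Polynomial Qbar) (RatFunc Qbar)
      (Polynomial.C a * Polynomial.X + Polynomial.C b) = 0 := by
    simpa [RatFunc.algebraMap_X, RatFunc.algebraMap_C] using h
  rw [FaithfulSMul.algebraMap_eq_zero_iff] at h1
  constructor
  · simpa using congrArg (Polynomial.coeff · 1) h1
  · simpa using congrArg (Polynomial.coeff · 0) h1

theorem moebius_denom_ne_zero (M : GL (Fin 2) Qbar) :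
    RatFunc.C (M.val 1 0) * RatFunc.X + RatFunc.C (M.val 1 1) ≠ 0 := by
  intro h
  obtain ⟨h1, h2⟩ := linear_eq_zero h
  have := M.det_ne_zero
  rw [Matrix.det_fin_two, h1, h2] at this
  simp at this

theorem moebius_transcendental (M : GL (Fin 2) Qbar) : Transcendental Qbar (moebius M) := by
  apply ratFunc_transcendental
  intro c hc
  rw [moebius, div_eq_iff (moebius_denom_ne_zero M)] at hc
  have h : RatFunc.C (M.val 0 0 - c * M.val 1 0) * RatFunc.X +
      RatFunc.C (M.val 0 1 - c * M.val 1 1) = 0 := by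
    simp only [map_sub, map_mul]
    linear_combination hc
  obtain ⟨h1, h2⟩ := linear_eq_zero h
  have := M.det_ne_zero
  rw [Matrix.det_fin_two] at this
  exact this (by linear_combination M.val 1 1 * h1 - M.val 1 0 * h2)

/-- The right action of `GL₂` on rational functions. -/
def moebiusHom : GL (Fin 2) Qbar →* (RatFunc Qbar →ₐ[Qbar] RatFunc Qbar)ᵐᵒᵖ where
  toFun M := MulOpposite.op (compHom (moebius_transcendental M))
  map_one' := by
    apply MulOpposite.unop_injective
    apply algHom_ext_X
    simp [compHom_X, moebius]
  map_mul' M N := by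
    apply MulOpposite.unop_injective
    apply algHom_ext_X
    rw [MulOpposite.unop_mul, MulOpposite.unop_op, AlgHom.mul_apply, MulOpposite.unop_op,
      MulOpposite.unop_op, compHom_X, compHom_X]
    have h1 := moebius_denom_ne_zero (M * N)
    have h2 := moebius_denom_ne_zero N
    have h3 := (compHom (moebius_transcendental N)).toRingHom.injective.ne (moebius_denom_ne_zero M)
    simp only [AlgHom.toRingHom_eq_coe, RingHom.coe_coe, map_add, map_mul, map_zero, algHom_C,
      compHom_X] at h3
    simp only [moebius, map_div₀, map_add, map_mul, algHom_C, compHom_X] at h3 ⊢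
    simp only [Units.val_mul, Matrix.mul_apply, Fin.sum_univ_two, map_add, map_mul] at h1 ⊢
    rw [div_eq_div_iff h1 h3]
    field_simp
    ring

/-- The right action of `PGL₂` on rational functions. -/
def projMoebiusHom : PGL(2, Qbar) →* (RatFunc Qbar →ₐ[Qbar] RatFunc Qbar)ᵐᵒᵖ :=
  Matrix.ProjGenLinGroup.lift moebiusHom <| by
    ext1 u
    apply MulOpposite.unop_injective
    apply algHom_ext_X
    have hu : RatFunc.C (u : Qbar) ≠ 0 := by
      simp
    simp [moebiusHom, compHom_X, moebius, hu]

theorem projMoebiusHom_mk_X (M : GL (Fin 2) Qbar) :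
    (projMoebiusHom (.mk M)).unop RatFunc.X = moebius M := compHom_X _

theorem projMoebiusHom_mk_apply (M : GL (Fin 2) Qbar) (f : RatFunc Qbar) :
    (projMoebiusHom (.mk M)).unop f = comp f (moebius M) := compHom_apply _ f

/-- Clearing denominators in (az + b)/(cz + d) = z gives cz² + (d - a)z - b = 0 identically, so the
matrix is scalar. -/
theorem eq_one_of_projMoebiusHom_X {g : PGL(2, Qbar)}
    (h : (projMoebiusHom g).unop RatFunc.X = RatFunc.X) : g = 1 := by
  induction g using Matrix.ProjGenLinGroup.induction_on with | mk M => ?_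
  rw [projMoebiusHom_mk_X, moebius, div_eq_iff (moebius_denom_ne_zero M)] at h
  have h1 : algebraMap (Polynomial Qbar) (RatFunc Qbar)
      (Polynomial.C (M.val 1 0) * Polynomial.X ^ 2 + Polynomial.C (M.val 1 1 - M.val 0 0) *
        Polynomial.X - Polynomial.C (M.val 0 1)) = 0 := by
    simp only [map_sub, map_add, map_mul, map_pow, RatFunc.algebraMap_X, RatFunc.algebraMap_C]
    linear_combination -h
  rw [FaithfulSMul.algebraMap_eq_zero_iff] at h1
  have c0 : M.val 0 1 = 0 := by simpa using congrArg (Polynomial.coeff · 0) h1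
  have c1 : M.val 1 1 - M.val 0 0 = 0 := by
    simpa [Polynomial.coeff_X, Polynomial.coeff_C] using congrArg (Polynomial.coeff · 1) h1
  have c2 : M.val 1 0 = 0 := by
    simpa [Polynomial.coeff_X, Polynomial.coeff_C] using congrArg (Polynomial.coeff · 2) h1
  have hd := M.det_ne_zero
  rw [Matrix.det_fin_two, c2, mul_zero, sub_zero] at hd
  rw [← Matrix.ProjGenLinGroup.mk_one, eq_comm, Matrix.ProjGenLinGroup.mk_eq_mk_iff]
  refine ⟨Units.mk0 _ (left_ne_zero_of_mul hd), ?_⟩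
  ext i j
  rw [sub_eq_zero] at c1
  fin_cases i <;> fin_cases j <;> simp [c0, c1, c2]

theorem eps_relation {ζ : Qbar} (hζ : IsPrimitiveRoot ζ 5) : eps ζ ^ 2 + eps ζ = 1 := by
  have h5 : ζ ^ 5 = 1 := hζ.pow_eq_one
  have hsum : 1 + ζ + ζ ^ 2 + ζ ^ 3 + ζ ^ 4 = 0 := by
    have := hζ.geom_sum_eq_zero (by norm_num)
    simpa [Finset.sum_range_succ] using this
  rw [eps]
  grind

/-- Since ε⁻¹ = ε + 1, the two quadratics involving ε multiply to the rational quartic factor of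
`formO`. -/
theorem lam_eq {ζ : Qbar} (hζ : IsPrimitiveRoot ζ 5) : lam ζ = lamVal RatFunc.X := by
  have h := eps_relation hζ
  have hi : (eps ζ)⁻¹ = eps ζ + 1 := by
    rw [inv_eq_iff_eq_inv, eq_comm, inv_eq_of_mul_eq_one_left]
    linear_combination h
  have hC : RatFunc.C (eps ζ) ^ 2 + RatFunc.C (eps ζ) = 1 := by
    rw [← map_pow, ← map_add, h, map_one]
  rw [lam, lamVal, hi, map_add, map_one]
  generalize RatFunc.C (eps ζ) = e at hC
  have hfac : (RatFunc.X ^ 2 - 2 * e * RatFunc.X - 1) *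
      (RatFunc.X ^ 2 + 2 * (e + 1) * RatFunc.X - 1) =
      (RatFunc.X ^ 4 + 2 * RatFunc.X ^ 3 - 6 * RatFunc.X ^ 2 - 2 * RatFunc.X + 1 :
        RatFunc Qbar) := by
    linear_combination -4 * RatFunc.X ^ 2 * hC
  rw [neg_mul, div_neg, ← neg_div, formO, ← hfac, formF]
  congr 1
  ring

theorem kleinJ_eq {ζ : Qbar} (hζ : IsPrimitiveRoot ζ 5) : kleinJ ζ = jVal RatFunc.X := by
  rw [kleinJ, lam_eq hζ, jVal_eq formF_X_ne_zero]

theorem kleinJ_eq_mu {ζ : Qbar} (hζ : IsPrimitiveRoot ζ 5) :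
    kleinJ ζ = (mu ^ 2 + 10 * mu + 5) ^ 3 / mu := by
  rw [kleinJ_eq hζ, jVal, mu]
  have hf := formF_X_ne_zero (k := Qbar)
  have hX := RatFunc.X_ne_zero (K := Qbar)
  simp only [formF, formH] at *
  have hg := right_ne_zero_of_mul hf
  -- With g = z¹⁰ + 11z⁵ - 1 this says 5H = g²(μ² + 10μ + 5).
  have hH : (RatFunc.X ^ 20 - 228 * RatFunc.X ^ 15 + 494 * RatFunc.X ^ 10 + 228 * RatFunc.X ^ 5 + 1
      : RatFunc Qbar) = (RatFunc.X ^ 10 + 11 * RatFunc.X ^ 5 - 1) ^ 2 -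
        250 * RatFunc.X ^ 5 * (RatFunc.X ^ 10 + 11 * RatFunc.X ^ 5 - 1) +
        3125 * RatFunc.X ^ 10 := by ring
  rw [hH]
  generalize (RatFunc.X ^ 10 + 11 * RatFunc.X ^ 5 - 1 : RatFunc Qbar) = g at hg
  field_simp
  ring

theorem rotate_transcendental {c : Qbar} (hc : c ≠ 0) :
    Transcendental Qbar (RatFunc.C c * RatFunc.X) := by
  apply ratFunc_transcendental
  intro b hb
  exact hc (linear_eq_zero (a := c) (b := -b) (by rw [map_neg, hb]; ring)).1

theorem comp_lam {ζ : Qbar} (hζ : IsPrimitiveRoot ζ 5) {c : Qbar} (hc : c ≠ 0) :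
    comp (lam ζ) (RatFunc.C c * RatFunc.X) = lamVal (RatFunc.C c * RatFunc.X) := by
  rw [lam_eq hζ, ← compHom_apply (rotate_transcendental hc)]
  exact (map_lamVal (compHom (rotate_transcendental hc)).toRingHom _).trans
    (congrArg lamVal (compHom_X _))

theorem resolvent_eq {ζ : Qbar} (hζ : IsPrimitiveRoot ζ 5) (m n : Qbar) (ν : Fin 5) :
    resolvent ζ m n ν =
      resVal (RatFunc.C m) (RatFunc.C n) (RatFunc.C ζ ^ (ν : ℕ) * RatFunc.X) := by
  have h : ζ ^ (ν : ℕ) ≠ 0 := pow_ne_zero _ (hζ.ne_zero (by norm_num))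
  rw [resolvent, comp_lam hζ h, resVal, map_pow]

theorem quintic_eq_prod_resolvent {ζ : Qbar} (hζ : IsPrimitiveRoot ζ 5) (m n : Qbar) :
    quintic (coeffA (RatFunc.C m) (RatFunc.C n) (kleinJ ζ))
        (coeffB (RatFunc.C m) (RatFunc.C n) (kleinJ ζ))
        (coeffC (RatFunc.C m) (RatFunc.C n) (kleinJ ζ)) =
      ∏ ν : Fin 5, (Polynomial.X - Polynomial.C (resolvent ζ m n ν)) := by
  have hζ' : IsPrimitiveRoot (RatFunc.C ζ) 5 := hζ.map_of_injective RatFunc.C_injective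
  apply Polynomial.funext
  intro y
  simp only [resolvent_eq hζ, kleinJ_eq hζ, Fin.prod_univ_five, quintic,
    Polynomial.eval_add, Polynomial.eval_sub, Polynomial.eval_mul, Polynomial.eval_pow,
    Polynomial.eval_X, Polynomial.eval_C]
  have := quintic_eq_prod_resVal hζ' (RatFunc.C m) (RatFunc.C n) formF_X_ne_zero formH_X_ne_zero
    formT_X_ne_zero y
  simpa using this

end RationalFunctions

/-! ### Fourier coefficients of the resolvents -/

section Fourier

variable {F : Type*} [Field F]

theorem primitive_five_sum {ζ : F} (hζ : IsPrimitiveRoot ζ 5) :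
    1 + ζ + ζ ^ 2 + ζ ^ 3 + ζ ^ 4 = 0 := by
  have := hζ.geom_sum_eq_zero (by norm_num)
  simpa [Finset.sum_range_succ] using this

/-- The `k`-th discrete Fourier coefficient of the five conjugate resolvents. -/
def resFourier (ζ m n z : F) (k : ℕ) : F :=
  ∑ ν : Fin 5, (ζ ^ k) ^ (ν : ℕ) * resVal m n (ζ ^ (ν : ℕ) * z)

/-- First Fourier component of the resolvents. -/
def resA (m n z : F) : F :=
  -(formF z / (z * formH z)) * pencilA z m (12 * n * formF z ^ 2 / formT z)

/-- Third Fourier component of the resolvents. -/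
def resC (m n z : F) : F :=
  -(formF z / (z * formH z)) * pencilC z m (12 * n * formF z ^ 2 / formT z)

theorem resVal_expansion {ζ z : F} (h : ζ ^ 5 = 1) (m n : F) (hf : formF z ≠ 0)
    (hH : formH z ≠ 0) (hT : formT z ≠ 0) :
    resVal m n (ζ * z) = ζ * resA m n z + ζ ^ 2 * (z * resA m n z) + ζ ^ 3 * resC m n z -
      ζ ^ 4 * (z * resC m n z) := by
  rw [resVal_rotate h m n hf hH hT, resA, resC]; ring

/-- Orthogonality of characters isolates the component of weight 5 - k. Consecutive components
differ by the factor z or -z, so z can be recovered from the resolvents. -/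
theorem resFourier_eq {ζ z : F} (hζ : IsPrimitiveRoot ζ 5) (m n : F) (hf : formF z ≠ 0)
    (hH : formH z ≠ 0) (hT : formT z ≠ 0) :
    resFourier ζ m n z 4 = 5 * resA m n z ∧ resFourier ζ m n z 3 = z * (5 * resA m n z) ∧
    resFourier ζ m n z 2 = 5 * resC m n z ∧ resFourier ζ m n z 1 = -(z * (5 * resC m n z)) := by
  have h5 : ζ ^ 5 = 1 := hζ.pow_eq_one
  have hsum := primitive_five_sum hζ
  have hpow (k : ℕ) : (ζ ^ k) ^ 5 = 1 := by rw [← pow_mul, mul_comm, pow_mul, h5, one_pow]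
  simp only [resFourier, Fin.sum_univ_five, resVal_expansion (hpow _) m n hf hH hT]
  generalize resA m n z = a
  generalize resC m n z = c
  norm_num
  refine ⟨?_, ?_, ?_, ?_⟩ <;> grind

end Fourier

/-! ### Behaviour of λ under T and U -/

section Transformations

variable {F : Type*} [Field F]

/-- As a form, f has degree 12 with one zero at infinity; this accounts for the extra factor z - e.
-/
theorem formF_T {e : F} (he : e ^ 2 + e = 1) (z : F) :
    (e * z + 1) * (z - e) * ((e * z + 1) ^ 10 + 11 * (e * z + 1) ^ 5 * (z - e) ^ 5 - (z - e) ^ 10) =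
      (e ^ 2 + 1) ^ 6 * formF z := by
  rw [formF]
  grind

/-- Up to constants, T permutes the five rotates of the octahedral form. The cases 0, 1, 2 suffice:
the other two arise by replacing ζ with ζ⁴, which leaves e unchanged. -/
theorem formO_T0 {ζ : F} (h : 1 + ζ + ζ ^ 2 + ζ ^ 3 + ζ ^ 4 = 0) {e : F} (he : e = ζ + ζ ^ 4) (z : F) :
    ((e * z + 1) ^ 2 + (z - e) ^ 2) * ((e * z + 1) ^ 4 + 2 * (e * z + 1) ^ 3 * (z - e) -
      6 * (e * z + 1) ^ 2 * (z - e) ^ 2 - 2 * (e * z + 1) * (z - e) ^ 3 + (z - e) ^ 4) =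
      -(e ^ 2 + 1) ^ 3 * formO z := by
  have : e ^ 2 + e = 1 := by grind
  rw [formO]
  grind

theorem formO_T1 {ζ : F} (h : 1 + ζ + ζ ^ 2 + ζ ^ 3 + ζ ^ 4 = 0) {e : F} (he : e = ζ + ζ ^ 4)
    (z : F) :
    ((ζ * (e * z + 1)) ^ 2 + (z - e) ^ 2) * ((ζ * (e * z + 1)) ^ 4 +
      2 * (ζ * (e * z + 1)) ^ 3 * (z - e) - 6 * (ζ * (e * z + 1)) ^ 2 * (z - e) ^ 2 -
      2 * (ζ * (e * z + 1)) * (z - e) ^ 3 + (z - e) ^ 4) =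
      -ζ ^ 4 * (e ^ 2 + 1) ^ 3 * formO (ζ ^ 3 * z) := by
  have h5 : ζ ^ 5 = 1 := by linear_combination (ζ - 1) * h
  have h1 : ζ * (e * z + 1) = (ζ ^ 2 + 1) * z + ζ := by
    rw [he]; linear_combination z * h5
  have h2 : e ^ 2 + 1 = 3 + ζ ^ 2 + ζ ^ 3 := by rw [he]; linear_combination (2 + ζ ^ 3) * h5
  rw [h1, h2, he, formO]
  -- The multiplier is a quotient of the difference of the two sides by the fifth cyclotomic
  -- polynomial in ζ.
  linear_combination (-8 * z ^ 6 + 16 * ζ * z ^ 5 + 8 * ζ * z ^ 6 + 40 * ζ ^ 2 * z ^ 4 - 16 * ζ ^ 2 * z ^ 5 - 16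
      * ζ ^ 2 * z ^ 6 - 40 * ζ ^ 3 * z ^ 4 + 80 * ζ ^ 3 * z ^ 5 + 16 * ζ ^ 3 * z ^ 6 + 27 * ζ ^
      4 + 40 * ζ ^ 4 * z ^ 2 + 80 * ζ ^ 4 * z ^ 4 - 48 * ζ ^ 4 * z ^ 5 - 27 * ζ ^ 5 - 16 * ζ ^ 5
      * z - 40 * ζ ^ 5 * z ^ 2 + 80 * ζ ^ 5 * z ^ 3 - 80 * ζ ^ 5 * z ^ 4 + 88 * ζ ^ 5 * z ^ 5 -
      8 * ζ ^ 5 * z ^ 6 + 19 * ζ ^ 6 + 16 * ζ ^ 6 * z - 160 * ζ ^ 6 * z ^ 3 + 120 * ζ ^ 6 * z ^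
      4 - 24 * ζ ^ 6 * z ^ 5 + 28 * ζ ^ 6 * z ^ 6 + 8 * ζ ^ 7 - 86 * ζ ^ 7 * z + 80 * ζ ^ 7 * z
      ^ 2 + 120 * ζ ^ 7 * z ^ 3 - 160 * ζ ^ 7 * z ^ 4 + 4 * ζ ^ 7 * z ^ 5 - 36 * ζ ^ 7 * z ^ 6 -
      18 * ζ ^ 8 + 6 * ζ ^ 8 * z - 120 * ζ ^ 8 * z ^ 2 - 40 * ζ ^ 8 * z ^ 3 + 60 * ζ ^ 8 * z ^ 4
      + 40 * ζ ^ 8 * z ^ 5 + 36 * ζ ^ 8 * z ^ 6 + 20 * ζ ^ 9 + 26 * ζ ^ 9 * z - 60 * ζ ^ 9 * z ^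
      3 - 68 * ζ ^ 9 * z ^ 5 - 20 * ζ ^ 9 * z ^ 6 - 19 * ζ ^ 10 - 96 * ζ ^ 10 * z + 25 * ζ ^ 10
      * z ^ 2 + 80 * ζ ^ 10 * z ^ 3 - 120 * ζ ^ 10 * z ^ 4 + 68 * ζ ^ 10 * z ^ 5 + 12 * ζ ^ 11 +
      12 * ζ ^ 11 * z - 85 * ζ ^ 11 * z ^ 2 - 40 * ζ ^ 11 * z ^ 3 + 180 * ζ ^ 11 * z ^ 4 - 40 *
      ζ ^ 11 * z ^ 5 + 20 * ζ ^ 11 * z ^ 6 + 8 * ζ ^ 12 + 16 * ζ ^ 12 * z - 15 * ζ ^ 12 * z ^ 2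
      + 20 * ζ ^ 12 * z ^ 3 - 180 * ζ ^ 12 * z ^ 4 - 35 * ζ ^ 12 * z ^ 6 - 20 * ζ ^ 13 - 38 * ζ
      ^ 13 * z + 100 * ζ ^ 13 * z ^ 4 + 40 * ζ ^ 13 * z ^ 5 + 35 * ζ ^ 13 * z ^ 6 + 19 * ζ ^ 14
      - 30 * ζ ^ 14 * z ^ 2 - 70 * ζ ^ 14 * z ^ 5 - 20 * ζ ^ 14 * z ^ 6 + 1 * ζ ^ 15 + 4 * ζ ^
      15 * z - 100 * ζ ^ 15 * z ^ 4 + 70 * ζ ^ 15 * z ^ 5 - 8 * ζ ^ 16 - 4 * ζ ^ 16 * z - 5 * ζ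
      ^ 16 * z ^ 2 + 40 * ζ ^ 16 * z ^ 4 - 40 * ζ ^ 16 * z ^ 5 + 20 * ζ ^ 16 * z ^ 6 + 8 * ζ ^
      17 - 2 * ζ ^ 17 * z - 40 * ζ ^ 17 * z ^ 4 - 35 * ζ ^ 17 * z ^ 6 + 2 * ζ ^ 18 * z - 35 * ζ
      ^ 18 * z ^ 4 + 40 * ζ ^ 18 * z ^ 5 + 35 * ζ ^ 18 * z ^ 6 - 1 * ζ ^ 19 - 16 * ζ ^ 19 * z ^
      5 - 20 * ζ ^ 19 * z ^ 6 + 1 * ζ ^ 20 - 10 * ζ ^ 20 * z ^ 4 + 16 * ζ ^ 20 * z ^ 5 - 5 * ζ ^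
      21 * z ^ 4 + 14 * ζ ^ 21 * z ^ 5 + 20 * ζ ^ 21 * z ^ 6 - 8 * ζ ^ 22 * z ^ 6 + 4 * ζ ^ 23 *
      z ^ 5 + 8 * ζ ^ 23 * z ^ 6 + 2 * ζ ^ 24 * z ^ 5 + 7 * ζ ^ 24 * z ^ 6 + 2 * ζ ^ 26 * z ^ 6
      + 1 * ζ ^ 27 * z ^ 6) * h

theorem formO_T2 {ζ : F} (h : 1 + ζ + ζ ^ 2 + ζ ^ 3 + ζ ^ 4 = 0) {e : F} (he : e = ζ + ζ ^ 4)
    (z : F) :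
    ((ζ ^ 2 * (e * z + 1)) ^ 2 + (z - e) ^ 2) * ((ζ ^ 2 * (e * z + 1)) ^ 4 +
      2 * (ζ ^ 2 * (e * z + 1)) ^ 3 * (z - e) - 6 * (ζ ^ 2 * (e * z + 1)) ^ 2 * (z - e) ^ 2 -
      2 * (ζ ^ 2 * (e * z + 1)) * (z - e) ^ 3 + (z - e) ^ 4) =
      -ζ ^ 4 * (e ^ 2 + 1) ^ 3 * formO (ζ ^ 4 * z) := by
  have h5 : ζ ^ 5 = 1 := by linear_combination (ζ - 1) * h
  have h1 : ζ ^ 2 * (e * z + 1) = (ζ ^ 3 + ζ) * z + ζ ^ 2 := by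
    rw [he]; linear_combination ζ * z * h5
  have h2 : e ^ 2 + 1 = 3 + ζ ^ 2 + ζ ^ 3 := by rw [he]; linear_combination (2 + ζ ^ 3) * h5
  rw [h1, h2, he, formO]
  linear_combination (1 * z ^ 6 - 6 * ζ * z ^ 5 - 3 * ζ * z ^ 6 + 15 * ζ ^ 2 * z ^ 4 + 14 * ζ ^ 2 * z ^ 5 - 3 *
      ζ ^ 2 * z ^ 6 - 20 * ζ ^ 3 * z ^ 3 - 25 * ζ ^ 3 * z ^ 4 + 2 * ζ ^ 3 * z ^ 5 + 3 * ζ ^ 3 *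
      z ^ 6 + 27 * ζ ^ 4 + 15 * ζ ^ 4 * z ^ 2 + 20 * ζ ^ 4 * z ^ 3 + 15 * ζ ^ 4 * z ^ 4 - 6 * ζ
      ^ 4 * z ^ 5 - 13 * ζ ^ 4 * z ^ 6 - 27 * ζ ^ 5 - 6 * ζ ^ 5 * z - 5 * ζ ^ 5 * z ^ 2 - 20 * ζ
      ^ 5 * z ^ 3 + 5 * ζ ^ 5 * z ^ 4 + 26 * ζ ^ 5 * z ^ 5 + 18 * ζ ^ 5 * z ^ 6 + 28 * ζ ^ 6 - 2
      * ζ ^ 6 * z - 5 * ζ ^ 6 * z ^ 2 - 20 * ζ ^ 6 * z ^ 3 - 55 * ζ ^ 6 * z ^ 4 - 8 * ζ ^ 6 * z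
      ^ 5 - 29 * ζ ^ 6 * z ^ 6 + 1 * ζ ^ 7 + 18 * ζ ^ 7 * z + 45 * ζ ^ 7 * z ^ 2 + 60 * ζ ^ 7 *
      z ^ 3 + 50 * ζ ^ 7 * z ^ 4 + 2 * ζ ^ 7 * z ^ 5 + 31 * ζ ^ 7 * z ^ 6 - 25 * ζ ^ 8 - 92 * ζ
      ^ 8 * z + 5 * ζ ^ 8 * z ^ 2 - 80 * ζ ^ 8 * z ^ 3 - 15 * ζ ^ 8 * z ^ 4 + 66 * ζ ^ 8 * z ^ 5
      - 31 * ζ ^ 8 * z ^ 6 + 47 * ζ ^ 9 + 32 * ζ ^ 9 * z - 10 * ζ ^ 9 * z ^ 2 + 140 * ζ ^ 9 * z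
      ^ 3 - 35 * ζ ^ 9 * z ^ 4 - 58 * ζ ^ 9 * z ^ 5 + 31 * ζ ^ 9 * z ^ 6 - 36 * ζ ^ 10 + 2 * ζ ^
      10 * z + 5 * ζ ^ 10 * z ^ 2 - 60 * ζ ^ 10 * z ^ 3 + 135 * ζ ^ 10 * z ^ 4 + 98 * ζ ^ 10 * z
      ^ 5 - 7 * ζ ^ 10 * z ^ 6 - 6 * ζ ^ 11 - 78 * ζ ^ 11 * z - 15 * ζ ^ 11 * z ^ 2 - 20 * ζ ^
      11 * z ^ 3 - 135 * ζ ^ 11 * z ^ 4 - 38 * ζ ^ 11 * z ^ 5 - 4 * ζ ^ 11 * z ^ 6 + 39 * ζ ^ 12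
      - 2 * ζ ^ 12 * z - 80 * ζ ^ 12 * z ^ 2 + 80 * ζ ^ 12 * z ^ 3 + 55 * ζ ^ 12 * z ^ 4 + 12 *
      ζ ^ 12 * z ^ 5 + 26 * ζ ^ 12 * z ^ 6 - 33 * ζ ^ 13 + 6 * ζ ^ 13 * z - 20 * ζ ^ 13 * z ^ 2
      - 100 * ζ ^ 13 * z ^ 3 + 20 * ζ ^ 13 * z ^ 4 + 36 * ζ ^ 13 * z ^ 5 - 36 * ζ ^ 13 * z ^ 6 +
      4 * ζ ^ 14 - 28 * ζ ^ 14 * z - 40 * ζ ^ 14 * z ^ 2 + 40 * ζ ^ 14 * z ^ 3 - 130 * ζ ^ 14 *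
      z ^ 4 - 68 * ζ ^ 14 * z ^ 5 + 36 * ζ ^ 14 * z ^ 6 + 16 * ζ ^ 15 - 14 * ζ ^ 15 * z - 20 * ζ
      ^ 15 * z ^ 2 - 20 * ζ ^ 15 * z ^ 3 + 180 * ζ ^ 15 * z ^ 4 + 68 * ζ ^ 15 * z ^ 5 - 20 * ζ ^
      15 * z ^ 6 - 11 * ζ ^ 16 + 12 * ζ ^ 16 * z - 20 * ζ ^ 16 * z ^ 2 - 180 * ζ ^ 16 * z ^ 4 -
      40 * ζ ^ 16 * z ^ 5 + 4 * ζ ^ 17 - 8 * ζ ^ 17 * z + 100 * ζ ^ 17 * z ^ 4 + 20 * ζ ^ 17 * z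
      ^ 6 + 2 * ζ ^ 18 - 2 * ζ ^ 18 * z - 5 * ζ ^ 18 * z ^ 2 + 40 * ζ ^ 18 * z ^ 5 - 35 * ζ ^ 18
      * z ^ 6 - 1 * ζ ^ 19 + 2 * ζ ^ 19 * z - 100 * ζ ^ 19 * z ^ 4 - 70 * ζ ^ 19 * z ^ 5 + 35 *
      ζ ^ 19 * z ^ 6 + 1 * ζ ^ 20 + 40 * ζ ^ 20 * z ^ 4 + 70 * ζ ^ 20 * z ^ 5 - 20 * ζ ^ 20 * z
      ^ 6 - 40 * ζ ^ 21 * z ^ 4 - 40 * ζ ^ 21 * z ^ 5 - 35 * ζ ^ 22 * z ^ 4 + 20 * ζ ^ 22 * z ^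
      6 + 40 * ζ ^ 23 * z ^ 5 - 35 * ζ ^ 23 * z ^ 6 - 10 * ζ ^ 24 * z ^ 4 - 16 * ζ ^ 24 * z ^ 5
      + 35 * ζ ^ 24 * z ^ 6 - 5 * ζ ^ 25 * z ^ 4 + 16 * ζ ^ 25 * z ^ 5 - 20 * ζ ^ 25 * z ^ 6 +
      14 * ζ ^ 26 * z ^ 5 + 20 * ζ ^ 27 * z ^ 6 + 4 * ζ ^ 28 * z ^ 5 - 8 * ζ ^ 28 * z ^ 6 + 2 *
      ζ ^ 29 * z ^ 5 + 8 * ζ ^ 29 * z ^ 6 + 7 * ζ ^ 30 * z ^ 6 + 2 * ζ ^ 32 * z ^ 6 + 1 * ζ ^ 33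
      * z ^ 6) * h

/-- In λ = -t²/f the factors (e² + 1)⁶ and (z - e)¹² cancel. What remains is κ²/c against 1/c',
which is the condition κ²c' = c. -/
theorem lamVal_T {e c c' κ z : F} (he : e ^ 2 + e = 1) (he' : e ^ 2 + 1 ≠ 0) (hz : z - e ≠ 0)
    (hc : c ^ 5 = 1) (hc' : c' ^ 5 = 1) (hκ : κ ^ 2 * c' = c)
    (hO : ((c * (e * z + 1)) ^ 2 + (z - e) ^ 2) * ((c * (e * z + 1)) ^ 4 +
      2 * (c * (e * z + 1)) ^ 3 * (z - e) - 6 * (c * (e * z + 1)) ^ 2 * (z - e) ^ 2 -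
      2 * (c * (e * z + 1)) * (z - e) ^ 3 + (z - e) ^ 4) = κ * (e ^ 2 + 1) ^ 3 * formO (c' * z)) :
    lamVal (c * ((e * z + 1) / (z - e))) = lamVal (c' * z) := by
  have hc0 : c ≠ 0 := fun h0 => by simp [h0] at hc
  have hc0' : c' ≠ 0 := fun h0 => by simp [h0] at hc'
  have h1 : formF ((e * z + 1) / (z - e)) = (e ^ 2 + 1) ^ 6 * formF z / (z - e) ^ 12 := by
    rw [← formF_T he, formF]; field_simp
  have h2 : formO (c * ((e * z + 1) / (z - e))) =
      κ * (e ^ 2 + 1) ^ 3 * formO (c' * z) / (z - e) ^ 6 := by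
    rw [← hO, formO]; field_simp
  rw [lamVal, lamVal, formF_rotate hc, formF_rotate hc', h1, h2, ← hκ]
  have hκ0 : κ ≠ 0 := fun h0 => hc0 (by rw [← hκ, h0]; ring)
  field_simp

theorem lamVal_T0 {ζ e z : F} (h : 1 + ζ + ζ ^ 2 + ζ ^ 3 + ζ ^ 4 = 0) (he : e = ζ + ζ ^ 4)
    (he' : e ^ 2 + 1 ≠ 0) (hz : z - e ≠ 0) :
    lamVal ((e * z + 1) / (z - e)) = lamVal z := by
  have := lamVal_T (c := 1) (c' := 1) (κ := -1) (by grind) he' hz (one_pow 5) (one_pow 5)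
    (by ring) (by have := formO_T0 h he z; simp only [one_mul]; linear_combination this)
  simpa using this

theorem lamVal_T1 {ζ e z : F} (h : 1 + ζ + ζ ^ 2 + ζ ^ 3 + ζ ^ 4 = 0) (he : e = ζ + ζ ^ 4)
    (he' : e ^ 2 + 1 ≠ 0) (hz : z - e ≠ 0) :
    lamVal (ζ * ((e * z + 1) / (z - e))) = lamVal (ζ ^ 3 * z) :=
  lamVal_T (κ := -ζ ^ 4) (by grind) he' hz (by grind) (by grind) (by grind) (formO_T1 h he z)

theorem lamVal_T2 {ζ e z : F} (h : 1 + ζ + ζ ^ 2 + ζ ^ 3 + ζ ^ 4 = 0) (he : e = ζ + ζ ^ 4)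
    (he' : e ^ 2 + 1 ≠ 0) (hz : z - e ≠ 0) :
    lamVal (ζ ^ 2 * ((e * z + 1) / (z - e))) = lamVal (ζ ^ 4 * z) :=
  lamVal_T (κ := -ζ ^ 4) (by grind) he' hz (by grind) (by grind) (by grind) (formO_T2 h he z)

theorem lamVal_U {c z : F} (hc : c ^ 5 = 1) (hz : z ≠ 0) :
    lamVal (c * (-1 / z)) = lamVal (c ^ 4 * z) := by
  have hc0 : c ≠ 0 := fun h0 => by simp [h0] at hc
  have h1 : formF (-1 / z) = formF z / z ^ 12 := by
    rw [formF, formF]; field_simp; ring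
  have h2 : formO (c * (-1 / z)) = c * formO (c ^ 4 * z) / z ^ 6 := by
    rw [formO, formO]; field_simp; grind
  have hc4 : (c ^ 4) ^ 5 = 1 := by rw [← pow_mul, mul_comm, pow_mul, hc, one_pow]
  rw [lamVal, lamVal, formF_rotate hc, formF_rotate hc4, h1, h2]
  field_simp
  rw [hc, one_mul]

end Transformations

/-! ### The isomorphism with A₅ and the invariance of j -/

section Group

theorem projMoebius_formulas (M : GL (Fin 2) Qbar) (w : RatFunc Qbar) :
    (projMoebiusHom (.mk M)).unop (lamVal w) = lamVal ((projMoebiusHom (.mk M)).unop w) :=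
  map_lamVal (projMoebiusHom (.mk M)).unop.toRingHom w

/-- The five conjugates of `λ`. -/
def lamConj (ζ : Qbar) (ν : Fin 5) : RatFunc Qbar :=
  lamVal (RatFunc.C ζ ^ (ν : ℕ) * RatFunc.X)

/-- After f is cancelled, evaluation at z = 0, where t takes the value 1, leaves only the powers of
ζ. -/
theorem lamConj_injective {ζ : Qbar} (hζ : IsPrimitiveRoot ζ 5) :
    Function.Injective (lamConj ζ) := by
  intro ν κ h
  have h5 : (RatFunc.C ζ : RatFunc Qbar) ^ 5 = 1 := by rw [← map_pow, hζ.pow_eq_one, map_one]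
  have hpow (k : ℕ) : ((RatFunc.C ζ : RatFunc Qbar) ^ k) ^ 5 = 1 := by
    rw [← pow_mul, mul_comm, pow_mul, h5, one_pow]
  have hC : (RatFunc.C ζ : RatFunc Qbar) ≠ 0 := by
    simpa using hζ.ne_zero (by norm_num)
  have hf := formF_X_ne_zero (k := Qbar)
  rw [lamConj, lamConj, lamVal, lamVal, formF_rotate (hpow _), formF_rotate (hpow _),
    div_eq_div_iff (mul_ne_zero (pow_ne_zero _ hC) hf) (mul_ne_zero (pow_ne_zero _ hC) hf)] at h
  have h2 : formO (RatFunc.C ζ ^ (ν : ℕ) * RatFunc.X) ^ 2 * RatFunc.C ζ ^ (κ : ℕ) =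
      formO (RatFunc.C ζ ^ (κ : ℕ) * RatFunc.X) ^ 2 * RatFunc.C ζ ^ (ν : ℕ) := by
    apply mul_right_cancel₀ hf
    linear_combination -h
  have h3 : formO (Polynomial.C ζ ^ (ν : ℕ) * Polynomial.X) ^ 2 * Polynomial.C ζ ^ (κ : ℕ) =
      formO (Polynomial.C ζ ^ (κ : ℕ) * Polynomial.X) ^ 2 * Polynomial.C ζ ^ (ν : ℕ) := by
    apply FaithfulSMul.algebraMap_injective (Polynomial Qbar) (RatFunc Qbar)
    simpa [map_formO, RatFunc.algebraMap_X, RatFunc.algebraMap_C] using h2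
  have h4 := congrArg (Polynomial.eval 0) h3
  simp [formO, Polynomial.eval_C] at h4
  exact Fin.ext (hζ.pow_inj ν.2 κ.2 h4.symm)

/-- An element fixing every conjugate of λ fixes the resolvents with m = 1, n = 0, hence their
Fourier coefficients, hence the quotient of two of them that equals z. -/
theorem projMoebius_eq_one {ζ : Qbar} (hζ : IsPrimitiveRoot ζ 5) {g : PGL(2, Qbar)}
    (h : ∀ ν, (projMoebiusHom g).unop (lamConj ζ ν) = lamConj ζ ν) : g = 1 := by
  apply eq_one_of_projMoebiusHom_X
  have hζ' : IsPrimitiveRoot (RatFunc.C ζ) 5 := hζ.map_of_injective RatFunc.C_injective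
  obtain ⟨h4, h3, -, -⟩ := resFourier_eq hζ' 1 0 formF_X_ne_zero formH_X_ne_zero formT_X_ne_zero
  have hfix (k : ℕ) : (projMoebiusHom g).unop (resFourier (RatFunc.C ζ) 1 0 RatFunc.X k) =
      resFourier (RatFunc.C ζ) 1 0 RatFunc.X k := by
    rw [resFourier, map_sum]
    refine Finset.sum_congr rfl fun ν _ => ?_
    have := h ν
    rw [lamConj] at this
    simp only [resVal, map_mul, map_pow, algHom_C, map_add, map_div₀, map_one, map_zero, this,
      map_ofNat]
  have hA : 5 * resA 1 0 (RatFunc.X : RatFunc Qbar) ≠ 0 := by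
    have hp : pencilA (RatFunc.X : RatFunc Qbar) 1 0 ≠ 0 := by
      have : algebraMap (Polynomial Qbar) (RatFunc Qbar)
          (Polynomial.X * (1 + 7 * Polynomial.X ^ 5)) ≠ 0 :=
        algebraMap_X_poly_ne_zero 1 (by norm_num)
      simpa [pencilA, RatFunc.algebraMap_X, map_ofNat] using this
    simpa [resA, RatFunc.X_ne_zero, formF_X_ne_zero, formH_X_ne_zero] using hp
  have hX : (RatFunc.X : RatFunc Qbar) =
      resFourier (RatFunc.C ζ) 1 0 RatFunc.X 3 / resFourier (RatFunc.C ζ) 1 0 RatFunc.X 4 := by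
    rw [h3, h4, mul_div_assoc, div_self hA, mul_one]
  rw [hX, map_div₀, hfix, hfix]

/-- The cyclic permutation of the five conjugates. -/
def permS : Equiv.Perm (Fin 5) := Equiv.subRight 1

/-- The permutation of the five conjugates induced by `T`. -/
def permT : Equiv.Perm (Fin 5) := Equiv.swap 1 3 * Equiv.swap 2 4

/-- The permutation of the five conjugates induced by `U`. -/
def permU : Equiv.Perm (Fin 5) := Equiv.swap 1 4 * Equiv.swap 2 3

/-- Elements of orders 5, 3 and 2 make the order divisible by 30, so the index in A₅ is at most 2.
The subgroup is therefore normal, and simplicity of A₅ finishes. -/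
theorem closure_perms :
    Subgroup.closure {permS, permT, permU} = alternatingGroup (Fin 5) := by
  have hle : Subgroup.closure {permS, permT, permU} ≤ alternatingGroup (Fin 5) := by
    rw [Subgroup.closure_le]
    rintro _ (rfl | rfl | rfl) <;> exact Equiv.Perm.mem_alternatingGroup.mpr (by decide)
  set H := Subgroup.closure {permS, permT, permU} with hH
  have hS : permS ∈ H := Subgroup.subset_closure (by simp)
  have hT : permT ∈ H := Subgroup.subset_closure (by simp)
  have dvd (n : ℕ) [Fact n.Prime] (g : Equiv.Perm (Fin 5)) (hg : g ∈ H) (h : g ^ n = 1)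
      (h1 : g ≠ 1) : n ∣ Nat.card H := by
    rw [← orderOf_eq_prime h h1]
    exact Subgroup.orderOf_dvd_natCard H hg
  have : Fact (Nat.Prime 5) := ⟨by norm_num⟩
  have d5 := dvd 5 permS hS (by decide) (by decide)
  have d3 := dvd 3 (permS ^ 2 * permT) (mul_mem (pow_mem hS 2) hT) (by decide) (by decide)
  have d2 := dvd 2 permT hT (by decide) (by decide)
  have hcard : Nat.card (alternatingGroup (Fin 5)) = 60 := by
    rw [nat_card_alternatingGroup, Nat.card_fin]; rfl
  have d30 : 30 ∣ Nat.card H := by lia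
  have hidx := Subgroup.card_mul_index (H.subgroupOf (alternatingGroup (Fin 5)))
  rw [hcard, Nat.card_congr (Subgroup.subgroupOfEquivOfLe hle).toEquiv] at hidx
  obtain ⟨k, hk⟩ := d30
  rw [hk] at hidx
  have hmul : k * (H.subgroupOf (alternatingGroup (Fin 5))).index = 2 := by lia
  have hi : (H.subgroupOf (alternatingGroup (Fin 5))).index ≤ 2 :=
    Nat.le_of_dvd two_pos (Dvd.intro_left _ hmul)
  have hn : (H.subgroupOf (alternatingGroup (Fin 5))).Normal := by
    interval_cases h : (H.subgroupOf (alternatingGroup (Fin 5))).index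
    · lia
    · rw [Subgroup.index_eq_one.mp h]; infer_instance
    · exact Subgroup.normal_of_index_eq_two h
  refine le_antisymm hle (Subgroup.subgroupOf_eq_top.mp ?_)
  rcases hn.eq_bot_or_eq_top with h | h
  · rw [h, Subgroup.index_bot, hcard] at hi
    norm_num at hi
  · exact h

/-- The generators of the icosahedral group paired with the permutations they induce. -/
def generatorPairs (ζ : Qbar) : Set (PGL(2, Qbar) × Equiv.Perm (Fin 5)) :=
  {p | (∃ M : GL (Fin 2) Qbar, M.val = matS ζ ∧ p = (.mk M, permS)) ∨
    (∃ M : GL (Fin 2) Qbar, M.val = matT ζ ∧ p = (.mk M, permT)) ∨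
    (∃ M : GL (Fin 2) Qbar, M.val = matU ∧ p = (.mk M, permU))}

theorem fst_image_generatorPairs (ζ : Qbar) :
    Prod.fst '' generatorPairs ζ = Matrix.ProjGenLinGroup.mk ''
      {M : GL (Fin 2) Qbar | M.val = matS ζ ∨ M.val = matT ζ ∨ M.val = matU} := by
  ext g
  constructor
  · rintro ⟨p, ⟨M, hM, rfl⟩ | ⟨M, hM, rfl⟩ | ⟨M, hM, rfl⟩, rfl⟩
    · exact ⟨M, .inl hM, rfl⟩
    · exact ⟨M, .inr (.inl hM), rfl⟩
    · exact ⟨M, .inr (.inr hM), rfl⟩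
  · rintro ⟨M, hM | hM | hM, rfl⟩
    · exact ⟨_, .inl ⟨M, hM, rfl⟩, rfl⟩
    · exact ⟨_, .inr (.inl ⟨M, hM, rfl⟩), rfl⟩
    · exact ⟨_, .inr (.inr ⟨M, hM, rfl⟩), rfl⟩

theorem eps_sq_add_one_ne_zero {ζ : Qbar} (hζ : IsPrimitiveRoot ζ 5) : eps ζ ^ 2 + 1 ≠ 0 := by
  intro h
  have h1 := eps_relation hζ
  have h2 : eps ζ = 2 := by linear_combination h1 - h
  rw [h2] at h
  norm_num at h

theorem snd_image_generatorPairs {ζ : Qbar} (hζ : IsPrimitiveRoot ζ 5) :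
    Prod.snd '' generatorPairs ζ = {permS, permT, permU} := by
  have hS : (matS ζ).det ≠ 0 := by simpa [matS] using hζ.ne_zero (by norm_num)
  have hT : (matT ζ).det ≠ 0 := by
    intro h
    apply eps_sq_add_one_ne_zero hζ
    rw [matT, Matrix.det_fin_two_of] at h
    linear_combination -h
  have hU : matU.det ≠ 0 := by simp [matU]
  ext g
  constructor
  · rintro ⟨p, ⟨M, hM, rfl⟩ | ⟨M, hM, rfl⟩ | ⟨M, hM, rfl⟩, rfl⟩ <;> simp
  · rintro (rfl | rfl | rfl)
    · exact ⟨_, .inl ⟨.mkOfDetNeZero _ hS, rfl, rfl⟩, rfl⟩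
    · exact ⟨_, .inr (.inl ⟨.mkOfDetNeZero _ hT, rfl, rfl⟩), rfl⟩
    · exact ⟨_, .inr (.inr ⟨.mkOfDetNeZero _ hU, rfl, rfl⟩), rfl⟩

theorem projMoebius_lamConj (ζ : Qbar) (M : GL (Fin 2) Qbar) (ν : Fin 5) :
    (projMoebiusHom (.mk M)).unop (lamConj ζ ν) =
      lamVal (RatFunc.C ζ ^ (ν : ℕ) * moebius M) := by
  rw [lamConj, projMoebius_formulas, map_mul, map_pow, algHom_C, projMoebiusHom_mk_X]

theorem generatorPairs_act {ζ : Qbar} (hζ : IsPrimitiveRoot ζ 5)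
    {p : PGL(2, Qbar) × Equiv.Perm (Fin 5)} (hp : p ∈ generatorPairs ζ) (ν : Fin 5) :
    (projMoebiusHom p.1).unop (lamConj ζ (p.2 ν)) = lamConj ζ ν := by
  have hsum := primitive_five_sum (hζ.map_of_injective (RatFunc.C_injective (K := Qbar)))
  have h5 : (RatFunc.C ζ : RatFunc Qbar) ^ 5 = 1 := by rw [← map_pow, hζ.pow_eq_one, map_one]
  have hpow (k : ℕ) : ((RatFunc.C ζ : RatFunc Qbar) ^ k) ^ 5 = 1 := by
    rw [← pow_mul, mul_comm, pow_mul, h5, one_pow]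
  have he : RatFunc.C (eps ζ) ^ 2 + RatFunc.C (eps ζ) = 1 := by
    rw [← map_pow, ← map_add, eps_relation hζ, map_one]
  have he' : RatFunc.C (eps ζ) ^ 2 + 1 ≠ 0 := by
    rw [← map_pow, ← map_one RatFunc.C, ← map_add, Ne, map_eq_zero]
    exact eps_sq_add_one_ne_zero hζ
  have hz : (RatFunc.X : RatFunc Qbar) - RatFunc.C (eps ζ) ≠ 0 := by
    intro h
    have := (linear_eq_zero (a := 1) (b := -eps ζ) (by rw [map_one, map_neg]; linear_combination h)).1
    exact one_ne_zero this
  have heq : (RatFunc.C (eps ζ) : RatFunc Qbar) = RatFunc.C ζ + RatFunc.C ζ ^ 4 := by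
    rw [eps, map_add, map_pow]
  rcases hp with ⟨M, hM, rfl⟩ | ⟨M, hM, rfl⟩ | ⟨M, hM, rfl⟩
  · have hX : moebius M = RatFunc.C ζ * RatFunc.X := by simp [moebius, hM, matS]
    rw [projMoebius_lamConj, hX, lamConj, ← mul_assoc, ← pow_succ]
    congr 2
    fin_cases ν
    · exact h5.trans (pow_zero _).symm
    all_goals rfl
  · have hX : moebius M = (RatFunc.C (eps ζ) * RatFunc.X + 1) / (RatFunc.X - RatFunc.C (eps ζ)) := by
      simp [moebius, hM, matT, sub_eq_add_neg]
    rw [projMoebius_lamConj, hX, lamConj]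
    have hsum4 : 1 + RatFunc.C ζ ^ 4 + (RatFunc.C ζ ^ 4) ^ 2 + (RatFunc.C ζ ^ 4) ^ 3 +
        (RatFunc.C ζ ^ 4) ^ 4 = (0 : RatFunc Qbar) := by grind
    have heq4 : (RatFunc.C (eps ζ) : RatFunc Qbar) =
        RatFunc.C ζ ^ 4 + (RatFunc.C ζ ^ 4) ^ 4 := by grind
    have q1 : ((RatFunc.C ζ : RatFunc Qbar) ^ 4) ^ 2 = RatFunc.C ζ ^ 3 := by grind
    have q2 : ((RatFunc.C ζ : RatFunc Qbar) ^ 4) ^ 3 = RatFunc.C ζ ^ 2 := by grind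
    have q3 : ((RatFunc.C ζ : RatFunc Qbar) ^ 4) ^ 4 = RatFunc.C ζ ^ 1 := by grind
    fin_cases ν
    · have := lamVal_T0 hsum heq he' hz
      simpa [show permT 0 = 0 by decide] using this
    · exact (q1 ▸ q3 ▸ lamVal_T2 hsum4 heq4 he' hz :)
    · exact (q2 ▸ lamVal_T1 hsum4 heq4 he' hz :)
    · have := lamVal_T1 hsum heq he' hz
      simpa [show permT 3 = 1 by decide] using this
    · exact lamVal_T2 hsum heq he' hz
  · have hX : moebius M = -1 / RatFunc.X := by simp [moebius, hM, matU]
    rw [projMoebius_lamConj, hX, lamConj, lamVal_U (hpow _) RatFunc.X_ne_zero, ← pow_mul]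
    congr 2
    have p (k : ℕ) : (RatFunc.C ζ : RatFunc Qbar) ^ (k + 5) = RatFunc.C ζ ^ k := by
      rw [pow_add, h5, mul_one]
    fin_cases ν
    · rfl
    · exact (p 11).trans ((p 6).trans (p 1))
    · exact (p 7).trans (p 2)
    · exact p 3
    · rfl

/-- Substitution reverses products; placing the permutation inside the index makes the relation
multiplicative in the pair. -/
theorem closure_generatorPairs_act {ζ : Qbar} (hζ : IsPrimitiveRoot ζ 5)
    {p : PGL(2, Qbar) × Equiv.Perm (Fin 5)}
    (hp : p ∈ Subgroup.closure (generatorPairs ζ)) (ν : Fin 5) :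
    (projMoebiusHom p.1).unop (lamConj ζ (p.2 ν)) = lamConj ζ ν := by
  induction hp using Subgroup.closure_induction generalizing ν with
  | mem p hp => exact generatorPairs_act hζ hp ν
  | one => simp
  | mul p q _ _ hp hq =>
    rw [Prod.fst_mul, Prod.snd_mul, map_mul, MulOpposite.unop_mul, AlgHom.mul_apply,
      Equiv.Perm.mul_apply, hp, hq]
  | inv p _ hp =>
    have h := hp (p⁻¹.2 ν)
    rw [Prod.snd_inv, ← Equiv.Perm.mul_apply, mul_inv_cancel, Equiv.Perm.one_apply] at h
    have h2 : projMoebiusHom p.1 * projMoebiusHom p⁻¹.1 = 1 := by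
      rw [← map_mul, Prod.fst_inv, mul_inv_cancel, map_one]
    rw [Prod.snd_inv, ← h, ← AlgHom.mul_apply, ← MulOpposite.unop_mul, h2]
    rfl

/-- The subgroup generated by the pairs (transformation, permutation) is the graph of the
isomorphism: both projections are injective, the first because the λ(ζ^ν z) are distinct, the second
because the action on them is faithful. -/
theorem icosahedralGroup_mulEquiv {ζ : Qbar} (hζ : IsPrimitiveRoot ζ 5) :
    Nonempty (icosahedralGroup ζ ≃* alternatingGroup (Fin 5)) := by
  set R := Subgroup.closure (generatorPairs ζ) with hR
  have hfst : (R.map (MonoidHom.fst _ _)) = icosahedralGroup ζ := by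
    rw [hR, MonoidHom.map_closure, icosahedralGroup, ← fst_image_generatorPairs]; rfl
  have hsnd : (R.map (MonoidHom.snd _ _)) = alternatingGroup (Fin 5) := by
    rw [hR, MonoidHom.map_closure, ← closure_perms, ← snd_image_generatorPairs hζ]; rfl
  have inj1 : Function.Injective ((MonoidHom.fst _ _).comp R.subtype) := by
    rw [injective_iff_map_eq_one]
    rintro ⟨p, hp⟩ h
    have h1 : p.1 = 1 := h
    ext1
    refine Prod.ext h1 (Equiv.ext fun ν => ?_)
    have := closure_generatorPairs_act hζ hp ν
    rw [h1, map_one] at this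
    exact lamConj_injective hζ this
  have inj2 : Function.Injective ((MonoidHom.snd _ _).comp R.subtype) := by
    rw [injective_iff_map_eq_one]
    rintro ⟨p, hp⟩ h
    have h1 : p.2 = 1 := h
    ext1
    refine Prod.ext (projMoebius_eq_one hζ fun ν => ?_) h1
    have := closure_generatorPairs_act hζ hp ν
    rwa [h1] at this
  have e1 := MonoidHom.ofInjective inj1
  have e2 := MonoidHom.ofInjective inj2
  rw [MonoidHom.range_comp, Subgroup.range_subtype] at e1 e2
  exact ⟨(MulEquiv.subgroupCongr hfst.symm).trans (e1.symm.trans (e2.trans (MulEquiv.subgroupCongr hsnd)))⟩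

theorem comp_kleinJ_moebius {ζ : Qbar} (hζ : IsPrimitiveRoot ζ 5) {M : GL (Fin 2) Qbar}
    (hM : Matrix.ProjGenLinGroup.mk M ∈ icosahedralGroup ζ) :
    comp (kleinJ ζ) (moebius M) = kleinJ ζ := by
  rw [← projMoebiusHom_mk_apply]
  have hR : Matrix.ProjGenLinGroup.mk M ∈
      (Subgroup.closure (generatorPairs ζ)).map (MonoidHom.fst _ _) := by
    rw [MonoidHom.map_closure]
    rw [icosahedralGroup, ← fst_image_generatorPairs] at hM
    exact hM
  obtain ⟨p, hp, hpM⟩ := hR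
  rw [← hpM]
  -- The function j is the same polynomial in each conjugate of λ, so permuting the conjugates does
  -- not change it.
  have key (ν : Fin 5) : (lamConj ζ ν + 3) ^ 3 * (lamConj ζ ν ^ 2 + 11 * lamConj ζ ν + 64) =
      kleinJ ζ := by
    have h5 : (RatFunc.C ζ : RatFunc Qbar) ^ 5 = 1 := by rw [← map_pow, hζ.pow_eq_one, map_one]
    have hpow : ((RatFunc.C ζ : RatFunc Qbar) ^ (ν : ℕ)) ^ 5 = 1 := by
      rw [← pow_mul, mul_comm, pow_mul, h5, one_pow]
    have hC : (RatFunc.C ζ : RatFunc Qbar) ≠ 0 := by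
      simpa using hζ.ne_zero (by norm_num)
    have hf : formF (RatFunc.C ζ ^ (ν : ℕ) * RatFunc.X) ≠ 0 := by
      rw [formF_rotate hpow]
      exact mul_ne_zero (pow_ne_zero _ hC) formF_X_ne_zero
    rw [kleinJ_eq hζ, lamConj, ← jVal_eq hf, jVal, jVal, formH_rotate hpow, formF_rotate hpow,
      mul_pow, hpow, one_mul]
  have h := closure_generatorPairs_act hζ hp 0
  conv_lhs => rw [← key (p.2 0)]
  simp only [map_mul, map_pow, map_add, map_ofNat, MonoidHom.coe_fst, h]
  exact key 0

end Group

/-! ### Explicit parameters m, n, j over ℚ(√(5 Disc)) -/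

section Inversion

variable {F : Type*} [CommRing F]

/-- The invariant `5⁴ δ`. -/
def invD (a b c : F) : F :=
    a ^ 4 - 5 * b ^ 3 + 25 * a * b * c

/-- Five times the discriminant of the quintic. -/
def invE (a b c : F) : F :=
    540 * a ^ 5 * c - 135 * a ^ 4 * b ^ 2 + 11250 * a ^ 2 * b * c ^ 2 - 8000 * a * b ^ 3 * c +
    1280 * b ^ 5 + 15625 * c ^ 4

/-- The invariant `12² 5⁵ γ₄`. -/
def invG (a b c : F) : F :=
    128 * a ^ 4 * b ^ 2 - 192 * a ^ 5 * c - 600 * a * b ^ 3 * c + 1000 * a ^ 2 * b * c ^ 2 - 144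
    * b ^ 5 + 3125 * c ^ 4

/-- The invariant `12³ 5¹⁰ γ₆`. -/
def invK (a b c : F) : F :=
    1728 * a ^ 10 + 10400 * a ^ 6 * b ^ 3 + 405000 * a ^ 2 * b ^ 6 - 180000 * a ^ 7 * b * c -
    1170000 * a ^ 3 * b ^ 4 * c + 1725000 * a ^ 4 * b ^ 2 * c ^ 2 - 1800000 * a ^ 5 * c ^ 3 +
    2812500 * a * b ^ 3 * c ^ 3 - 4687500 * a ^ 2 * b * c ^ 4 - 2025000 * b ^ 5 * c ^ 2 -
    9765625 * c ^ 6

/-- Rational part of `2 m 5⁴ δ`. -/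
def mRat (a b c : F) : F :=
    -50 * b ^ 2 * c + 125 * a * c ^ 2 - 11 * a ^ 3 * b

/-- Rational part of `288 n² 5⁴ δ / (1728 - j)`. -/
def qRat (a b c : F) : F :=
    125 * b * c ^ 2 + 11 * a ^ 2 * b ^ 2 + 10 * a ^ 3 * c

/-- Rational part of `24 n (5⁴ δ)³`. -/
def nRat (a b c : F) : F :=
    1953125 * b ^ 3 * c ^ 5 + 90000 * b ^ 8 * c - 515625 * a * b ^ 6 * c ^ 2 + 1031250 * a ^ 2 *
    b ^ 4 * c ^ 3 - 625000 * a ^ 3 * b ^ 2 * c ^ 4 + 44375 * a ^ 3 * b ^ 7 + 390625 * a ^ 4 * c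
    ^ 5 - 224125 * a ^ 4 * b ^ 5 * c + 203750 * a ^ 5 * b ^ 3 * c ^ 2 + 84375 * a ^ 6 * b * c ^
    3 - 1140 * a ^ 7 * b ^ 4 + 9600 * a ^ 8 * b ^ 2 * c + 8000 * a ^ 9 * c ^ 2 - 216 * a ^ 11 *
    b

/-- Coefficient of `√(5 Disc)` in `24 n (5⁴ δ)³`. -/
def nIrr (a b c : F) : F :=
    15625 * b ^ 3 * c ^ 3 + 1125 * a * b ^ 6 - 4125 * a ^ 2 * b ^ 4 * c + 8750 * a ^ 3 * b ^ 2 *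
    c ^ 2 - 3125 * a ^ 4 * c ^ 3 + 420 * a ^ 5 * b ^ 3 + 600 * a ^ 6 * b * c - 8 * a ^ 9

/-- Rational part of `2 j (5⁴ δ)⁵`. -/
def jRat (a b c : F) : F :=
    -30517578125 * b ^ 5 * c ^ 8 - 2021484375 * b ^ 10 * c ^ 4 - 10800000 * b ^ 15 + 9521484375
    * a * b ^ 8 * c ^ 5 + 67500000 * a * b ^ 13 * c - 9765625000 * a ^ 2 * b ^ 6 * c ^ 6 -
    569531250 * a ^ 2 * b ^ 11 * c ^ 2 - 18310546875 * a ^ 3 * b ^ 4 * c ^ 7 + 3236328125 * a ^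
    3 * b ^ 9 * c ^ 3 + 30517578125 * a ^ 4 * b ^ 2 * c ^ 8 - 6279296875 * a ^ 4 * b ^ 7 * c ^ 4
    - 75121875 * a ^ 4 * b ^ 12 - 30517578125 * a ^ 5 * c ^ 9 - 4228515625 * a ^ 5 * b ^ 5 * c ^
    5 + 538837500 * a ^ 5 * b ^ 10 * c + 25390625000 * a ^ 6 * b ^ 3 * c ^ 6 - 896406250 * a ^ 6
    * b ^ 8 * c ^ 2 - 18310546875 * a ^ 7 * b * c ^ 7 - 884375000 * a ^ 7 * b ^ 6 * c ^ 3 +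
    2080078125 * a ^ 8 * b ^ 4 * c ^ 4 - 19835000 * a ^ 8 * b ^ 9 + 742187500 * a ^ 9 * b ^ 2 *
    c ^ 5 + 115925000 * a ^ 9 * b ^ 7 * c - 1230468750 * a ^ 10 * c ^ 6 - 202375000 * a ^ 10 * b
    ^ 5 * c ^ 2 + 258750000 * a ^ 11 * b ^ 3 * c ^ 3 - 165625000 * a ^ 12 * b * c ^ 4 + 3352000
    * a ^ 12 * b ^ 6 - 16880000 * a ^ 13 * b ^ 4 * c + 14200000 * a ^ 14 * b ^ 2 * c ^ 2 -
    9200000 * a ^ 15 * c ^ 3 - 64000 * a ^ 16 * b ^ 3 + 576000 * a ^ 17 * b * c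

/-- Coefficient of `√(5 Disc)` in `2 j (5⁴ δ)⁵`. -/
def jIrr (a b c : F) : F :=
    -244140625 * b ^ 5 * c ^ 6 - 6328125 * b ^ 10 * c ^ 2 + 17578125 * a * b ^ 8 * c ^ 3 -
    29296875 * a ^ 2 * b ^ 6 * c ^ 4 - 1265625 * a ^ 2 * b ^ 11 + 48828125 * a ^ 3 * b ^ 4 * c ^
    5 + 4781250 * a ^ 3 * b ^ 9 * c - 244140625 * a ^ 4 * b ^ 2 * c ^ 6 - 6562500 * a ^ 4 * b ^
    7 * c ^ 2 + 244140625 * a ^ 5 * c ^ 7 + 19375000 * a ^ 5 * b ^ 5 * c ^ 3 - 60546875 * a ^ 6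
    * b ^ 3 * c ^ 4 - 1745000 * a ^ 6 * b ^ 8 + 58593750 * a ^ 7 * b * c ^ 5 + 6525000 * a ^ 7 *
    b ^ 6 * c - 1125000 * a ^ 8 * b ^ 4 * c ^ 2 - 6250000 * a ^ 9 * b ^ 2 * c ^ 3 + 5625000 * a
    ^ 10 * c ^ 4 - 30400 * a ^ 10 * b ^ 5 - 320000 * a ^ 11 * b ^ 3 * c - 200000 * a ^ 12 * b *
    c ^ 2 + 12800 * a ^ 14 * b ^ 2 + 12800 * a ^ 15 * c

/-- Multiplication of `x.1 + x.2 √e` and `y.1 + y.2 √e`. -/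
def quadMul (e : F) (x y : F × F) : F × F :=
  (x.1 * y.1 + e * x.2 * y.2, x.1 * y.2 + x.2 * y.1)

/-- The value `x.1 + x.2 d`. -/
def quadVal (d : F) (x : F × F) : F := x.1 + x.2 * d

theorem quadVal_mul {d e : F} (h : d ^ 2 = e) (x y : F × F) :
    quadVal d (quadMul e x y) = quadVal d x * quadVal d y := by
  simp only [quadVal, quadMul]
  linear_combination (-x.2 * y.2) * h

/-- With t = 5⁴δ, N = 24nt³, Q = 288n²t/(1728 - j) and J = 2jt⁵ this is N² = Q(3456t⁵ - J), the
relation making the formulas for n, q and j consistent. -/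
theorem quad_identity_n (a b c : F) :
    quadMul (invE a b c) (nRat a b c, nIrr a b c) (nRat a b c, nIrr a b c) =
      quadMul (invE a b c) (qRat a b c, b)
        (3456 * invD a b c ^ 5 - jRat a b c, -jIrr a b c) := by
  simp only [quadMul, nRat, nIrr, qRat, jRat, jIrr, invD, invE]
  ext
  · ring
  · ring

/-- The trace of j: `jRat` divided by (5⁴δ)⁵ is the sum of the roots of the quadratic in the
theorem. -/
theorem jRat_eq (a b c : F) :
    1728 * jRat a b c = 3125 * invG a b c ^ 3 - invK a b c ^ 2 + 1728 ^ 2 * invD a b c ^ 5 := by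
  simp only [jRat, invG, invK, invD]
  ring

/-- The norm of j, which matches the product of the roots of the same quadratic. -/
theorem jRat_sq (a b c : F) :
    jRat a b c ^ 2 - invE a b c * jIrr a b c ^ 2 = 12500 * invG a b c ^ 3 * invD a b c ^ 5 := by
  simp only [jRat, jIrr, invG, invD, invE]
  ring

/-- The equation for A with denominators cleared; q absorbs n²/(1728 - j). Pairs stand for x + y√e,
so it becomes two polynomial identities in a, b, c. The identities for B and C have the same origin.
-/
theorem quad_identity_A (a b c : F) :
    let e := invE a b c
    let m := (mRat a b c, -a)
    let n := (nRat a b c, nIrr a b c)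
    let q := (qRat a b c, b)
    let t := invD a b c
    let mm := quadMul e m m
    (4 * a) • (jRat a b c, jIrr a b c) = -(5 : F) • ((8 * t ^ 2) • quadMul e mm m + quadMul e mm n +
      (144 * t ^ 3) • quadMul e m q + (2 * t) • quadMul e n q) := by
  simp only [quadMul, nRat, nIrr, qRat, jRat, jIrr, mRat, invD, invE]
  ext
  · simp
    ring
  · simp
    ring

theorem quad_identity_B (a b c : F) :
    let e := invE a b c
    let m := (mRat a b c, -a)
    let n := (nRat a b c, nIrr a b c)
    let q := (qRat a b c, b)
    let t := invD a b c
    let mm := quadMul e m m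
    (8 * b) • (jRat a b c, jIrr a b c) = -(5 : F) • (t • quadMul e mm mm -
      (36 * t ^ 2) • quadMul e mm q - (2 : F) • quadMul e (quadMul e m n) q -
      (108 * t ^ 3) • quadMul e q q) := by
  simp only [quadMul, nRat, nIrr, qRat, jRat, jIrr, mRat, invD, invE]
  ext
  · simp
    ring
  · simp
    ring

theorem quad_identity_C (a b c : F) :
    let e := invE a b c
    let m := (mRat a b c, -a)
    let n := (nRat a b c, nIrr a b c)
    let q := (qRat a b c, b)
    let t := invD a b c
    let mm := quadMul e m m
    let qq := quadMul e q q
    (16 * c) • (jRat a b c, jIrr a b c) = -(quadMul e mm (quadMul e mm m) -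
      (20 * t) • quadMul e (quadMul e mm m) q + (180 * t ^ 2) • quadMul e m qq +
      (4 : F) • quadMul e n qq) := by
  simp only [quadMul, nRat, nIrr, qRat, jRat, jIrr, mRat, invD, invE]
  ext
  · simp
    ring
  · simp
    ring

theorem exists_resolvent_parameters {F : Type*} [Field F] [CharZero F] {a b c d : F}
    (hd : d ^ 2 = invE a b c) (hD : invD a b c ≠ 0)
    (hJ : quadVal d (jRat a b c, jIrr a b c) ≠ 0)
    (hR : quadVal d (jRat a b c, jIrr a b c) ≠ 3456 * invD a b c ^ 5) :
    ∃ m n j : F, j ≠ 0 ∧ j ≠ 1728 ∧ a = coeffA m n j ∧ b = coeffB m n j ∧ c = coeffC m n j := by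
  have iN := congrArg (quadVal d) (quad_identity_n a b c)
  have iA := congrArg (quadVal d) (quad_identity_A a b c)
  have iB := congrArg (quadVal d) (quad_identity_B a b c)
  have iC := congrArg (quadVal d) (quad_identity_C a b c)
  have hsmul (r : F) (x : F × F) : quadVal d (r • x) = r * quadVal d x := by
    simp only [quadVal, Prod.smul_fst, Prod.smul_snd, smul_eq_mul]; ring
  have hadd (x y : F × F) : quadVal d (x + y) = quadVal d x + quadVal d y := by
    simp only [quadVal, Prod.fst_add, Prod.snd_add]; ring
  have hsub (x y : F × F) : quadVal d (x - y) = quadVal d x - quadVal d y := by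
    simp only [quadVal, Prod.fst_sub, Prod.snd_sub]; ring
  have hneg (x : F × F) : quadVal d (-x) = -quadVal d x := by
    simp only [quadVal, Prod.fst_neg, Prod.snd_neg]; ring
  simp only [quadVal_mul hd, hsmul, hadd, hsub, hneg] at iN iA iB iC
  have hRv : quadVal d (3456 * invD a b c ^ 5 - jRat a b c, -jIrr a b c) =
      3456 * invD a b c ^ 5 - quadVal d (jRat a b c, jIrr a b c) := by
    simp only [quadVal]; ring
  rw [hRv] at iN
  generalize quadVal d (jRat a b c, jIrr a b c) = J at *
  generalize quadVal d (mRat a b c, -a) = M at *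
  generalize quadVal d (nRat a b c, nIrr a b c) = N at *
  generalize quadVal d (qRat a b c, b) = Q at *
  generalize invD a b c = t at *
  obtain ⟨R, hRdef⟩ : ∃ R, R = 3456 * t ^ 5 - J := ⟨_, rfl⟩
  have hR0 : R ≠ 0 := by rw [hRdef, sub_ne_zero]; exact hR.symm
  rw [← hRdef] at iN
  have hQ : Q = N ^ 2 / R := by rw [eq_div_iff hR0]; linear_combination -iN
  have hj : 1728 - J / (2 * t ^ 5) = R / (2 * t ^ 5) := by rw [hRdef]; field_simp; ring
  rw [hQ] at iA iB iC
  -- These undo the normalisations M = 2mt, N = 24nt³, J = 2jt⁵.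
  refine ⟨M / (2 * t), N / (24 * t ^ 3), J / (2 * t ^ 5),
    div_ne_zero hJ (mul_ne_zero two_ne_zero (pow_ne_zero 5 hD)), ?_, ?_, ?_, ?_⟩
  · intro h
    rw [h, sub_self, eq_comm, div_eq_zero_iff] at hj
    rcases hj with h | h
    · exact hR0 h
    · exact hD (by simpa using h)
  · rw [coeffA, hj]
    have h : a = -5 * (8 * t ^ 2 * (M * M * M) + M * M * N + 144 * t ^ 3 * (M * (N ^ 2 / R)) +
        2 * t * (N * (N ^ 2 / R))) / (4 * J) := by
      rw [eq_div_iff (mul_ne_zero (by norm_num) hJ)]; linear_combination iA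
    rw [h]; field_simp; ring
  · rw [coeffB, hj]
    have h : b = -5 * (t * (M * M * (M * M)) - 36 * t ^ 2 * (M * M * (N ^ 2 / R)) -
        2 * (M * N * (N ^ 2 / R)) - 108 * t ^ 3 * (N ^ 2 / R * (N ^ 2 / R))) / (8 * J) := by
      rw [eq_div_iff (mul_ne_zero (by norm_num) hJ)]; linear_combination iB
    rw [h]; field_simp; ring
  · rw [coeffC, hj]
    have h : c = -(M * M * (M * M * M) - 20 * t * (M * M * M * (N ^ 2 / R)) +
        180 * t ^ 2 * (M * (N ^ 2 / R * (N ^ 2 / R))) + 4 * (N * (N ^ 2 / R * (N ^ 2 / R)))) /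
        (16 * J) := by
      rw [eq_div_iff (mul_ne_zero (by norm_num) hJ)]; linear_combination iC
    rw [h]; field_simp; ring

/-- A quintic whose quadratic resolvent has a root other than `0` and `1728` is a resolvent
quintic over any field containing the square root of five times its discriminant. -/
theorem exists_resolvent_of_isNondegenerate {F : Type*} [Field F] [CharZero F] {a b c : ℚ} {d : F}
    (hD : invD a b c ≠ 0) (hnd : IsNondegenerate a b c) (hd : d ^ 2 = (invE a b c : ℚ)) :
    ∃ m n j : F, j ≠ 0 ∧ j ≠ 1728 ∧ (a : F) = coeffA m n j ∧ (b : F) = coeffB m n j ∧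
      (c : F) = coeffC m n j := by
  have cD : ((invD a b c : ℚ) : F) = invD (a : F) b c := by simp [invD]
  have cE : ((invE a b c : ℚ) : F) = invE (a : F) b c := by simp [invE]
  have cJ : ((jRat a b c : ℚ) : F) = jRat (a : F) b c := by simp [jRat]
  have hD' : invD (a : F) b c ≠ 0 := by rw [← cD]; exact_mod_cast hD
  rw [cE] at hd
  have hd' : (-d) ^ 2 = invE (a : F) b c := by rw [neg_sq, hd]
  -- Both square roots d and -d lie in F, so a failure means that each of the two conjugate values
  -- of j is 0 or 1728.
  by_contra hcon
  have h1 : quadVal d (jRat (a : F) b c, jIrr (a : F) b c) = 0 ∨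
      quadVal d (jRat (a : F) b c, jIrr (a : F) b c) = 3456 * invD (a : F) b c ^ 5 := by
    by_contra! h
    exact hcon (exists_resolvent_parameters hd hD' h.1 h.2)
  have h2 : quadVal (-d) (jRat (a : F) b c, jIrr (a : F) b c) = 0 ∨
      quadVal (-d) (jRat (a : F) b c, jIrr (a : F) b c) = 3456 * invD (a : F) b c ^ 5 := by
    by_contra! h
    exact hcon (exists_resolvent_parameters hd' hD' h.1 h.2)
  have hsq := jRat_sq (a : F) b c
  have hJ := jRat_eq a b c
  have g4 : gamma4 a b c = invG a b c / (12 ^ 2 * 5 ^ 5) := rfl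
  have g6 : gamma6 a b c = invK a b c / (12 ^ 3 * 5 ^ 10) := rfl
  have gd : delta a b c = invD a b c / 5 ^ 4 := rfl
  obtain ⟨n1, n2, n3⟩ := hnd
  rw [g4, g6, gd] at n1
  rw [g4, g6, gd] at n2
  rw [g4, g6] at n3
  simp only [quadVal] at h1 h2
  have hprod : (jRat (a : F) b c + jIrr (a : F) b c * d) * (jRat (a : F) b c + jIrr (a : F) b c * -d)
      = 12500 * invG (a : F) b c ^ 3 * invD (a : F) b c ^ 5 := by
    linear_combination hsq - jIrr (a : F) b c ^ 2 * hd
  have hG (h : 12500 * invG (a : F) b c ^ 3 * invD (a : F) b c ^ 5 = 0) : invG a b c = 0 := by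
    have : invG (a : F) b c = 0 := by simpa [hD'] using h
    have cG : ((invG a b c : ℚ) : F) = invG (a : F) b c := by simp [invG]
    exact_mod_cast cG.trans this
  have hJ0 {r : ℚ} (h : jRat (a : F) b c = (r : F)) : jRat a b c = r := by
    rw [← cJ] at h; exact_mod_cast h
  -- The pairs (0, 0), (0, 1728) in either order, and (1728, 1728) contradict the first, third and
  -- second clause of non-degeneracy respectively.
  rcases h1 with h1 | h1 <;> rcases h2 with h2 | h2 <;> rw [h1, h2] at hprod
  · have hg := hG (by rw [← hprod]; ring)
    have hj := hJ0 (r := 0) (by push_cast; linear_combination (h1 + h2) / 2)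
    rw [hg, hj] at hJ
    exact n1 ⟨by rw [hg]; norm_num, by linear_combination (hJ / 1728 ^ 2) / 5 ^ 20⟩
  · have hg := hG (by rw [← hprod]; ring)
    have hj := hJ0 (r := 1728 * invD a b c ^ 5) (by push_cast [cD]; linear_combination (h1 + h2) / 2)
    rw [hg, hj] at hJ
    have hk : invK a b c = 0 := pow_eq_zero_iff two_ne_zero |>.mp (by linear_combination hJ)
    exact n3 ⟨by rw [hg]; norm_num, by rw [hk]; norm_num⟩
  · have hg := hG (by rw [← hprod]; ring)
    have hj := hJ0 (r := 1728 * invD a b c ^ 5) (by push_cast [cD]; linear_combination (h1 + h2) / 2)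
    rw [hg, hj] at hJ
    have hk : invK a b c = 0 := pow_eq_zero_iff two_ne_zero |>.mp (by linear_combination hJ)
    exact n3 ⟨by rw [hg]; norm_num, by rw [hk]; norm_num⟩
  · have hj := hJ0 (r := 3456 * invD a b c ^ 5) (by push_cast [cD]; linear_combination (h1 + h2) / 2)
    rw [hj] at hJ
    have hg : 12500 * invG a b c ^ 3 = 3456 ^ 2 * invD a b c ^ 5 := by
      have cG : ((invG a b c : ℚ) : F) = invG (a : F) b c := by simp [invG]
      rw [← cG, ← cD] at hprod
      have h : (12500 * invG a b c ^ 3) * invD a b c ^ 5 =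
          (3456 ^ 2 * invD a b c ^ 5) * invD a b c ^ 5 := by
        have : ((12500 * invG a b c ^ 3) * invD a b c ^ 5 : F) =
          (3456 ^ 2 * invD a b c ^ 5) * invD a b c ^ 5 := by linear_combination -hprod
        exact_mod_cast this
      exact mul_right_cancel₀ (pow_ne_zero 5 hD) h
    have hk : invK a b c = 0 := pow_eq_zero_iff two_ne_zero |>.mp (by linear_combination hJ + hg / 4)
    exact n2 ⟨by rw [hk]; norm_num, by linear_combination hg / 12500 / (12 ^ 6 * 5 ^ 15)⟩

end Inversion

/-! ### The discriminant of a principal quintic -/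

section Discriminant

open Polynomial

theorem quintic_natDegree {R : Type*} [CommRing R] [Nontrivial R] (a b c : R) :
    (quintic a b c).natDegree = 5 := by
  rw [quintic]; compute_degree!

theorem quintic_monic {R : Type*} [CommRing R] [Nontrivial R] (a b c : R) :
    (quintic a b c).Monic := by
  rw [quintic]; monicity!

theorem quintic_map {R S : Type*} [CommRing R] [CommRing S] (φ : R →+* S) (a b c : R) :
    (quintic a b c).map φ = quintic (φ a) (φ b) (φ c) := by
  simp [quintic]

theorem quintic_derivative {R : Type*} [CommRing R] (a b c : R) :
    derivative (quintic a b c) = C 5 * X ^ 4 + C (2 * a) * X + C b := by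
  simp only [quintic, derivative_add, derivative_X_pow, derivative_C_mul, derivative_X,
    derivative_C, map_mul, map_ofNat, Nat.cast_ofNat]
  ring

theorem resultant_quintic {R : Type*} [CommRing R] [Nontrivial R] (a b c : R) :
    resultant (quintic a b c) (derivative (quintic a b c)) 5 4 = (quintic a b c).discr := by
  have h := resultant_deriv (f := quintic a b c)
    (by rw [← natDegree_pos_iff_degree_pos, quintic_natDegree]; norm_num)
  rw [quintic_natDegree, quintic_monic] at h
  norm_num at h
  exact h

set_option maxHeartbeats 4000000 in
theorem resultant_quartic_quadratic {R : Type*} [CommRing R] (p q r u v w : R) :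
    resultant (C p * X ^ 4 + C q * X + C r) (C u * X ^ 2 + C v * X + C w) 4 2 =
      w ^ 4 * p ^ 2 + 3 * w ^ 2 * p * q * v * u + 2 * w ^ 2 * p * u ^ 2 * r - w * p * q * v ^ 3 -
        4 * w * p * v ^ 2 * u * r + w * q ^ 2 * u ^ 3 + p * v ^ 4 * r - q * v * u ^ 3 * r +
        u ^ 4 * r ^ 2 := by
  rw [resultant]
  have : sylvester (C p * X ^ 4 + C q * X + C r) (C u * X ^ 2 + C v * X + C w) 4 2 =
      !![w, 0, 0, 0, r, 0;
         v, w, 0, 0, q, r;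
         u, v, w, 0, 0, q;
         0, u, v, w, 0, 0;
         0, 0, u, v, p, 0;
         0, 0, 0, u, 0, p] := by
    ext i j
    fin_cases i <;> fin_cases j <;>
      simp [sylvester, Fin.addCases, coeff_X, coeff_C]
  rw [this]
  simp [Matrix.det_succ_row_zero, Fin.sum_univ_succ, Fin.succAbove]
  ring

theorem five_mul_discr_quintic {k : Type*} [Field k] [CharZero k] (a b c : k) :
    5 * (quintic a b c).discr = invE a b c := by
  have hd : derivative (quintic a b c) = C 5 * X ^ 4 + C (2 * a) * X + C b :=
    quintic_derivative a b c
  -- Modulo its derivative the quintic reduces to a quadratic, so a six-by-six determinant suffices.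
  have hq : quintic a b c = (C (3 * a / 5) * X ^ 2 + C (4 * b / 5) * X + C c) +
      derivative (quintic a b c) * (C (1 / 5) * X) := by
    have e5 : (C 5 : k[X]) * C (1 / 5) = 1 := by rw [← C_mul]; simp
    have ea : (C a : k[X]) = C (3 * a / 5) + C (2 * a) * C (1 / 5) := by
      rw [← C_mul, ← C_add]; congr 1; ring
    have eb : (C b : k[X]) = C (4 * b / 5) + C b * C (1 / 5) := by
      rw [← C_mul, ← C_add]; congr 1; ring
    rw [hd, quintic]
    linear_combination -X ^ 5 * e5 + X ^ 2 * ea + X * eb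
  have h4 : (derivative (quintic a b c)).natDegree ≤ 4 := by
    rw [hd]; compute_degree
  rw [← resultant_quintic, resultant_comm]
  generalize derivative (quintic a b c) = g at *
  rw [hq, resultant_add_mul_right _ _ _ _ _
    (by have : (C (1 / 5 : k) * X).natDegree ≤ 1 := by compute_degree
        lia) h4,
    -- Lowering the formal degree from 5 to 2 costs the cube of the leading coefficient 5 of the
    -- derivative.
    resultant_add_right_deg _ _ 4 2 3 (by compute_degree), hd, resultant_quartic_quadratic]
  simp [invE]
  ring

/-- The resultant is the product of the derivative's values at the roots. Each of the ten
differences occurs there twice with opposite signs, and the ten signs cancel. -/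
theorem quintic_discr_eq_sq {R : Type*} [CommRing R] [IsDomain R] {a b c : R} {x : Fin 5 → R}
    (h : quintic a b c = ∏ i, (X - C (x i))) :
    (quintic a b c).discr = (∏ i, ∏ j ∈ Finset.Ioi i, (x i - x j)) ^ 2 := by
  rw [← resultant_quintic]
  have hd : (derivative (quintic a b c)).natDegree ≤ 4 := by
    rw [quintic_derivative]; compute_degree
  have h1 := resultant_prod_left Finset.univ (fun i => X - C (x i)) (derivative (quintic a b c)) 4
    (by simp) hd
  rw [← h, quintic_natDegree] at h1
  rw [h1]
  have h2 (i : Fin 5) : (X - C (x i)).resultant (derivative (quintic a b c))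
      (X - C (x i)).natDegree 4 = (derivative (quintic a b c)).eval (x i) := by
    rw [natDegree_X_sub_C]
    have := resultant_X_sub_C_pow_left (x i) (derivative (quintic a b c)) 1 4 hd
    rwa [pow_one, pow_one] at this
  simp only [h2]
  rw [h]
  simp only [Fin.prod_univ_five, derivative_mul, derivative_sub, derivative_X, derivative_C,
    eval_add, eval_sub, eval_mul, eval_X, eval_C, sub_self, mul_zero, zero_mul, add_zero, zero_add,
    sub_zero, mul_one, one_mul]
  have i0 : Finset.Ioi (0 : Fin 5) = {1, 2, 3, 4} := by decide
  have i1 : Finset.Ioi (1 : Fin 5) = {2, 3, 4} := by decide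
  have i2 : Finset.Ioi (2 : Fin 5) = {3, 4} := by decide
  have i3 : Finset.Ioi (3 : Fin 5) = {4} := by decide
  have i4 : Finset.Ioi (4 : Fin 5) = ∅ := by decide
  rw [i0, i1, i2, i3, i4]
  simp only [Finset.prod_insert, Finset.mem_insert, Finset.mem_singleton, Fin.reduceEq, or_self,
    not_false_eq_true, Finset.prod_singleton, Finset.prod_empty]
  rw [← neg_sub (x 0) (x 1), ← neg_sub (x 0) (x 2), ← neg_sub (x 0) (x 3), ← neg_sub (x 0) (x 4),
    ← neg_sub (x 1) (x 2), ← neg_sub (x 1) (x 3), ← neg_sub (x 1) (x 4), ← neg_sub (x 2) (x 3),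
    ← neg_sub (x 2) (x 4), ← neg_sub (x 3) (x 4)]
  generalize x 0 - x 1 = d01, x 0 - x 2 = d02, x 0 - x 3 = d03, x 0 - x 4 = d04,
    x 1 - x 2 = d12, x 1 - x 3 = d13, x 1 - x 4 = d14, x 2 - x 3 = d23, x 2 - x 4 = d24,
    x 3 - x 4 = d34
  ring

end Discriminant

/-! ### Five-torsion of a short Weierstrass curve -/

section Torsion

open WeierstrassCurve

/-- The curve `y² = x³ + a x + b`. -/
def shortCurve {F : Type*} [CommRing F] (a b : F) : WeierstrassCurve F := ⟨0, 0, 0, a, b⟩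

theorem shortCurve_Δ {F : Type*} [CommRing F] (a b : F) :
    (shortCurve a b).Δ = -16 * (4 * a ^ 3 + 27 * b ^ 2) := by
  simp only [shortCurve, WeierstrassCurve.Δ, WeierstrassCurve.b₂, WeierstrassCurve.b₄,
    WeierstrassCurve.b₆, WeierstrassCurve.b₈]
  ring

/-- The polynomial whose roots are the sums `x_P + x_{2P}` over the five-torsion of
`y² = x³ + a x + b`. -/
def torsionSextic {F : Type*} [CommRing F] (a b s : F) : F :=
  s ^ 6 + 20 * a * s ^ 4 + 160 * b * s ^ 3 - 80 * a ^ 2 * s ^ 2 - 128 * a * b * s - 80 * b ^ 2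

/-- The denominator-free form of `x_{2P} = x'` in terms of `x_P = x`. -/
def IsDoubleX {F : Type*} [CommRing F] (a b x x' : F) : Prop :=
  4 * (x ^ 3 + a * x + b) * x' = x ^ 4 - 2 * a * x ^ 2 - 8 * b * x + a ^ 2

variable {F : Type*} [Field F] {a b : F}

/-- The duplication numerator is (3x² + a)² - 8x(x³ + ax + b), so a common zero with the cubic would
be a double root of it. -/
theorem ne_zero_of_isDoubleX (hΔ : 4 * a ^ 3 + 27 * b ^ 2 ≠ 0) {x x' : F}
    (h : IsDoubleX a b x x') : x ^ 3 + a * x + b ≠ 0 := by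
  intro h0
  rw [IsDoubleX, h0] at h
  have h1 : (3 * x ^ 2 + a) ^ 2 = 0 := by linear_combination -h + 8 * x * h0
  have h2 : a = -3 * x ^ 2 := by
    have := pow_eq_zero_iff (two_ne_zero) |>.mp h1
    linear_combination this
  have h3 : b = 2 * x ^ 3 := by rw [h2] at h0; linear_combination h0
  exact hΔ (by rw [h2, h3]; ring)

theorem shortCurve_equation {x y : F} (h : (shortCurve a b).toAffine.Nonsingular x y) :
    y ^ 2 = x ^ 3 + a * x + b := by
  have := (Affine.equation_iff ..).mp h.1
  simpa [shortCurve] using this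

theorem shortCurve_negY (x y : F) : (shortCurve a b).toAffine.negY x y = -y := by
  simp [shortCurve, Affine.negY]

variable [CharZero F]

theorem IsDoubleX.unique {x x₁ x₂ : F} (h0 : x ^ 3 + a * x + b ≠ 0) (h₁ : IsDoubleX a b x x₁)
    (h₂ : IsDoubleX a b x x₂) : x₁ = x₂ := by
  rw [IsDoubleX] at h₁ h₂
  apply mul_left_cancel₀ (mul_ne_zero (show (4 : F) ≠ 0 by norm_num) h0)
  rw [h₁, h₂]

/-- The difference of the two relations is divisible by x - x' and determines p = xx' from s = x +
x'; eliminating p from their sum leaves the sextic. -/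
theorem torsionSextic_of_isDoubleX {x x' : F} (hne : x ≠ x') (h : IsDoubleX a b x x')
    (h' : IsDoubleX a b x' x) : torsionSextic a b (x + x') = 0 := by
  rw [IsDoubleX] at h h'
  have h1 : 6 * (x * x') * (x + x') = (x + x') ^ 3 - 2 * a * (x + x') - 4 * b := by
    apply mul_left_cancel₀ (sub_ne_zero.mpr hne)
    linear_combination h - h'
  have h2 : 8 * (x + x') ^ 2 * (x * x') - 10 * (x * x') ^ 2 + 4 * a * (x * x') +
      12 * b * (x + x') - (x + x') ^ 4 + 2 * a * (x + x') ^ 2 - 2 * a ^ 2 = 0 := by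
    linear_combination h + h'
  generalize x + x' = s at *
  generalize x * x' = p at *
  rw [torsionSextic]
  grind

/-- The elimination can be reversed: b ≠ 0 forces s ≠ 0, so p is determined, and x, x' are the roots
of X² - sX + p. A double root would make the discriminant vanish. -/
theorem exists_isDoubleX_of_torsionSextic [IsAlgClosed F] (hb : b ≠ 0)
    (hΔ : 4 * a ^ 3 + 27 * b ^ 2 ≠ 0) {s : F} (h : torsionSextic a b s = 0) :
    ∃ x x', x ≠ x' ∧ x + x' = s ∧ IsDoubleX a b x x' ∧ IsDoubleX a b x' x := by
  have hs : s ≠ 0 := by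
    rintro rfl
    apply hb
    simpa [torsionSextic] using h
  obtain ⟨p, hp⟩ : ∃ p, 6 * p * s = s ^ 3 - 2 * a * s - 4 * b :=
    ⟨(s ^ 3 - 2 * a * s - 4 * b) / (6 * s), by field_simp⟩
  obtain ⟨r, hr⟩ := IsAlgClosed.exists_pow_nat_eq (s ^ 2 - 4 * p) (n := 2) (by norm_num)
  have h2 : 8 * s ^ 2 * p - 10 * p ^ 2 + 4 * a * p + 12 * b * s - s ^ 4 + 2 * a * s ^ 2 -
      2 * a ^ 2 = 0 := by
    have : 36 * s ^ 2 * (8 * s ^ 2 * p - 10 * p ^ 2 + 4 * a * p + 12 * b * s - s ^ 4 +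
      2 * a * s ^ 2 - 2 * a ^ 2) = 0 := by
      rw [torsionSextic] at h
      linear_combination 2 * h + (48 * s ^ 3 - 10 * (6 * p * s) - 10 * (s ^ 3 - 2 * a * s - 4 * b)
        + 24 * a * s) * hp
    simpa [hs] using this
  refine ⟨(s + r) / 2, (s - r) / 2, fun he => ?_, by ring, ?_, ?_⟩
  · have hr0 : r = 0 := by linear_combination he
    rw [hr0] at hr
    obtain rfl : p = s ^ 2 / 4 := by linear_combination (1 / 4 : F) * hr
    obtain rfl : b = -(s / 2) ^ 3 - a * (s / 2) := by linear_combination (1 / 4 : F) * hp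
    have h3 : (3 * s ^ 2 + 4 * a) ^ 2 = 0 := by linear_combination -8 * h2
    have h4 : a = -3 * s ^ 2 / 4 := by
      have := pow_eq_zero_iff (two_ne_zero) |>.mp h3
      linear_combination (1 / 4 : F) * this
    exact hΔ (by rw [h4]; ring)
  · rw [IsDoubleX]
    have e : p = (s + r) / 2 * ((s - r) / 2) := by linear_combination (1 / 4 : F) * hr
    rw [e] at hp h2
    linear_combination (1 / 2 : F) * h2 + r / 2 * hp
  · rw [IsDoubleX]
    have e : p = (s + r) / 2 * ((s - r) / 2) := by linear_combination (1 / 4 : F) * hr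
    rw [e] at hp h2
    linear_combination (1 / 2 : F) * h2 - r / 2 * hp

variable [DecidableEq F]

theorem two_nsmul_some_of_ne_zero {x y : F} (h : (shortCurve a b).toAffine.Nonsingular x y)
    (hy : y ≠ 0) : ∃ (x' y' : F) (h' : (shortCurve a b).toAffine.Nonsingular x' y'),
      2 • Affine.Point.some x y h = Affine.Point.some x' y' h' ∧ IsDoubleX a b x x' := by
  have hy' : y ≠ (shortCurve a b).toAffine.negY x y := by
    rw [shortCurve_negY]
    intro h0
    apply hy
    linear_combination (1 / 2 : F) * h0
  refine ⟨_, _, _, (two_nsmul _).trans (Affine.Point.add_self_of_Y_ne hy'), ?_⟩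
  have h1 := shortCurve_equation h
  rw [Affine.slope_of_Y_ne rfl hy', shortCurve_negY, IsDoubleX]
  simp only [shortCurve, Affine.addX]
  have h2 : y - -y = 2 * y := by ring
  rw [h2, ← h1]
  field_simp
  grind

theorem two_nsmul_some {x y x' y' : F} {h : (shortCurve a b).toAffine.Nonsingular x y}
    {h' : (shortCurve a b).toAffine.Nonsingular x' y'}
    (he : 2 • Affine.Point.some x y h = Affine.Point.some x' y' h') : IsDoubleX a b x x' := by
  by_cases hy : y = 0
  · subst hy
    rw [two_nsmul, Affine.Point.add_self_of_Y_eq (by rw [shortCurve_negY, neg_zero])] at he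
    exact absurd he.symm (Affine.Point.some_ne_zero _)
  · obtain ⟨x₂, y₂, h₂, e₂, hd⟩ := two_nsmul_some_of_ne_zero h hy
    rw [he, Affine.Point.some.injEq] at e₂
    rwa [e₂.1]

/-- Here 4P = -P has the x-coordinate of P, so doubling exchanges the two x-coordinates. If they
agreed, then 2P = ±P, which with 5P = 0 gives P = 0. -/
theorem isDoubleX_of_five_nsmul {x y x' y' : F} {h : (shortCurve a b).toAffine.Nonsingular x y}
    {h' : (shortCurve a b).toAffine.Nonsingular x' y'}
    (h5 : 5 • Affine.Point.some x y h = 0)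
    (h2 : 2 • Affine.Point.some x y h = Affine.Point.some x' y' h') :
    x ≠ x' ∧ IsDoubleX a b x x' ∧ IsDoubleX a b x' x := by
  refine ⟨fun hx => ?_, two_nsmul_some h2, ?_⟩
  · subst hx
    have h0 : Affine.Point.some x y h ≠ 0 := Affine.Point.some_ne_zero _
    rcases Affine.Point.X_eq_iff (h₁ := h) (h₂ := h') |>.mp rfl with e | e
    · rw [← h2] at e
      exact h0 (by simp [two_nsmul] at e)
    · rw [← h2] at e
      have h3 : 3 • Affine.Point.some x y h = 0 := by
        rw [show (3 : ℕ) = 1 + 2 from rfl, add_nsmul, one_nsmul]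
        nth_rewrite 1 [e]
        exact neg_add_cancel _
      apply h0
      have : (6 : ℕ) • Affine.Point.some x y h = 0 := by
        rw [show (6 : ℕ) = 3 * 2 from rfl, mul_nsmul, h3, smul_zero]
      rwa [show (6 : ℕ) = 5 + 1 from rfl, add_nsmul, h5, zero_add, one_nsmul] at this
  · have e : 2 • Affine.Point.some x' y' h' = -Affine.Point.some x y h := by
      rw [← h2, ← mul_nsmul]
      apply eq_neg_of_add_eq_zero_left
      rw [← h5, show (5 : ℕ) = 2 * 2 + 1 from rfl, add_nsmul, one_nsmul]
    rw [Affine.Point.neg_some] at e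
    exact two_nsmul_some e

/-- The point 4P has the x-coordinate of P, so 4P = ±P. The plus sign means 2P = -P and hence x =
x', leaving 5P = 0. -/
theorem five_nsmul_of_isDoubleX [IsAlgClosed F] (hΔ : 4 * a ^ 3 + 27 * b ^ 2 ≠ 0) {x x' : F}
    (hne : x ≠ x') (h : IsDoubleX a b x x') (h' : IsDoubleX a b x' x) :
    ∃ (y y' : F) (hP : (shortCurve a b).toAffine.Nonsingular x y)
      (hP' : (shortCurve a b).toAffine.Nonsingular x' y'),
      5 • Affine.Point.some x y hP = 0 ∧
      2 • Affine.Point.some x y hP = Affine.Point.some x' y' hP' := by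
  have hx := ne_zero_of_isDoubleX hΔ h
  have hx' := ne_zero_of_isDoubleX hΔ h'
  obtain ⟨y, hy⟩ := IsAlgClosed.exists_pow_nat_eq (x ^ 3 + a * x + b) (n := 2) (by norm_num)
  have hy0 : y ≠ 0 := by rintro rfl; exact hx (by rw [← hy]; ring)
  have hP : (shortCurve a b).toAffine.Nonsingular x y := by
    rw [← Affine.equation_iff_nonsingular_of_Δ_ne_zero
      (by rw [shortCurve_Δ]; exact mul_ne_zero (by norm_num) hΔ), Affine.equation_iff]
    simpa [shortCurve] using hy
  obtain ⟨x₂, y', hP', e2, hd⟩ := two_nsmul_some_of_ne_zero hP hy0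
  obtain rfl := hd.unique hx h
  have hy' : y' ≠ 0 := by
    rintro rfl
    exact hx' (by rw [← shortCurve_equation hP']; ring)
  refine ⟨y, y', hP, hP', ?_, e2⟩
  obtain ⟨x₃, y₃, h₃, e4, hd'⟩ := two_nsmul_some_of_ne_zero hP' hy'
  obtain rfl := hd'.unique hx' h'
  rw [← e2, ← mul_nsmul] at e4
  rcases Affine.Point.X_eq_iff (h₁ := h₃) (h₂ := hP) |>.mp rfl with e | e
  · exfalso
    rw [e, ← sub_eq_zero, show (2 * 2 : ℕ) = 1 + 2 + 1 from rfl, add_nsmul, one_nsmul,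
      add_sub_cancel_right, add_nsmul, one_nsmul, add_eq_zero_iff_eq_neg, e2] at e4
    exact hne (Affine.Point.X_eq_iff.mpr (Or.inr e4))
  · rw [e, eq_neg_iff_add_eq_zero] at e4
    rw [show (5 : ℕ) = 2 * 2 + 1 from rfl, add_nsmul, one_nsmul, e4]

end Torsion

theorem fiveTorsionSums_shortCurve {a b : Qbar} (hb : b ≠ 0) (hΔ : 4 * a ^ 3 + 27 * b ^ 2 ≠ 0) :
    fiveTorsionSums (shortCurve a b) = {s | torsionSextic a b s = 0} := by
  classical
  ext s
  constructor
  · rintro ⟨x, y, x', y', h, h', h5, h2, rfl⟩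
    obtain ⟨hne, hd, hd'⟩ := isDoubleX_of_five_nsmul h5 h2
    exact torsionSextic_of_isDoubleX hne hd hd'
  · intro hs
    obtain ⟨x, x', hne, rfl, hd, hd'⟩ := exists_isDoubleX_of_torsionSextic hb hΔ hs
    obtain ⟨y, y', hP, hP', h5, h2⟩ := five_nsmul_of_isDoubleX hΔ hne hd hd'
    exact ⟨x, y, x', y', hP, hP', h5, h2, rfl⟩

/-! ### Splitting the torsion sextic by icosahedral forms -/

section Sextic

variable {F : Type*}

/-- The form attached to the point at infinity of `ℙ¹(𝔽₅)`. -/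
def sexticInf [CommRing F] (z : F) : F := 10 * (z ^ 10 + 1)

/-- The form attached to the origin of `ℙ¹(𝔽₅)`. -/
def sexticFin [CommRing F] (z : F) : F :=
  -2 - 12 * z - 36 * z ^ 2 - 48 * z ^ 3 - 84 * z ^ 4 - 84 * z ^ 6 + 48 * z ^ 7 - 36 * z ^ 8 +
    12 * z ^ 9 - 2 * z ^ 10

theorem sexticFin_expansion [CommRing F] {ζ : F} (h : ζ ^ 5 = 1) (z : F) :
    sexticFin (ζ * z) = (-2 - 2 * z ^ 10) + (ζ * (-12 * z - 84 * z ^ 6) +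
      ζ ^ 2 * (-36 * z ^ 2 + 48 * z ^ 7) + ζ ^ 3 * (-48 * z ^ 3 - 36 * z ^ 8) +
      ζ ^ 4 * (-84 * z ^ 4 + 12 * z ^ 9)) := by
  rw [sexticFin]
  linear_combination (-84 * ζ * z ^ 6 + 48 * ζ ^ 2 * z ^ 7 - 36 * ζ ^ 3 * z ^ 8 +
    12 * ζ ^ 4 * z ^ 9 - 2 * (ζ ^ 5 + 1) * z ^ 10) * h

theorem sexticInf_rotate [CommRing F] {ζ : F} (h : ζ ^ 5 = 1) (z : F) :
    sexticInf (ζ * z) = sexticInf z := by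
  rw [sexticInf, sexticInf]
  linear_combination 10 * (ζ ^ 5 + 1) * z ^ 10 * h

variable [Field F]

theorem sextic_coeff_cubic {F : Type*} [CommRing F] (z : F) :
    (-12 * z - 84 * z ^ 6) ^ 2 * (-48 * z ^ 3 - 36 * z ^ 8) + (-36 * z ^ 2 + 48 * z ^ 7) ^ 2 * (-12 * z - 84 * z ^ 6) + (-48 * z ^ 3 - 36 * z ^ 8) ^ 2 * (-84 * z ^ 4 + 12 * z ^ 9) + (-84 * z ^ 4 + 12 * z ^ 9) ^ 2 * (-36 * z ^ 2 + 48 * z ^ 7) =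
      -22464 * z ^ 5 - 616896 * z ^ 10 - 616896 * z ^ 20 + 22464 * z ^ 25 := by
  ring

theorem sextic_coeff_quartic {F : Type*} [CommRing F] (z : F) :
    (-12 * z - 84 * z ^ 6) ^ 3 * (-36 * z ^ 2 + 48 * z ^ 7) + (-36 * z ^ 2 + 48 * z ^ 7) ^ 3 * (-84 * z ^ 4 + 12 * z ^ 9) + (-48 * z ^ 3 - 36 * z ^ 8) ^ 3 * (-12 * z - 84 * z ^ 6) + (-84 * z ^ 4 + 12 * z ^ 9) ^ 3 * (-48 * z ^ 3 - 36 * z ^ 8) - (-12 * z - 84 * z ^ 6) ^ 2 * (-84 * z ^ 4 + 12 * z ^ 9) ^ 2 - (-36 * z ^ 2 + 48 * z ^ 7) ^ 2 * (-48 * z ^ 3 - 36 * z ^ 8) ^ 2 + (-12 * z - 84 * z ^ 6) * (-36 * z ^ 2 + 48 * z ^ 7) * (-48 * z ^ 3 - 36 * z ^ 8) * (-84 * z ^ 4 + 12 * z ^ 9) =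
      62208 * z ^ 5 + 4209408 * z ^ 10 + 32368896 * z ^ 15 + 13333248 * z ^ 20 - 32368896 * z ^ 25 + 4209408 * z ^ 30 - 62208 * z ^ 35 := by
  ring

theorem sextic_coeff_quintic {F : Type*} [CommRing F] (z : F) :
    (-12 * z - 84 * z ^ 6) ^ 5 + (-36 * z ^ 2 + 48 * z ^ 7) ^ 5 + (-48 * z ^ 3 - 36 * z ^ 8) ^ 5 + (-84 * z ^ 4 + 12 * z ^ 9) ^ 5 - 5 * ((-12 * z - 84 * z ^ 6) ^ 3 * (-48 * z ^ 3 - 36 * z ^ 8) * (-84 * z ^ 4 + 12 * z ^ 9) + (-36 * z ^ 2 + 48 * z ^ 7) ^ 3 * (-12 * z - 84 * z ^ 6) * (-48 * z ^ 3 - 36 * z ^ 8) + (-48 * z ^ 3 - 36 * z ^ 8) ^ 3 * (-36 * z ^ 2 + 48 * z ^ 7) * (-84 * z ^ 4 + 12 * z ^ 9) + (-84 * z ^ 4 + 12 * z ^ 9) ^ 3 * (-12 * z - 84 * z ^ 6) * (-36 * z ^ 2 + 48 * z ^ 7)) + 5 * ((-12 * z - 84 * z ^ 6) ^ 2 * (-36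 * z ^ 2 + 48 * z ^ 7) ^ 2 * (-84 * z ^ 4 + 12 * z ^ 9) + (-36 * z ^ 2 + 48 * z ^ 7) ^ 2 * (-84 * z ^ 4 + 12 * z ^ 9) ^ 2 * (-48 * z ^ 3 - 36 * z ^ 8) + (-48 * z ^ 3 - 36 * z ^ 8) ^ 2 * (-12 * z - 84 * z ^ 6) ^ 2 * (-36 * z ^ 2 + 48 * z ^ 7) + (-84 * z ^ 4 + 12 * z ^ 9) ^ 2 * (-48 * z ^ 3 - 36 * z ^ 8) ^ 2 * (-12 * z - 84 * z ^ 6)) =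
      -248832 * z ^ 5 - 38071296 * z ^ 10 - 657911808 * z ^ 15 - 3333602304 * z ^ 20 - 3333602304 * z ^ 30 + 657911808 * z ^ 35 - 38071296 * z ^ 40 + 248832 * z ^ 45 := by
  ring

/-- One root is invariant under rotation and the other five form a rotation orbit, so
`circulant_product` applies after subtracting their common constant component -2 - 2z¹⁰. -/
theorem torsionSextic_forms {ζ : F} (h5 : ζ ^ 5 = 1) (hsum : 1 + ζ + ζ ^ 2 + ζ ^ 3 + ζ ^ 4 = 0)
    (z s : F) :
    torsionSextic (-3 * formH z) (-2 * formT z) s =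
      (s - sexticInf z) * ((s - sexticFin z) * (s - sexticFin (ζ * z)) *
        (s - sexticFin (ζ ^ 2 * z)) * (s - sexticFin (ζ ^ 3 * z)) *
        (s - sexticFin (ζ ^ 4 * z))) := by
  have hpow (k : ℕ) : (ζ ^ k) ^ 5 = 1 := by rw [← pow_mul, mul_comm, pow_mul, h5, one_pow]
  have r0 := sexticFin_expansion (one_pow 5) z
  rw [one_mul] at r0
  rw [r0, sexticFin_expansion h5, sexticFin_expansion (hpow 2), sexticFin_expansion (hpow 3),
    sexticFin_expansion (hpow 4)]
  have hc := circulant_product hsum (s - (-2 - 2 * z ^ 10)) (-12 * z - 84 * z ^ 6)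
    (-36 * z ^ 2 + 48 * z ^ 7) (-48 * z ^ 3 - 36 * z ^ 8) (-84 * z ^ 4 + 12 * z ^ 9)
  have p6 : ζ ^ 6 = ζ := by linear_combination ζ * h5
  have p8 : ζ ^ 8 = ζ ^ 3 := by linear_combination ζ ^ 3 * h5
  have p9 : ζ ^ 9 = ζ ^ 4 := by linear_combination ζ ^ 4 * h5
  have p12 : ζ ^ 12 = ζ ^ 2 := by linear_combination (ζ ^ 7 + ζ ^ 2) * h5
  have p16 : ζ ^ 16 = ζ := by linear_combination (ζ ^ 11 + ζ ^ 6 + ζ) * h5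
  simp only [← pow_mul, Nat.reduceMul, p6, p8, p9, p12, p16]
  have e2 : (-12 * z - 84 * z ^ 6) * (-84 * z ^ 4 + 12 * z ^ 9) +
      (-36 * z ^ 2 + 48 * z ^ 7) * (-48 * z ^ 3 - 36 * z ^ 8) =
      2736 * z ^ 5 + 5904 * z ^ 10 - 2736 * z ^ 15 := by ring
  have e3 := sextic_coeff_cubic z
  have e4 := sextic_coeff_quartic z
  have e5 := sextic_coeff_quintic z
  rw [e2, e3, e4, e5] at hc
  have hy : s = s - (-2 - 2 * z ^ 10) + (-2 - 2 * z ^ 10) := by ring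
  calc _ = (s - sexticInf z) * _ := ?_
    _ = _ := congrArg _ (hc.symm.trans ?_)
  · rw [sexticInf, show s - 10 * (z ^ 10 + 1) = s - (-2 - 2 * z ^ 10) - 12 * (z ^ 10 + 1) by ring]
    nth_rewrite 1 [hy]
    generalize s - (-2 - 2 * z ^ 10) = y
    rw [torsionSextic, formH, formT]
    have p (k : ℕ) : z ^ (5 * k) = (z ^ 5) ^ k := pow_mul z 5 k
    have p2 := p 2; have p3 := p 3; have p4 := p 4; have p5 := p 5; have p6 := p 6; have p7 := p 7
    have p8 := p 8; have p9 := p 9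
    norm_num only at p2 p3 p4 p5 p6 p7 p8 p9
    simp only [p2, p3, p4, p5, p6, p7, p8, p9]
    generalize z ^ 5 = u
    ring
  · refine congrArg₂ _ (congrArg₂ _ (congrArg₂ _ (congrArg₂ _ ?_ ?_) ?_) ?_) ?_ <;> ring

/-- The pairing {∞, 0}, {1, 4}, {2, 3} of ℙ¹(𝔽₅) gives a sum of products equal to -12H + 144fW, by
`formW_mul`. Since 1/(λ + 3) = -fW/H, this sum determines λ. -/
theorem sextic_matching {ζ : F} (h5 : ζ ^ 5 = 1) (hsum : 1 + ζ + ζ ^ 2 + ζ ^ 3 + ζ ^ 4 = 0) (z : F) :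
    sexticInf z * sexticFin z + sexticFin (ζ * z) * sexticFin (ζ ^ 4 * z) +
      sexticFin (ζ ^ 2 * z) * sexticFin (ζ ^ 3 * z) =
      formW z * (-12 * formO z ^ 2 + 180 * formF z) := by
  have hpow (k : ℕ) : (ζ ^ k) ^ 5 = 1 := by rw [← pow_mul, mul_comm, pow_mul, h5, one_pow]
  have key (o a b c d : F) : (o + (ζ * a + ζ ^ 2 * b + ζ ^ 3 * c + ζ ^ 4 * d)) *
      (o + (ζ ^ 4 * a + (ζ ^ 4) ^ 2 * b + (ζ ^ 4) ^ 3 * c + (ζ ^ 4) ^ 4 * d)) +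
      (o + (ζ ^ 2 * a + (ζ ^ 2) ^ 2 * b + (ζ ^ 2) ^ 3 * c + (ζ ^ 2) ^ 4 * d)) *
      (o + (ζ ^ 3 * a + (ζ ^ 3) ^ 2 * b + (ζ ^ 3) ^ 3 * c + (ζ ^ 3) ^ 4 * d)) =
      2 * (o ^ 2 + a ^ 2 + b ^ 2 + c ^ 2 + d ^ 2) - (o * a + o * b + o * c + o * d + a * b +
        a * c + a * d + b * c + b * d + c * d) := by
    grind
  rw [add_assoc, sexticFin_expansion h5, sexticFin_expansion (hpow 2), sexticFin_expansion (hpow 3),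
    sexticFin_expansion (hpow 4), key]
  simp only [sexticInf, sexticFin, formW, formO, formF]
  ring

/-- The six values of `x_P + x_{2P}`. -/
def sexticRoot (ζ z : F) : Option (Fin 5) → F
  | none => formH z / formT z * sexticInf z
  | some ν => formH z / formT z * sexticFin (ζ ^ (ν : ℕ) * z)

/-- Scaling x by H/T turns the coefficients -3H, -2T into 3κ, 2κ with κ = -H³/T², which depend only
on j. -/
theorem torsionSextic_eq_zero_iff {ζ z : F} (hζ : IsPrimitiveRoot ζ 5) (hH : formH z ≠ 0)
    (hT : formT z ≠ 0) (s : F) :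
    torsionSextic (3 * (-formH z ^ 3 / formT z ^ 2)) (2 * (-formH z ^ 3 / formT z ^ 2)) s = 0 ↔
      ∃ i, sexticRoot ζ z i = s := by
  have hc : formH z / formT z ≠ 0 := div_ne_zero hH hT
  obtain ⟨s, rfl⟩ : ∃ s₀, s = formH z / formT z * s₀ := ⟨s / (formH z / formT z), by field_simp⟩
  have e : torsionSextic (3 * (-formH z ^ 3 / formT z ^ 2)) (2 * (-formH z ^ 3 / formT z ^ 2))
      (formH z / formT z * s) = (formH z / formT z) ^ 6 *
        torsionSextic (-3 * formH z) (-2 * formT z) s := by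
    rw [torsionSextic, torsionSextic]; field_simp
  rw [e, torsionSextic_forms hζ.pow_eq_one (primitive_five_sum hζ), Option.exists,
    Fin.exists_fin_succ, Fin.exists_fin_succ, Fin.exists_fin_succ, Fin.exists_fin_succ,
    Fin.exists_fin_one]
  simp only [mul_eq_zero, pow_ne_zero 6 hc, false_or, sub_eq_zero, or_assoc, sexticRoot,
    mul_right_inj' hc, @eq_comm _ _ s]
  simp

end Sextic

/-! ### Galois action on z and on the sextic roots -/

section GaloisAction

variable {F : Type*} [Field F]

theorem map_sexticRoot (σ : F →+* F) (ζ z : F) (i : Option (Fin 5)) :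
    σ (sexticRoot ζ z i) = sexticRoot (σ ζ) (σ z) i := by
  cases i <;> simp [sexticRoot, sexticInf, sexticFin, map_formH, map_formT, map_ofNat]

theorem formH_inv {z : F} (hz : z ≠ 0) : formH (-1 / z) = formH z / z ^ 20 := by
  rw [formH, formH]; field_simp; ring

theorem formT_inv {z : F} (hz : z ≠ 0) : formT (-1 / z) = formT z / z ^ 30 := by
  rw [formT, formT]; field_simp; ring

theorem sexticInf_inv {z : F} (hz : z ≠ 0) : sexticInf (-1 / z) = sexticInf z / z ^ 10 := by
  rw [sexticInf, sexticInf]; field_simp; ring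

theorem sexticFin_inv {z : F} (hz : z ≠ 0) : sexticFin (-1 / z) = sexticFin z / z ^ 10 := by
  rw [sexticFin, sexticFin]; field_simp; ring

theorem sexticRoot_inv {ζ z : F} (hζ : ζ ^ 5 = 1) (hz : z ≠ 0) (hT : formT z ≠ 0)
    (i : Option (Fin 5)) : sexticRoot (ζ ^ 4) (-1 / z) i = sexticRoot ζ z i := by
  have hζ0 : ζ ≠ 0 := fun h0 => by simp [h0] at hζ
  cases i with
  | none =>
    rw [sexticRoot, sexticRoot, formH_inv hz, formT_inv hz, sexticInf_inv hz]; field_simp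
  | some ν =>
    have hpow : (ζ ^ (ν : ℕ)) ^ 5 = 1 := by rw [← pow_mul, mul_comm, pow_mul, hζ, one_pow]
    have h10 : (ζ ^ (ν : ℕ) * z) ^ 10 = z ^ 10 := by
      rw [mul_pow]; linear_combination ((ζ ^ (ν : ℕ)) ^ 5 + 1) * z ^ 10 * hpow
    have e : (ζ ^ 4) ^ (ν : ℕ) * (-1 / z) = -1 / (ζ ^ (ν : ℕ) * z) := by
      rw [← pow_mul, mul_comm 4, pow_mul]
      have := pow_ne_zero (ν : ℕ) hζ0
      generalize ζ ^ (ν : ℕ) = c at *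
      field_simp
      rw [hpow]
    rw [sexticRoot, sexticRoot, formH_inv hz, formT_inv hz, e,
      sexticFin_inv (mul_ne_zero (pow_ne_zero _ hζ0) hz), h10]
    field_simp

theorem gauss_sum_sq {ζ : F} (h : 1 + ζ + ζ ^ 2 + ζ ^ 3 + ζ ^ 4 = 0) :
    (ζ + ζ ^ 4 - ζ ^ 2 - ζ ^ 3) ^ 2 = 5 := by
  grind

/-- The Gauss sum is a square root of 5 and changes sign under ζ ↦ ζ² and ζ ↦ ζ³. -/
theorem eq_or_eq_of_map_gauss_sum [CharZero F] {ζ : F} (hζ : IsPrimitiveRoot ζ 5) (σ : F →+* F)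
    (h : σ (ζ + ζ ^ 4 - ζ ^ 2 - ζ ^ 3) = ζ + ζ ^ 4 - ζ ^ 2 - ζ ^ 3) :
    σ ζ = ζ ∨ σ ζ = ζ ^ 4 := by
  have h5 := hζ.pow_eq_one
  have hs := primitive_five_sum hζ
  have hσ : IsPrimitiveRoot (σ ζ) 5 := hζ.map_of_injective σ.injective
  obtain ⟨k, hk, e⟩ := hζ.eq_pow_of_pow_eq_one hσ.pow_eq_one
  have hg := gauss_sum_sq hs
  have hne : ζ + ζ ^ 4 - ζ ^ 2 - ζ ^ 3 ≠ 0 := fun h0 => by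
    rw [h0] at hg; norm_num at hg
  have hneg : ζ + ζ ^ 4 - ζ ^ 2 - ζ ^ 3 ≠ -(ζ + ζ ^ 4 - ζ ^ 2 - ζ ^ 3) := fun h0 => by
    apply hne
    linear_combination (1 / 2 : F) * h0
  simp only [map_sub, map_add, map_pow, ← e] at h
  interval_cases k
  · exact absurd (by rw [← e, pow_zero]) (hσ.ne_one (by norm_num))
  · exact Or.inl (by rw [← e, pow_one])
  · exact absurd (by rw [← h]; grind) hneg
  · exact absurd (by rw [← h]; grind) hneg
  · exact Or.inr e.symm

/-- If σ fixes ζ it fixes all Fourier coefficients of the resolvents and hence z. If it inverts ζ it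
exchanges the coefficients of index k and 5 - k, which forces z ↦ -1/z. A nonzero resolvent ensures
that some usable Fourier component is nonzero. -/
theorem map_sexticRoot_eq_of_fixed [CharZero F] {ζ z m n : F} (hζ : IsPrimitiveRoot ζ 5)
    (hf : formF z ≠ 0) (hH : formH z ≠ 0) (hT : formT z ≠ 0) (σ : F →+* F)
    (hx : ∀ ν : Fin 5, σ (resVal m n (ζ ^ (ν : ℕ) * z)) = resVal m n (ζ ^ (ν : ℕ) * z))
    (hinj : ∃ ν : Fin 5, resVal m n (ζ ^ (ν : ℕ) * z) ≠ 0)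
    (h : σ (ζ + ζ ^ 4 - ζ ^ 2 - ζ ^ 3) = ζ + ζ ^ 4 - ζ ^ 2 - ζ ^ 3) (i : Option (Fin 5)) :
    σ (sexticRoot ζ z i) = sexticRoot ζ z i := by
  have h5 := hζ.pow_eq_one
  have hz : z ≠ 0 := fun h0 => hf (by simp [h0, formF])
  have hmap (k : ℕ) : σ (resFourier ζ m n z k) =
      ∑ ν : Fin 5, (σ ζ ^ k) ^ (ν : ℕ) * resVal m n (ζ ^ (ν : ℕ) * z) := by
    simp [resFourier, hx]
  obtain ⟨r4, r3, r2, r1⟩ := resFourier_eq hζ m n hf hH hT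
  have hAC : resA m n z ≠ 0 ∨ resC m n z ≠ 0 := by
    by_contra! h0
    obtain ⟨ν, hν⟩ := hinj
    have hpow : (ζ ^ (ν : ℕ)) ^ 5 = 1 := by rw [← pow_mul, mul_comm, pow_mul, h5, one_pow]
    exact hν (by rw [resVal_expansion hpow m n hf hH hT, h0.1, h0.2]; ring)
  rw [map_sexticRoot]
  rcases eq_or_eq_of_map_gauss_sum hζ σ h with e | e
  · have hfix (k : ℕ) : σ (resFourier ζ m n z k) = resFourier ζ m n z k := by
      rw [hmap, e, resFourier]
    have f4 := hfix 4; have f3 := hfix 3; have f2 := hfix 2; have f1 := hfix 1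
    rw [r4] at f4; rw [r3, map_mul, f4] at f3; rw [r2] at f2; rw [r1, map_neg, map_mul, f2] at f1
    have hσ : σ z = z := by
      rcases hAC with h0 | h0
      · exact mul_right_cancel₀ (mul_ne_zero (by norm_num) h0) f3
      · exact mul_right_cancel₀ (mul_ne_zero (by norm_num) h0) (neg_injective f1)
    rw [e, hσ]
  · have hfix (k l : ℕ) (hkl : ζ ^ (4 * k) = ζ ^ l) :
        σ (resFourier ζ m n z k) = resFourier ζ m n z l := by
      rw [hmap, e, resFourier, ← pow_mul, hkl]
    have f4 := hfix 4 1 (by linear_combination (ζ ^ 11 + ζ ^ 6 + ζ) * h5)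
    have f3 := hfix 3 2 (by linear_combination (ζ ^ 7 + ζ ^ 2) * h5)
    have f2 := hfix 2 3 (by linear_combination ζ ^ 3 * h5)
    have f1 := hfix 1 4 rfl
    rw [r4, r1] at f4; rw [r3, r2, map_mul, f4] at f3; rw [r2, r3] at f2
    rw [r1, r4, map_neg, map_mul, f2] at f1
    have hσ : σ z = -1 / z := by
      rw [eq_div_iff hz]
      rcases hAC with h0 | h0
      · apply mul_right_cancel₀ (mul_ne_zero (show (5 : F) ≠ 0 by norm_num) h0)
        linear_combination -f1
      · apply mul_right_cancel₀ (mul_ne_zero (show (5 : F) ≠ 0 by norm_num) h0)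
        linear_combination -f3
    rw [e, hσ, sexticRoot_inv h5 hz hT]

theorem resVal_mem_of_sexticRoot_mem [CharZero F] {ζ z m n : F} (hζ : IsPrimitiveRoot ζ 5)
    (hf : formF z ≠ 0) (hH : formH z ≠ 0) (hT : formT z ≠ 0) (M : Subfield F)
    (hm : m ∈ M) (hn : n ∈ M) (hk : formH z ^ 3 / formT z ^ 2 ∈ M)
    (hs : ∀ i, sexticRoot ζ z i ∈ M) (ν : Fin 5) : resVal m n (ζ ^ (ν : ℕ) * z) ∈ M := by
  have h5 := hζ.pow_eq_one
  have hpow : (ζ ^ (ν : ℕ)) ^ 5 = 1 := by rw [← pow_mul, mul_comm, pow_mul, h5, one_pow]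
  have hfin (k : ℕ) : formH z / formT z * sexticFin (ζ ^ k * (ζ ^ (ν : ℕ) * z)) ∈ M := by
    -- Rotating the base point to w = ζ^ν z only permutes the six roots, so the single pairing of
    -- `sextic_matching` serves every ν.
    have : ζ ^ k * (ζ ^ (ν : ℕ) * z) = ζ ^ ((k + ν) % 5) * z := by
      rw [← mul_assoc, ← pow_add]
      congr 1
      conv_lhs => rw [← Nat.div_add_mod (k + ν) 5, pow_add, pow_mul, h5, one_pow, one_mul]
    rw [this]
    exact hs (some ⟨(k + ν) % 5, Nat.mod_lt _ (by norm_num)⟩)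
  have hinf : formH z / formT z * sexticInf z ∈ M := hs none
  obtain ⟨w, hw⟩ : ∃ w, w = ζ ^ (ν : ℕ) * z := ⟨_, rfl⟩
  rw [← hw] at hfin ⊢
  have eF : formF w ≠ 0 := by
    rw [hw, formF_rotate hpow]
    exact mul_ne_zero (pow_ne_zero _ (hζ.ne_zero (by norm_num))) hf
  rw [← formH_rotate hpow, ← hw] at hH hk hfin hinf
  rw [← formT_rotate hpow, ← hw] at hT hk hfin hinf
  rw [← sexticInf_rotate hpow, ← hw] at hinf
  have hmat := sextic_matching h5 (primitive_five_sum hζ) w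
  have f0 := hfin 0; have f1 := hfin 1; have f2 := hfin 2; have f3 := hfin 3; have f4 := hfin 4
  rw [pow_zero, one_mul] at f0
  rw [pow_one] at f1
  have hsum := M.add_mem (M.add_mem (M.mul_mem hinf f0) (M.mul_mem f1 f4)) (M.mul_mem f2 f3)
  have hu : 1 / (lamVal w + 3) ∈ M := by
    have : 1 / (lamVal w + 3) = -(formH w / formT w * sexticInf w * (formH w / formT w * sexticFin w) +
        formH w / formT w * sexticFin (ζ * w) * (formH w / formT w * sexticFin (ζ ^ 4 * w)) +
        formH w / formT w * sexticFin (ζ ^ 2 * w) * (formH w / formT w * sexticFin (ζ ^ 3 * w))) /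
        (144 * (formH w ^ 3 / formT w ^ 2)) - 1 / 12 := by
      calc 1 / (lamVal w + 3) = -(formF w * formW w) / formH w := lamVal_add_three eF hH
        _ = -(formW w * (-12 * formO w ^ 2 + 180 * formF w)) / (144 * formH w) - 1 / 12 := by
          field_simp
          rw [← formW_mul]
          ring
        _ = _ := by
          rw [← hmat]
          field_simp
    rw [this]
    exact M.sub_mem (M.div_mem (M.neg_mem hsum) (M.mul_mem (ofNat_mem M 144) hk))
      (M.div_mem M.one_mem (ofNat_mem M 12))
  have hl : lamVal w + 3 ∈ M := by
    have := M.inv_mem hu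
    rwa [one_div, inv_inv] at this
  have hl' : lamVal w ∈ M := by
    have := M.sub_mem hl (ofNat_mem M 3)
    rwa [add_sub_cancel_right] at this
  exact M.add_mem (M.div_mem hm hl) (M.div_mem (M.mul_mem (ofNat_mem M 12) hn)
    (M.mul_mem hl (M.add_mem (M.add_mem (M.pow_mem hl' 2) (M.mul_mem (ofNat_mem M 10) hl'))
      (ofNat_mem M 45))))

end GaloisAction

/-! ### The two inclusions between the fields -/

section EllipticCurve

open Polynomial IntermediateField

theorem mem_of_fixed {k K : Type*} [Field k] [Field K] [Algebra k K] [IsGalois k K]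
    (L : IntermediateField k K) {x : K}
    (h : ∀ σ : K ≃ₐ[k] K, (∀ y ∈ L, σ y = y) → σ x = x) : x ∈ L := by
  rw [← InfiniteGalois.fixedField_fixingSubgroup L, mem_fixedField_iff]
  intro σ hσ
  exact h σ fun y hy => (mem_fixingSubgroup_iff L σ).mp hσ y hy

instance isAlgClosure_Qbar : IsAlgClosure ℚ Qbar := by
  refine ⟨inferInstance, ⟨fun z => ?_⟩⟩
  obtain ⟨p, hp, h⟩ := (AlgebraicClosure.instIsAlgClosure ℚ).isAlgebraic.isAlgebraic z
  refine ⟨p, hp, ?_⟩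
  rw [aeval_def] at h ⊢
  -- The two ℚ-algebra structures have the same structure map, since ring homomorphisms out of ℚ are
  -- unique.
  rwa [Subsingleton.elim (algebraMap ℚ Qbar)]

instance isGalois_Qbar : IsGalois ℚ Qbar :=
  IsAlgClosure.isGalois ℚ Qbar

theorem rootSet_quintic_eq_range {a b c : ℚ} {x : Fin 5 → Qbar}
    (h : quintic (a : Qbar) b c = ∏ i, (X - C (x i))) :
    (quintic a b c).rootSet Qbar = Set.range x := by
  ext y
  rw [mem_rootSet_of_ne (quintic_monic a b c).ne_zero, aeval_def, ← eval_map, quintic_map]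
  simp only [eq_ratCast]
  rw [h, eval_prod, Finset.prod_eq_zero_iff]
  simp [sub_eq_zero, eq_comm]

theorem discr_cast (a b c : ℚ) :
    (quintic (a : Qbar) b c).discr = ((quintic a b c).discr : ℚ) := by
  have h1 := five_mul_discr_quintic (a : Qbar) b c
  have h2 := congrArg (Rat.cast : ℚ → Qbar) (five_mul_discr_quintic a b c)
  have h3 : ((invE a b c : ℚ) : Qbar) = invE (a : Qbar) b c := by simp [invE]
  push_cast at h2
  rw [h3, ← h1] at h2
  exact (mul_left_cancel₀ (by norm_num) h2).symm

/-- The root e of five times this quintic's discriminant is kept apart from the generator d, because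
the quintic may be a Tschirnhaus transform of the one that defines d. -/
theorem exists_ellipticCurve_of_resVal {ζ z d e m n : Qbar} {a b c : ℚ} (hζ : IsPrimitiveRoot ζ 5)
    (hf : formF z ≠ 0) (hH : formH z ≠ 0) (hT : formT z ≠ 0)
    (hm : m ∈ adjoin ℚ {d}) (hn : n ∈ adjoin ℚ {d}) (hj : jVal z ∈ adjoin ℚ {d})
    (hq : quintic (a : Qbar) b c = ∏ ν : Fin 5, (X - C (resVal m n (ζ ^ (ν : ℕ) * z))))
    (he : e ∈ adjoin ℚ {d}) (hd : e ^ 2 = algebraMap ℚ Qbar (5 * (quintic a b c).discr))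
    (hdisc : (quintic a b c).discr ≠ 0) :
    ∃ E : WeierstrassCurve (adjoin ℚ {d}), E.IsElliptic ∧
      (adjoin (adjoin ℚ {d}) (fiveTorsionSums (E.baseChange Qbar))).restrictScalars ℚ =
        adjoin ℚ ((quintic a b c).rootSet Qbar) ⊔ adjoin ℚ {d} := by
  have h5 := hζ.pow_eq_one
  have hs := primitive_five_sum hζ
  set κ : Qbar := -formH z ^ 3 / formT z ^ 2 with hκ
  have hκj : κ = jVal z / (1728 - jVal z) := by
    rw [sub_jVal hf, jVal, hκ]; field_simp
  have hκK : κ ∈ adjoin ℚ {d} := by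
    rw [hκj]; exact div_mem hj (sub_mem (ofNat_mem _ 1728) hj)
  have hκ0 : κ ≠ 0 := div_ne_zero (neg_ne_zero.mpr (pow_ne_zero _ hH)) (pow_ne_zero _ hT)
  have hκ1 : κ + 1 ≠ 0 := by
    have : κ + 1 = 1728 * formF z ^ 5 / formT z ^ 2 := by
      rw [hκ, eq_div_iff (pow_ne_zero _ hT)]
      field_simp
      rw [formT_sq]; ring
    rw [this]
    exact div_ne_zero (mul_ne_zero (by norm_num) (pow_ne_zero _ hf)) (pow_ne_zero _ hT)
  have hΔ : 4 * (3 * κ) ^ 3 + 27 * (2 * κ) ^ 2 ≠ 0 := by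
    have : 4 * (3 * κ) ^ 3 + 27 * (2 * κ) ^ 2 = 108 * κ ^ 2 * (κ + 1) := by ring
    rw [this]
    exact mul_ne_zero (mul_ne_zero (by norm_num) (pow_ne_zero _ hκ0)) hκ1
  let k : adjoin ℚ {d} := ⟨κ, hκK⟩
  have hbase : (shortCurve (3 * k) (2 * k)).baseChange Qbar = shortCurve (3 * κ) (2 * κ) := by
    have h2 : algebraMap (adjoin ℚ {d}) Qbar k = κ := rfl
    simp only [shortCurve, WeierstrassCurve.baseChange, WeierstrassCurve.map, map_mul, h2,
      map_ofNat, map_zero]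
  refine ⟨shortCurve (3 * k) (2 * k), ⟨?_⟩, ?_⟩
  · rw [shortCurve_Δ, isUnit_iff_ne_zero]
    intro h0
    have := congrArg (algebraMap (adjoin ℚ {d}) Qbar) h0
    simp only [map_mul, map_add, map_pow, map_neg, map_ofNat, map_zero] at this
    exact mul_ne_zero (by norm_num) hΔ this
  have hset : fiveTorsionSums (shortCurve (3 * κ) (2 * κ)) = Set.range (sexticRoot ζ z) := by
    rw [fiveTorsionSums_shortCurve (mul_ne_zero two_ne_zero hκ0) hΔ]
    ext s
    exact torsionSextic_eq_zero_iff hζ hH hT s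
  rw [hbase, hset, rootSet_quintic_eq_range hq]
  refine (restrictScalars_adjoin ℚ (adjoin ℚ {d}) (Set.range (sexticRoot ζ z))).trans ?_
  set x : Fin 5 → Qbar := fun ν => resVal m n (ζ ^ (ν : ℕ) * z) with hxdef
  have hdisc2 := quintic_discr_eq_sq hq
  rw [discr_cast] at hdisc2
  have hV : ∏ i, ∏ j ∈ Finset.Ioi i, (x i - x j) ≠ 0 := by
    intro h0
    rw [h0] at hdisc2
    apply hdisc
    have : (((quintic a b c).discr : ℚ) : Qbar) = 0 := by rw [hdisc2]; ring
    exact_mod_cast this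
  apply le_antisymm
  · rw [adjoin_le_iff]
    apply Set.union_subset (fun y hy => (le_sup_right : adjoin ℚ {d} ≤ _) hy)
    rintro _ ⟨i, rfl⟩
    apply mem_of_fixed
    intro σ hσ
    have hσx (ν : Fin 5) : σ (x ν) = x ν :=
      hσ _ ((le_sup_left : adjoin ℚ (Set.range x) ≤ _) (subset_adjoin _ _ ⟨ν, rfl⟩))
    have hσd : σ e = e :=
      hσ _ ((le_sup_right : adjoin ℚ {d} ≤ _) he)
    refine map_sexticRoot_eq_of_fixed hζ hf hH hT (σ : Qbar →+* Qbar) hσx ?_ ?_ i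
    · by_contra! h0
      apply hV
      apply Finset.prod_eq_zero (Finset.mem_univ 0)
      apply Finset.prod_eq_zero (i := 1) (by decide)
      rw [hxdef]
      simp only [h0, sub_self]
    -- Dividing √(5 Disc) by the product of root differences gives ±√5, so σ fixes the Gauss sum.
    · have hsq : (e / ∏ i, ∏ j ∈ Finset.Ioi i, (x i - x j)) ^ 2 =
          (ζ + ζ ^ 4 - ζ ^ 2 - ζ ^ 3) ^ 2 := by
        have h0 : (((quintic a b c).discr : ℚ) : Qbar) ≠ 0 := by exact_mod_cast hdisc
        rw [gauss_sum_sq hs, div_pow, ← hdisc2, hd, div_eq_iff h0]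
        simp
      have hfix : σ (e / ∏ i, ∏ j ∈ Finset.Ioi i, (x i - x j)) =
          e / ∏ i, ∏ j ∈ Finset.Ioi i, (x i - x j) := by
        simp [hσd, hσx]
      rcases sq_eq_sq_iff_eq_or_eq_neg.mp hsq with h | h
      · rw [h] at hfix
        exact hfix
      · rw [h, map_neg] at hfix
        exact neg_injective hfix
  · apply sup_le
    · rw [adjoin_le_iff]
      rintro _ ⟨ν, rfl⟩
      have hle : (adjoin ℚ {d} : Set Qbar) ⊆
          adjoin ℚ ((adjoin ℚ {d} : Set Qbar) ∪ Set.range (sexticRoot ζ z)) :=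
        Set.subset_union_left.trans (subset_adjoin _ _)
      refine resVal_mem_of_sexticRoot_mem hζ hf hH hT
        (adjoin ℚ ((adjoin ℚ {d} : Set Qbar) ∪ Set.range (sexticRoot ζ z))).toSubfield
        (hle hm) (hle hn) (hle ?_) (fun i => subset_adjoin _ _ (Or.inr ⟨i, rfl⟩)) ν
      have : formH z ^ 3 / formT z ^ 2 = -κ := by rw [hκ]; ring
      rw [this]
      exact neg_mem hκK
    · exact fun y hy => subset_adjoin _ _ (Or.inl hy)

end EllipticCurve

/-! ### Symmetric functions of five roots -/

section Symmetric

open Polynomial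

variable {R : Type*} [CommRing R]

/-- Minus the third elementary symmetric function. -/
def symA (y : Fin 5 → R) : R :=
  -(y 0 * y 1 * y 2 + y 0 * y 1 * y 3 + y 0 * y 1 * y 4 + y 0 * y 2 * y 3 + y 0 * y 2 * y 4 +
    y 0 * y 3 * y 4 + y 1 * y 2 * y 3 + y 1 * y 2 * y 4 + y 1 * y 3 * y 4 + y 2 * y 3 * y 4)

/-- The fourth elementary symmetric function. -/
def symB (y : Fin 5 → R) : R :=
  y 0 * y 1 * y 2 * y 3 + y 0 * y 1 * y 2 * y 4 + y 0 * y 1 * y 3 * y 4 + y 0 * y 2 * y 3 * y 4 +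
    y 1 * y 2 * y 3 * y 4

/-- Minus the fifth elementary symmetric function. -/
def symC (y : Fin 5 → R) : R := -(y 0 * y 1 * y 2 * y 3 * y 4)

/-- The second elementary symmetric function. -/
def symTwo (y : Fin 5 → R) : R :=
  y 0 * y 1 + y 0 * y 2 + y 0 * y 3 + y 0 * y 4 + y 1 * y 2 + y 1 * y 3 + y 1 * y 4 +
    y 2 * y 3 + y 2 * y 4 + y 3 * y 4

theorem prod_X_sub_C_eq (y : Fin 5 → R) :
    ∏ i, (X - C (y i)) = X ^ 5 - C (∑ i, y i) * X ^ 4 + C (symTwo y) * X ^ 3 + C (symA y) * X ^ 2 +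
      C (symB y) * X + C (symC y) := by
  simp only [Fin.prod_univ_five, Fin.sum_univ_five, symTwo, symA, symB, symC, map_add, map_mul,
    map_neg]
  ring

theorem sum_sq_eq (y : Fin 5 → R) : y ⬝ᵥ y = (∑ i, y i) ^ 2 - 2 * symTwo y := by
  simp only [dotProduct, Fin.sum_univ_five, symTwo]
  ring

theorem coeff_prod_X_sub_C (y : Fin 5 → R) :
    (∏ i, (X - C (y i))).coeff 4 = -∑ i, y i ∧ (∏ i, (X - C (y i))).coeff 3 = symTwo y ∧
    (∏ i, (X - C (y i))).coeff 2 = symA y ∧ (∏ i, (X - C (y i))).coeff 1 = symB y ∧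
    (∏ i, (X - C (y i))).coeff 0 = symC y := by
  rw [prod_X_sub_C_eq]
  generalize ∑ i, y i = s
  refine ⟨?_, ?_, ?_, ?_, ?_⟩ <;> simp [coeff_X, coeff_C]

theorem sym_comp_perm (y : Fin 5 → R) (π : Equiv.Perm (Fin 5)) :
    symA (y ∘ π) = symA y ∧ symB (y ∘ π) = symB y ∧ symC (y ∘ π) = symC y := by
  have h : ∏ i, (X - C ((y ∘ π) i)) = ∏ i, (X - C (y i)) := Equiv.prod_comp π fun i => X - C (y i)
  have h1 := coeff_prod_X_sub_C (y ∘ π)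
  rw [h] at h1
  have h2 := coeff_prod_X_sub_C y
  exact ⟨h1.2.2.1.symm.trans h2.2.2.1, h1.2.2.2.1.symm.trans h2.2.2.2.1,
    h1.2.2.2.2.symm.trans h2.2.2.2.2⟩

theorem map_sym {S : Type*} [CommRing S] (φ : R →+* S) (y : Fin 5 → R) :
    φ (symA y) = symA (φ ∘ y) ∧ φ (symB y) = symB (φ ∘ y) ∧ φ (symC y) = symC (φ ∘ y) := by
  simp [symA, symB, symC]

theorem sym_mul (t : R) (y : Fin 5 → R) :
    symA (fun i => t * y i) = t ^ 3 * symA y ∧ symB (fun i => t * y i) = t ^ 4 * symB y ∧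
    symC (fun i => t * y i) = t ^ 5 * symC y := by
  refine ⟨?_, ?_, ?_⟩ <;> simp only [symA, symB, symC] <;> ring

theorem quintic_eq_prod_of_sum [IsDomain R] [CharZero R] {y : Fin 5 → R} (h1 : ∑ i, y i = 0)
    (h2 : y ⬝ᵥ y = 0) :
    quintic (symA y) (symB y) (symC y) = ∏ i, (X - C (y i)) := by
  rw [sum_sq_eq, h1] at h2
  have h3 : symTwo y = 0 := by simpa using h2
  rw [prod_X_sub_C_eq, h1, h3, quintic]
  simp

theorem sym_of_quintic_eq_prod {a b c : R} {x : Fin 5 → R}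
    (h : quintic a b c = ∏ i, (X - C (x i))) :
    ∑ i, x i = 0 ∧ x ⬝ᵥ x = 0 ∧ symA x = a ∧ symB x = b ∧ symC x = c := by
  have h1 := coeff_prod_X_sub_C x
  rw [← h] at h1
  simp only [quintic, coeff_add, coeff_X_pow, coeff_C_mul, coeff_X, coeff_C] at h1
  norm_num at h1
  obtain ⟨e1, e2, e3, e4, e5⟩ := h1
  refine ⟨e1, ?_, e3.symm, e4.symm, e5.symm⟩
  rw [sum_sq_eq, e1, ← e2]
  ring

theorem exists_eq_prod_of_quintic {k : Type*} [Field k] [IsAlgClosed k] (a b c : k) :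
    ∃ x : Fin 5 → k, quintic a b c = ∏ i, (X - C (x i)) := by
  have hs := IsAlgClosed.splits (quintic a b c)
  have hcard : (quintic a b c).roots.toList.length = 5 := by
    rw [Multiset.length_toList, ← hs.natDegree_eq_card_roots, quintic_natDegree]
  have hprod := hs.eq_prod_roots_of_monic (quintic_monic a b c)
  refine ⟨fun i => (quintic a b c).roots.toList.get (i.cast hcard.symm), ?_⟩
  conv_lhs => rw [hprod, ← Multiset.coe_toList (quintic a b c).roots]
  rw [Multiset.map_coe, Multiset.prod_coe]
  rw [← List.ofFn_get (List.map _ _), List.prod_ofFn]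
  refine Fintype.prod_equiv (finCongr (by simpa using hcard)) _ _ fun i => ?_
  simp

theorem prod_sub_eq_det (x : Fin 5 → R) : ∏ i, ∏ j ∈ Finset.Ioi i, (x i - x j) =
    (Matrix.vandermonde fun i => -x i).det := by
  rw [Matrix.det_vandermonde]
  exact Finset.prod_congr rfl fun i _ => Finset.prod_congr rfl fun j _ => by ring

theorem prod_sub_comp_perm (x : Fin 5 → R) (π : Equiv.Perm (Fin 5)) :
    ∏ i, ∏ j ∈ Finset.Ioi i, ((x ∘ π) i - (x ∘ π) j) =
      (Equiv.Perm.sign π : ℤ) * ∏ i, ∏ j ∈ Finset.Ioi i, (x i - x j) := by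
  rw [prod_sub_eq_det, prod_sub_eq_det, ← Matrix.det_permute]
  rfl

theorem injective_of_prod_sub_ne_zero [IsDomain R] {x : Fin 5 → R}
    (h : ∏ i, ∏ j ∈ Finset.Ioi i, (x i - x j) ≠ 0) : Function.Injective x := by
  rw [prod_sub_eq_det, Matrix.det_vandermonde_ne_zero_iff] at h
  exact fun i j hij => h (congrArg _ hij)

end Symmetric

/-! ### Tschirnhaus transformations by reflection -/

section Tschirnhaus

open Polynomial

variable {R : Type*} [CommRing R]

/-- A multiple of the reflection of `x` in the hyperplane orthogonal to `v`. -/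
def reflect (x v : Fin 5 → R) : Fin 5 → R := fun i => x i * (v ⬝ᵥ v) - 2 * v i * (x ⬝ᵥ v)

theorem reflect_sum {x v : Fin 5 → R} (hx : ∑ i, x i = 0) (hv : ∑ i, v i = 0) :
    ∑ i, reflect x v i = 0 := by
  simp only [reflect, Finset.sum_sub_distrib, ← Finset.sum_mul, ← Finset.mul_sum, hx, hv]
  ring

theorem reflect_dotProduct {x v : Fin 5 → R} (hx : x ⬝ᵥ x = 0) :
    reflect x v ⬝ᵥ reflect x v = 0 := by
  have : reflect x v = (v ⬝ᵥ v) • x - (2 * (x ⬝ᵥ v)) • v := by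
    ext i; simp only [reflect, Pi.sub_apply, Pi.smul_apply, smul_eq_mul]; ring
  rw [this]
  simp only [sub_dotProduct, dotProduct_sub, smul_dotProduct, dotProduct_smul, hx, smul_eq_mul,
    dotProduct_comm v x]
  ring

theorem map_reflect {S : Type*} [CommRing S] (φ : R →+* S) (x v : Fin 5 → R) :
    φ ∘ reflect x v = reflect (φ ∘ x) (φ ∘ v) := by
  ext i
  simp [reflect, dotProduct, map_ofNat]

theorem reflect_comp_perm (x v : Fin 5 → R) (π : Equiv.Perm (Fin 5)) :
    reflect (x ∘ π) (v ∘ π) = reflect x v ∘ π := by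
  ext i
  simp [reflect]

/-- Reflection along x - w carries one isotropic vector to a multiple of the other, so every
isotropic w not orthogonal to x is reached up to scale. -/
theorem reflect_sub {x w : Fin 5 → R} (hx : x ⬝ᵥ x = 0) (hw : w ⬝ᵥ w = 0) :
    reflect x (x - w) = fun i => -2 * (x ⬝ᵥ w) * w i := by
  ext i
  simp only [reflect, sub_dotProduct, dotProduct_sub, hx, hw, dotProduct_comm w x, Pi.sub_apply]
  ring

/-- The trace zero vector attached to the polynomial with coefficients `c`. -/
def traceless {k : Type*} [Field k] [Algebra k R] (x : Fin 5 → k) (c : Fin 5 → R) : Fin 5 → R :=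
  fun i => ∑ l : Fin 5, c l * algebraMap k R (x i ^ (l : ℕ) - (∑ j, x j ^ (l : ℕ)) / 5)

theorem traceless_sum {k : Type*} [Field k] [CharZero k] [Algebra k R] (x : Fin 5 → k)
    (c : Fin 5 → R) : ∑ i, traceless x c i = 0 := by
  simp only [traceless]
  rw [Finset.sum_comm]
  refine Finset.sum_eq_zero fun l _ => ?_
  rw [← Finset.mul_sum, ← map_sum, Finset.sum_sub_distrib]
  simp only [Finset.sum_const, Finset.card_univ, Fintype.card_fin, nsmul_eq_mul]
  rw [Nat.cast_ofNat, mul_div_cancel₀ _ (by norm_num), sub_self, map_zero, mul_zero]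

/-- Interpolation: distinct nodes make the Vandermonde matrix invertible, and subtracting the mean
has no effect on a vector of sum zero. -/
theorem exists_traceless_eq {k : Type*} [Field k] {x v : Fin 5 → k}
    (hx : Function.Injective x) (hv : ∑ i, v i = 0) : ∃ c : Fin 5 → k, traceless x c = v := by
  have hdet := Matrix.det_vandermonde_ne_zero_iff.mpr hx
  have hV : (Matrix.vandermonde x) * (Matrix.vandermonde x)⁻¹ = 1 :=
    Matrix.mul_nonsing_inv _ (isUnit_iff_ne_zero.mpr hdet)
  refine ⟨(Matrix.vandermonde x)⁻¹.mulVec v, ?_⟩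
  have h1 : (Matrix.vandermonde x).mulVec ((Matrix.vandermonde x)⁻¹.mulVec v) = v := by
    rw [Matrix.mulVec_mulVec, hV, Matrix.one_mulVec]
  generalize (Matrix.vandermonde x)⁻¹.mulVec v = c at h1
  have h2 (i : Fin 5) : ∑ l : Fin 5, c l * x i ^ (l : ℕ) = v i := by
    rw [← congrFun h1 i]
    simp [Matrix.mulVec, dotProduct, Matrix.vandermonde_apply, mul_comm]
  ext i
  simp only [traceless, Algebra.algebraMap_self, RingHom.id_apply, mul_sub, Finset.sum_sub_distrib,
    h2]
  have h3 : ∑ l : Fin 5, c l * ((∑ j, x j ^ (l : ℕ)) / 5) = 0 := by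
    simp only [mul_div_assoc', ← Finset.sum_div, Finset.mul_sum]
    rw [Finset.sum_comm]
    simp only [h2, hv, zero_div]
  rw [h3, sub_zero]

/-- The product of the invariants whose vanishing is to be avoided. -/
def badLocus (y : Fin 5 → R) : R :=
  invD (symA y) (symB y) (symC y) * invG (symA y) (symB y) (symC y) *
    invK (symA y) (symB y) (symC y) * invE (symA y) (symB y) (symC y)

theorem map_badLocus {S : Type*} [CommRing S] (φ : R →+* S) (y : Fin 5 → R) :
    φ (badLocus y) = badLocus (φ ∘ y) := by
  obtain ⟨ha, hb, hc⟩ := map_sym φ y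
  simp [badLocus, invD, invG, invK, invE, ha, hb, hc, map_ofNat]

/-- If all products vanished, comparing the identity with the transposition of 0 and 1 would give
(x₀ - x₁)(w₀ - w₁) = 0. -/
theorem exists_dotProduct_ne_zero [IsDomain R] {x w : Fin 5 → R} (hx : Function.Injective x)
    (hw : Function.Injective w) : ∃ π : Equiv.Perm (Fin 5), x ⬝ᵥ (w ∘ π) ≠ 0 := by
  by_contra! h
  have h0 := h 1
  have h1 := h (Equiv.swap 0 1)
  have e0 : Equiv.swap (0 : Fin 5) 1 2 = 2 := by decide
  have e1 : Equiv.swap (0 : Fin 5) 1 3 = 3 := by decide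
  have e2 : Equiv.swap (0 : Fin 5) 1 4 = 4 := by decide
  simp [dotProduct, Fin.sum_univ_five, e0, e1, e2] at h0 h1
  have h2 : (x 0 - x 1) * (w 0 - w 1) = 0 := by linear_combination h0 - h1
  rcases mul_eq_zero.mp h2 with h3 | h3
  · exact absurd (hx (sub_eq_zero.mp h3)) (by decide)
  · exact absurd (hw (sub_eq_zero.mp h3)) (by decide)

theorem exists_traceless_badLocus_ne_zero {k : Type*} [Field k] [IsAlgClosed k] [CharZero k]
    {x : Fin 5 → k} (hx : Function.Injective x) (h1 : ∑ i, x i = 0) (h2 : x ⬝ᵥ x = 0) :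
    ∃ c : Fin 5 → k, badLocus (reflect x (traceless x c)) ≠ 0 := by
  -- The quintic x⁵ + x + 1 avoids the bad locus; its roots, suitably ordered, are reached from x by
  -- one reflection up to scale.
  obtain ⟨w, hw⟩ := exists_eq_prod_of_quintic (0 : k) 1 1
  have hwinj : Function.Injective w := by
    apply injective_of_prod_sub_ne_zero
    intro h0
    have h3 := quintic_discr_eq_sq hw
    have h4 := five_mul_discr_quintic (0 : k) 1 1
    rw [h3, h0] at h4
    norm_num [invE] at h4
  obtain ⟨s1, s2, sA, sB, sC⟩ := sym_of_quintic_eq_prod hw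
  obtain ⟨π, hπ⟩ := exists_dotProduct_ne_zero hx hwinj
  have s1' : ∑ i, (w ∘ π) i = 0 := (Equiv.sum_comp π w).trans s1
  have s2' : (w ∘ π) ⬝ᵥ (w ∘ π) = 0 := by rw [comp_equiv_dotProduct_comp_equiv, s2]
  obtain ⟨c, hc⟩ := exists_traceless_eq hx (v := x - w ∘ π)
    (by simp only [Pi.sub_apply, Finset.sum_sub_distrib, h1, s1', sub_self])
  refine ⟨c, ?_⟩
  rw [hc, reflect_sub h2 s2']
  obtain ⟨tA, tB, tC⟩ := sym_mul (-2 * (x ⬝ᵥ w ∘ π)) (w ∘ π)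
  obtain ⟨pA, pB, pC⟩ := sym_comp_perm w π
  rw [badLocus, tA, tB, tC, pA, pB, pC, sA, sB, sC]
  have ht : -2 * (x ⬝ᵥ w ∘ π) ≠ 0 := mul_ne_zero (by norm_num) hπ
  generalize -2 * (x ⬝ᵥ w ∘ π) = t at ht
  have : invD (t ^ 3 * 0) (t ^ 4 * 1) (t ^ 5 * 1) * invG (t ^ 3 * 0) (t ^ 4 * 1) (t ^ 5 * 1) *
      invK (t ^ 3 * 0) (t ^ 4 * 1) (t ^ 5 * 1) * invE (t ^ 3 * 0) (t ^ 4 * 1) (t ^ 5 * 1) =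
      (-5 * (3125 - 144) * (-2025000 - 9765625) * (1280 + 15625)) * t ^ 82 := by
    simp only [invD, invG, invK, invE]; ring
  rw [this]
  exact mul_ne_zero (by norm_num) (pow_ne_zero _ ht)

theorem exists_rat_traceless_badLocus_ne_zero {k : Type*} [Field k] [IsAlgClosed k] [CharZero k]
    {x : Fin 5 → k} (hx : Function.Injective x) (h1 : ∑ i, x i = 0) (h2 : x ⬝ᵥ x = 0) :
    ∃ c : Fin 5 → ℚ, badLocus (reflect x (traceless x fun i => (c i : k))) ≠ 0 := by
  obtain ⟨c₀, hc₀⟩ := exists_traceless_badLocus_ne_zero hx h1 h2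
  have heval (c : Fin 5 → k) : MvPolynomial.eval c (badLocus (reflect (MvPolynomial.C ∘ x)
      (traceless x (MvPolynomial.X (R := k))))) = badLocus (reflect x (traceless x c)) := by
    rw [map_badLocus, map_reflect]
    congr 2
    · ext i; simp
    · ext i; simp [traceless, MvPolynomial.algebraMap_eq]
  by_contra! h
  apply hc₀
  rw [← heval]
  -- As a polynomial in c, the bad locus would vanish on the Zariski dense set of rational points
  -- and hence identically.
  have : badLocus (reflect (MvPolynomial.C ∘ x) (traceless x (MvPolynomial.X (R := k)))) = 0 := by
    refine MvPolynomial.funext_set (fun _ => Set.range (Rat.cast : ℚ → k))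
      (fun _ => Set.infinite_range_of_injective Rat.cast_injective) fun y hy => ?_
    choose c hc using fun i => hy i (Set.mem_univ i)
    obtain rfl : (fun i => (c i : k)) = y := funext hc
    rw [heval, h, map_zero]
  rw [this, map_zero]

end Tschirnhaus

/-! ### Reduction to a non-degenerate quintic -/

section Reduction

open Polynomial IntermediateField

theorem exists_perm_of_rootSet {a b c : ℚ} {x : Fin 5 → Qbar} (hx : Function.Injective x)
    (h : quintic (a : Qbar) b c = ∏ i, (X - C (x i))) (σ : Qbar ≃ₐ[ℚ] Qbar) :
    ∃ π : Equiv.Perm (Fin 5), ∀ i, σ (x i) = x (π i) := by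
  have hmem (i : Fin 5) : ∃ j, x j = σ (x i) := by
    have h1 : σ (x i) ∈ (quintic a b c).rootSet Qbar := by
      have h0 : x i ∈ (quintic a b c).rootSet Qbar := by
        rw [rootSet_quintic_eq_range h]; exact ⟨i, rfl⟩
      rw [mem_rootSet] at h0 ⊢
      exact ⟨h0.1, by rw [aeval_algHom_apply, h0.2, map_zero]⟩
    rwa [rootSet_quintic_eq_range h] at h1
  choose f hf using hmem
  have hinj : Function.Injective f := fun i j hij => by
    apply hx
    apply σ.injective
    rw [← hf, ← hf, hij]
  exact ⟨Equiv.ofBijective f (Finite.injective_iff_bijective.mp hinj), fun i => (hf i).symm⟩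

theorem exists_rat_of_fixed {x : Qbar} (h : ∀ σ : Qbar ≃ₐ[ℚ] Qbar, σ x = x) : ∃ q : ℚ, (q : Qbar) = x := by
  have hx : x ∈ (⊥ : IntermediateField ℚ Qbar) := mem_of_fixed ⊥ fun σ _ => h σ
  obtain ⟨q, hq⟩ := IntermediateField.mem_bot.mp hx
  exact ⟨q, by rw [← hq]; simp⟩

theorem map_traceless {x : Fin 5 → Qbar} {c : Fin 5 → ℚ} {σ : Qbar ≃ₐ[ℚ] Qbar}
    {π : Equiv.Perm (Fin 5)} (h : ∀ i, σ (x i) = x (π i)) :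
    (σ : Qbar →+* Qbar) ∘ traceless x (fun i => (c i : Qbar)) =
      traceless x (fun i => (c i : Qbar)) ∘ π := by
  ext i
  have hs (l : ℕ) : ∑ j, x (π j) ^ l = ∑ j, x j ^ l := Equiv.sum_comp π fun j => x j ^ l
  simp [traceless, h, hs, map_ofNat]

/-- Reflecting the roots along a trace-zero rational polynomial in them commutes with Galois and
preserves the vanishing of the sum and of the sum of squares. The new roots thus belong to another
rational principal quintic, and generic coefficients make it non-degenerate and separable. -/
theorem exists_nondegenerate_quintic {A B C' : ℚ} (hdisc : (quintic A B C').discr ≠ 0) :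
    ∃ a b c r : ℚ, invD a b c ≠ 0 ∧ IsNondegenerate a b c ∧ (quintic a b c).discr ≠ 0 ∧ r ≠ 0 ∧
      (quintic a b c).discr = r ^ 2 * (quintic A B C').discr ∧
      adjoin ℚ ((quintic a b c).rootSet Qbar) = adjoin ℚ ((quintic A B C').rootSet Qbar) := by
  obtain ⟨x, hx⟩ := exists_eq_prod_of_quintic (A : Qbar) B C'
  have hdx := quintic_discr_eq_sq hx
  rw [discr_cast] at hdx
  have hVx : ∏ i, ∏ j ∈ Finset.Ioi i, (x i - x j) ≠ 0 := by
    intro h0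
    rw [h0] at hdx
    exact hdisc (by exact_mod_cast hdx.trans (by ring : (0 : Qbar) ^ 2 = 0))
  have hinj := injective_of_prod_sub_ne_zero hVx
  obtain ⟨h1, h2, -, -, -⟩ := sym_of_quintic_eq_prod hx
  obtain ⟨c, hc⟩ := exists_rat_traceless_badLocus_ne_zero hinj h1 h2
  obtain ⟨y, hy⟩ : ∃ y, y = reflect x (traceless x fun i => (c i : Qbar)) := ⟨_, rfl⟩
  rw [← hy] at hc
  have hσ {σ : Qbar ≃ₐ[ℚ] Qbar} {π : Equiv.Perm (Fin 5)} (h : ∀ i, σ (x i) = x (π i)) :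
      (σ : Qbar →+* Qbar) ∘ y = y ∘ π := by
    rw [hy, map_reflect, map_traceless h, ← reflect_comp_perm]
    congr 1
    ext i
    exact h i
  have hperm := exists_perm_of_rootSet hinj hx
  have hfix (σ : Qbar ≃ₐ[ℚ] Qbar) : σ (symA y) = symA y ∧ σ (symB y) = symB y ∧
      σ (symC y) = symC y := by
    obtain ⟨π, hπ⟩ := hperm σ
    have e := map_sym (σ : Qbar →+* Qbar) y
    rw [hσ hπ] at e
    obtain ⟨p1, p2, p3⟩ := sym_comp_perm y π
    rw [p1, p2, p3] at e
    exact e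
  obtain ⟨a, ha⟩ := exists_rat_of_fixed fun σ => (hfix σ).1
  obtain ⟨b, hb⟩ := exists_rat_of_fixed fun σ => (hfix σ).2.1
  obtain ⟨c', hc'⟩ := exists_rat_of_fixed fun σ => (hfix σ).2.2
  have hq : quintic (a : Qbar) b c' = ∏ i, (X - C (y i)) := by
    rw [ha, hb, hc']
    apply quintic_eq_prod_of_sum
    · rw [hy]; exact reflect_sum h1 (traceless_sum x _)
    · rw [hy]; exact reflect_dotProduct h2
  have hbad : invD a b c' * invG a b c' * invK a b c' * invE a b c' ≠ 0 := by
    intro h0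
    apply hc
    rw [badLocus, ← ha, ← hb, ← hc']
    have := congrArg (Rat.cast : ℚ → Qbar) h0
    simpa [invD, invG, invK, invE] using this
  simp only [mul_ne_zero_iff] at hbad
  obtain ⟨⟨⟨hD, hG⟩, hK⟩, hE⟩ := hbad
  have hdy := quintic_discr_eq_sq hq
  rw [discr_cast] at hdy
  have hdisc' : (quintic a b c').discr ≠ 0 := by
    intro h0
    apply hE
    rw [← five_mul_discr_quintic, h0, mul_zero]
  have hVy : ∏ i, ∏ j ∈ Finset.Ioi i, (y i - y j) ≠ 0 := by
    intro h0
    rw [h0] at hdy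
    exact hdisc' (by exact_mod_cast hdy.trans (by ring : (0 : Qbar) ^ 2 = 0))
  have hinjy := injective_of_prod_sub_ne_zero hVy
  -- Each automorphism permutes both root systems by the same permutation, so both difference
  -- products change by the same sign and their quotient is rational.
  obtain ⟨r, hr⟩ : ∃ r : ℚ, (r : Qbar) = (∏ i, ∏ j ∈ Finset.Ioi i, (y i - y j)) /
      ∏ i, ∏ j ∈ Finset.Ioi i, (x i - x j) := by
    apply exists_rat_of_fixed
    intro σ
    obtain ⟨π, hπ⟩ := hperm σ
    have ey (i : Fin 5) : σ (y i) = (y ∘ π) i := congrFun (hσ hπ) i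
    have ex (i : Fin 5) : σ (x i) = (x ∘ π) i := hπ i
    simp only [map_div₀, map_prod, map_sub, ex, ey]
    rw [prod_sub_comp_perm, prod_sub_comp_perm]
    refine mul_div_mul_left _ _ ?_
    rcases Int.units_eq_one_or (Equiv.Perm.sign π) with h | h <;> simp [h]
  have g4 : gamma4 a b c' = invG a b c' / (12 ^ 2 * 5 ^ 5) := rfl
  have g6 : gamma6 a b c' = invK a b c' / (12 ^ 3 * 5 ^ 10) := rfl
  have hg4 : gamma4 a b c' ≠ 0 := by rw [g4]; exact div_ne_zero hG (by norm_num)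
  have hg6 : gamma6 a b c' ≠ 0 := by rw [g6]; exact div_ne_zero hK (by norm_num)
  refine ⟨a, b, c', r, hD, ⟨fun h => hg4 h.1, fun h => hg6 h.1, fun h => hg4 h.1⟩, hdisc', ?_, ?_, ?_⟩
  · rintro rfl
    exact div_ne_zero hVy hVx (by rw [← hr]; simp)
  · have : (((quintic a b c').discr : ℚ) : Qbar) = ((r ^ 2 * (quintic A B C').discr : ℚ) : Qbar) := by
      push_cast
      rw [hdy, hdx, hr]
      field_simp
    exact_mod_cast this
  · rw [rootSet_quintic_eq_range hq, rootSet_quintic_eq_range hx]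
    apply le_antisymm <;> rw [adjoin_le_iff] <;> rintro _ ⟨i, rfl⟩ <;> apply mem_of_fixed <;>
      intro σ hfixed
    · have e : ∀ i, σ (x i) = x ((1 : Equiv.Perm (Fin 5)) i) := fun i =>
        hfixed _ (subset_adjoin _ _ ⟨i, rfl⟩)
      exact congrFun (hσ e) i
    -- Since the transformed roots are distinct, an automorphism fixing all of them induces the
    -- trivial permutation and fixes the old roots.
    · obtain ⟨π, hπ⟩ := hperm σ
      have e : y (π i) = y i :=
        (congrFun (hσ hπ) i).symm.trans (hfixed _ (subset_adjoin _ _ ⟨i, rfl⟩))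
      rw [hπ, hinjy e]

end Reduction

/-! ### Solving j(z) = j -/

section Klein

theorem formH_ne_zero_of_formF {F : Type*} [Field F] [CharZero F] {z : F} (h : formF z = 0) :
    formH z ≠ 0 := by
  rw [formF, mul_eq_zero] at h
  rcases h with rfl | h
  · simp [formH]
  · have hH : formH z = 3125 * (z ^ 5) ^ 2 := by
      rw [formH]
      linear_combination (z ^ 10 - 239 * z ^ 5 - 1) * h
    have hz : z ≠ 0 := by rintro rfl; norm_num at h
    rw [hH]
    exact mul_ne_zero (by norm_num) (pow_ne_zero _ (pow_ne_zero _ hz))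

/-- The polynomial H³ + jf⁵ has degree 60, hence a root. There f ≠ 0 because f and H have no common
zero, while j ≠ 0 and j ≠ 1728 exclude zeros of H and T. -/
theorem exists_jVal_eq {F : Type*} [Field F] [IsAlgClosed F] [CharZero F] {j : F} (h0 : j ≠ 0)
    (h1 : j ≠ 1728) : ∃ z : F, formF z ≠ 0 ∧ formH z ≠ 0 ∧ formT z ≠ 0 ∧ jVal z = j := by
  open Polynomial in
  obtain ⟨z, hz⟩ : ∃ z : F, formH z ^ 3 + j * formF z ^ 5 = 0 := by
    have hdeg : (formH (X : F[X]) ^ 3 + C j * formF X ^ 5).natDegree = 60 := by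
      have hH : (formH (X : F[X])).natDegree = 20 := by rw [formH]; compute_degree!
      have hF : (formF (X : F[X])).natDegree ≤ 11 := by rw [formF]; compute_degree
      have h60 : (formH (X : F[X]) ^ 3).natDegree = 60 := by rw [natDegree_pow, hH]
      rw [natDegree_add_eq_left_of_natDegree_lt, h60]
      rw [h60]
      refine (natDegree_C_mul_le _ _).trans_lt (natDegree_pow_le.trans_lt ?_)
      lia
    obtain ⟨z, hz⟩ := IsAlgClosed.exists_root (formH (X : F[X]) ^ 3 + C j * formF X ^ 5) (by
      rw [degree_eq_natDegree (by rintro e; rw [e] at hdeg; simp at hdeg), hdeg]; norm_num)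
    refine ⟨z, ?_⟩
    simpa [IsRoot, formH, formF] using hz
  have hf : formF z ≠ 0 := by
    intro e
    rw [e] at hz
    exact formH_ne_zero_of_formF e (pow_eq_zero_iff (n := 3) (by norm_num) |>.mp (by linear_combination hz))
  have hj : jVal z = j := by
    rw [jVal, div_eq_iff (pow_ne_zero _ hf)]
    linear_combination -hz
  refine ⟨z, hf, ?_, ?_, hj⟩
  · intro e
    exact h0 (by rw [← hj, jVal, e]; simp)
  · intro e
    have := sub_jVal hf
    rw [e, hj] at this
    exact h1 (by linear_combination -this)

end Klein

/-! ### Assembly over ℚ(√(5 Disc)) -/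

section Main

open Polynomial IntermediateField

theorem quintic_eq_prod_X_sub_C_resVal {F : Type*} [Field F] [CharZero F] {ζ z : F}
    (hζ : IsPrimitiveRoot ζ 5) (m n : F) (hf : formF z ≠ 0) (hH : formH z ≠ 0)
    (hT : formT z ≠ 0) :
    quintic (coeffA m n (jVal z)) (coeffB m n (jVal z)) (coeffC m n (jVal z)) =
      ∏ ν : Fin 5, (X - C (resVal m n (ζ ^ (ν : ℕ) * z))) := by
  apply Polynomial.funext
  intro y
  have h := quintic_eq_prod_resVal hζ m n hf hH hT y
  simpa [quintic, Fin.prod_univ_five, eval_mul] using h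

theorem exists_resolvent_over_adjoin {A B C' : ℚ} (hD : invD A B C' ≠ 0)
    (hnd : IsNondegenerate A B C') {d e : Qbar} (he : e ∈ adjoin ℚ {d})
    (hd : e ^ 2 = algebraMap ℚ Qbar (5 * (quintic A B C').discr)) :
    ∃ m n j : adjoin ℚ {d}, j ≠ 0 ∧ j ≠ 1728 ∧
      algebraMap ℚ (adjoin ℚ {d}) A = coeffA m n j ∧
      algebraMap ℚ (adjoin ℚ {d}) B = coeffB m n j ∧
      algebraMap ℚ (adjoin ℚ {d}) C' = coeffC m n j := by
  have h : (⟨e, he⟩ : adjoin ℚ {d}) ^ 2 = ((invE A B C' : ℚ) : adjoin ℚ {d}) := by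
    apply Subtype.ext
    rw [← five_mul_discr_quintic]
    exact hd.trans ((eq_ratCast _ _).trans (map_ratCast (algebraMap (adjoin ℚ {d}) Qbar) _).symm)
  simpa only [eq_ratCast] using exists_resolvent_of_isNondegenerate hD hnd h

theorem exists_ellipticCurve {A B C' : ℚ} (hdisc : (quintic A B C').discr ≠ 0) {d : Qbar}
    (hd : d ^ 2 = algebraMap ℚ Qbar (5 * (quintic A B C').discr)) :
    ∃ E : WeierstrassCurve (adjoin ℚ {d}), E.IsElliptic ∧
      (adjoin (adjoin ℚ {d}) (fiveTorsionSums (E.baseChange Qbar))).restrictScalars ℚ =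
        adjoin ℚ ((quintic A B C').rootSet Qbar) ⊔ adjoin ℚ {d} := by
  obtain ⟨a, b, c, r, hD, hnd, hdisc', -, hr, hroot⟩ := exists_nondegenerate_quintic hdisc
  have hdK : d ∈ adjoin ℚ {d} := mem_adjoin_simple_self ℚ d
  -- The discriminants differ by r², so rd is the required square root for the transformed quintic
  -- and the base field stays the same.
  have he : (r : Qbar) * d ∈ adjoin ℚ {d} := mul_mem (SubfieldClass.ratCast_mem _ r) hdK
  have hd' : ((r : Qbar) * d) ^ 2 = algebraMap ℚ Qbar (5 * (quintic a b c).discr) := by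
    rw [mul_pow, hd, hr]
    simp only [eq_ratCast]
    push_cast
    ring
  obtain ⟨m, n, j, hj0, hj1, ha, hb, hc⟩ := exists_resolvent_over_adjoin hD hnd he hd'
  have hj0' : (j : Qbar) ≠ 0 := fun h => hj0 (Subtype.ext h)
  have hj1' : (j : Qbar) ≠ 1728 := fun h => hj1 (Subtype.ext h)
  obtain ⟨z, hf, hH, hT, hz⟩ := exists_jVal_eq hj0' hj1'
  obtain ⟨ζ, hζ⟩ : ∃ ζ : Qbar, IsPrimitiveRoot ζ 5 := HasEnoughRootsOfUnity.exists_primitiveRoot Qbar 5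
  have hq : quintic (a : Qbar) b c =
      ∏ ν : Fin 5, (X - C (resVal (m : Qbar) n (ζ ^ (ν : ℕ) * z))) := by
    rw [← quintic_eq_prod_X_sub_C_resVal hζ m n hf hH hT, hz]
    have ha' := congrArg (algebraMap (adjoin ℚ {d}) Qbar) ha
    have hb' := congrArg (algebraMap (adjoin ℚ {d}) Qbar) hb
    have hc' := congrArg (algebraMap (adjoin ℚ {d}) Qbar) hc
    have em : algebraMap (adjoin ℚ {d}) Qbar m = (m : Qbar) := rfl
    have en : algebraMap (adjoin ℚ {d}) Qbar n = (n : Qbar) := rfl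
    have ej : algebraMap (adjoin ℚ {d}) Qbar j = (j : Qbar) := rfl
    simp only [coeffA, coeffB, coeffC, map_neg, map_mul, map_div₀, map_add, map_sub, map_pow,
      map_ofNat, map_one, em, en, ej, eq_ratCast, map_ratCast] at ha' hb' hc'
    rw [ha', hb', hc']
    rfl
  rw [← hroot]
  exact exists_ellipticCurve_of_resVal hζ hf hH hT m.2 n.2 (by rw [hz]; exact j.2) hq he hd' hdisc'

end Main

end Icosahedral

end

theorem mainTheorem7 (A B C : ℚ) (hδ : A ^ 4 - 5 * B ^ 3 + 25 * A * B * C ≠ 0) :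
    -- Klein's function and the resolvents
    (∀ ζ : Qbar, IsPrimitiveRoot ζ 5 →
      Nonempty (Icosahedral.icosahedralGroup ζ ≃* alternatingGroup (Fin 5)) ∧
      Icosahedral.kleinJ ζ =
        (Icosahedral.mu ^ 2 + 10 * Icosahedral.mu + 5) ^ 3 / Icosahedral.mu ∧
      (∀ M : GL (Fin 2) Qbar,
        Matrix.ProjGenLinGroup.mk M ∈ Icosahedral.icosahedralGroup ζ →
          Icosahedral.comp (Icosahedral.kleinJ ζ) (Icosahedral.moebius M) =
            Icosahedral.kleinJ ζ) ∧
      (∀ m n : Qbar,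
        Icosahedral.quintic
            (Icosahedral.coeffA (RatFunc.C m) (RatFunc.C n) (Icosahedral.kleinJ ζ))
            (Icosahedral.coeffB (RatFunc.C m) (RatFunc.C n) (Icosahedral.kleinJ ζ))
            (Icosahedral.coeffC (RatFunc.C m) (RatFunc.C n) (Icosahedral.kleinJ ζ)) =
          ∏ ν : Fin 5, (Polynomial.X - Polynomial.C (Icosahedral.resolvent ζ m n ν)))) ∧
    -- every non-degenerate quintic is a resolvent quintic over `ℚ(√(5 Disc q))`
    (Icosahedral.IsNondegenerate A B C →
      ∀ d : Qbar, d ^ 2 = algebraMap ℚ Qbar (5 * (Icosahedral.quintic A B C).discr) →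
        ∃ m n j : IntermediateField.adjoin ℚ {d},
          j ≠ 0 ∧ j ≠ 1728 ∧
          algebraMap ℚ (IntermediateField.adjoin ℚ {d}) A = Icosahedral.coeffA m n j ∧
          algebraMap ℚ (IntermediateField.adjoin ℚ {d}) B = Icosahedral.coeffB m n j ∧
          algebraMap ℚ (IntermediateField.adjoin ℚ {d}) C = Icosahedral.coeffC m n j) ∧
    -- the associated elliptic curve
    ((Icosahedral.quintic A B C).discr ≠ 0 →
      ∀ d : Qbar, d ^ 2 = algebraMap ℚ Qbar (5 * (Icosahedral.quintic A B C).discr) →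
        ∃ E : WeierstrassCurve (IntermediateField.adjoin ℚ {d}),
          E.IsElliptic ∧
          (IntermediateField.adjoin (IntermediateField.adjoin ℚ {d})
              (Icosahedral.fiveTorsionSums (E.baseChange Qbar))).restrictScalars ℚ =
            IntermediateField.adjoin ℚ ((Icosahedral.quintic A B C).rootSet Qbar) ⊔
              IntermediateField.adjoin ℚ {d}) := by
  refine ⟨fun ζ hζ => ⟨Icosahedral.icosahedralGroup_mulEquiv hζ, Icosahedral.kleinJ_eq_mu hζ,
    fun M hM => Icosahedral.comp_kleinJ_moebius hζ hM,
    fun m n => Icosahedral.quintic_eq_prod_resolvent hζ m n⟩, fun hnd d hd => ?_,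
    fun hdisc d hd => Icosahedral.exists_ellipticCurve hdisc hd⟩
  exact Icosahedral.exists_resolvent_over_adjoin hδ hnd
    (IntermediateField.mem_adjoin_simple_self ℚ d) hd
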